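/- **Model.** A register is classical or quantum and has a finite basis. A gate is a unitary on quantum registers, a permutation of the values of classical registers, or a measurement into a fresh classical register; it may be classically controlled, and it may sleep until an activation register has been set. A circuit is a finite set of gates with a partial ordering that depends on the initial values of the classical registers (where a register that stores the outcome of a measurement has this outcome as initial value), such that any two gates that can both be active and access a same register are ordered. A *protocol* is a finite set of role-circuits; each has its own registers, its own ordering, and shares only channel registers with other circuits. A channel register is insecure, authenticated (others can read it if it is classical, and cannot access it if it is quantum), or hidden. A corruptible role-circuit $r$ has a corruption register $C_r$, and its gates are active only if $C_r=0$. Some channel registers are designated as input/output channels. A *valid environment* $E$ for a protocol $P$ is a circuit with its own registers and an output bit $Z$, together with a choice of the relative order of its gates and those of $P$, and of the communication gates of distinct circuits of $P$ that share a channel register, such that $E+P$ is a circuit. Its gates may access its own registers, the input/output channels, the corruption registers, the other channels in accordance with their types, and, if active only when $C_r=1$, the registers of $r$ and the channels of $r$ in the name of $r$. An *ideal protocol* $I$ for $P$ is a protocol that shares with $P$ only the input/output channels and corruption registers; every circuit of $P$ that uses an input/output channel has a counterpart in $I$ with the same identity and corruption register. A *valid simulator* $S$ (which may depend on $E$) is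 a circuit that owns private registers and simulated copies of the registers of $P$ not shared with $I$, can read but never modify the corruption registers of $I$, and otherwise interacts with $I$ only by gates that are active only when some circuit $r$ of $I$ is corrupted, which access the registers of $r$, the channels of $r$ in the name of $r$, and the internal channels of $I$ in accordance with their types; $E+I+S$ must be a circuit. $P$ *$\epsilon$-securely realizes* $I$ if for every valid $E$ there is a valid $S$ with $$|\Pr(Z_{E+P}=0)-\Pr(Z_{E+I+S}=0)|\le\epsilon .$$ The size of a circuit is the sum over its gates of the dimension of the space on which the gate acts, and $n$ is the security parameter. A function $\epsilon(n,m)$ is *negligible* if for all $f$ bounded by a polynomial and all polynomials $q$, $\epsilon(n,f(n))\,q(n)\le 1$ for large $n$; in a stronger variant, for all such $f$ there is $\alpha>0$ with $\epsilon(n,f(n))\le 2^{-\alpha n}$ for large $n$. A protocol definition $P$ (a family of copies, for every $n$) *computationally realizes* $I$ if $P$ and $I$ have size polynomial in $n$ and there are a negligible $\epsilon$ and a polynomial $p$, the same for all copies, such that for all $n$, all copies and all valid $E$ there is a valid $S$ of size at most $p(n)$ with $|\Pr(Z_{E+P}=0)-\Pr(Z_{E+I+S}=0)|\le\epsilon(n,|E|)$.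 **Theorem.** For every $n$ let $P=P_n$ be a protocol organized as a finite rooted tree of sub-protocols $Q=M(Q)+\sum_{R\in\mathcal C(Q)}R$, where $M(Q)$ is the main module of $Q$ and $\mathcal C(Q)$ is the set of its children, with an ideal protocol $I(Q)$ for every $Q$; let $\widetilde Q=M(Q)+\sum_{R\in\mathcal C(Q)}I(R)$. Distinct circuits use distinct gates and registers, except that a sub-protocol shares its input/output channels with the outside, and an ideal protocol shares input/output channels and corruption registers with what it replaces. 1. *Unconditional scenario.* For every $n$: if for every sub-protocol $Q$ of $P$ (including $P$), $\widetilde Q$ $\epsilon_{\widetilde Q}$-securely realizes $I(Q)$, where $\epsilon_{\widetilde Q}$ does not depend on the environment, then $P$ $\epsilon_P$-securely realizes $I(P)$ with $\epsilon_P=\sum_Q\epsilon_{\widetilde Q}$. 2. *Computational scenario.* Suppose that the number of sub-protocols of $P_n$ is bounded by a polynomial in $n$, and that they are copies of finitely many protocol definitions. If for each of these definitions $\widetilde Q$ computationally realizes $I(Q)$, then $P$ computationally realizes $I(P)$. This holds for each of the two notions of negligible function. -/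

import Mathlib

open scoped BigOperators

noncomputable section

/-! ## Registers -/

/-- The security types of a channel register. -/
inductive ChannelType
  | insecure
  | authenticated
  | hidden
  deriving DecidableEq

/-- What a register is used for.  A channel register, and an activation register (the register by
which a communication gate is woken up), carries its channel-type, its sender-ID and its
recipient-ID. -/
inductive RegKind
  | storage
  | channel (type : ChannelType) (sender recipient : ℕ)
  | activation (type : ChannelType) (sender recipient : ℕ)
  | corruption
  deriving DecidableEq

/-- A register, with its unique name.  Its basis states are `0, …, top`. -/
structure Reg where
  name : ℕ
  classical : Bool
  top : ℕ
  kind : RegKind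
  deriving DecidableEq

/-- The basis states (for a classical register, the values) of a register. -/
abbrev Val (ρ : Reg) : Type := Fin (ρ.top + 1)

/-- An assignment of a basis state to every register. -/
abbrev Conf : Type := (ρ : Reg) → Val ρ

/-- Degrees of access to a register. -/
inductive Access
  | none
  | read
  | full
  deriving DecidableEq

/-- Channel registers, including the activation registers of communication gates. -/
def Reg.IsLink (ρ : Reg) : Prop :=
  (∃ t s d, ρ.kind = .channel t s d) ∨ (∃ t s d, ρ.kind = .activation t s d)

/-- The access that a channel-type gives to somebody who is neither the sender nor the recipient:
an authenticated register can be read if it is classical, and cannot be accessed if it is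
quantum. -/
def ChannelType.outsider (classical : Bool) : ChannelType → Access
  | .insecure => .full
  | .authenticated => if classical then .read else .none
  | .hidden => .none

/-- The access of an outsider to a register. -/
def Reg.outsider (ρ : Reg) : Access :=
  match ρ.kind with
  | .channel t _ _ => t.outsider ρ.classical
  | .activation t _ _ => t.outsider ρ.classical
  | _ => .none

/-- The access to a channel register of a circuit whose identity is `i`. -/
def Reg.accessAs (ρ : Reg) (i : ℕ) : Access :=
  match ρ.kind with
  | .channel t s d => if i = s ∨ i = d then .full else t.outsider ρ.classical
  | .activation t s d => if i = s ∨ i = d then .full else t.outsider ρ.classical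
  | _ => .none

/-! ## Gates -/

/-- The operations: a unitary transformation, a permutation of classical values, and a measurement
of `q` whose outcome is stored in `c`. -/
inductive Op
  | unitary (tgt : Finset Reg) (U : Matrix.unitaryGroup ((ρ : tgt) → Val ρ.1) ℂ)
  | perm (tgt : Finset Reg) (σ : Equiv.Perm ((ρ : tgt) → Val ρ.1))
  | measure (q c : Reg)

/-- The registers on which an operation acts. -/
def Op.tgt : Op → Finset Reg
  | .unitary A _ => A
  | .perm A _ => A
  | .measure q c => {q, c}

/-- The fresh classical register in which a measurement stores its outcome. -/
def Op.outcome : Op → Finset Reg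
  | .measure _ c => {c}
  | _ => ∅

/-- Unitaries act on quantum registers, permutations on classical registers, a measurement takes a
quantum register to a classical register of the same dimension. -/
def Op.WellTyped : Op → Prop
  | .unitary A _ => ∀ ρ ∈ A, ρ.classical = false
  | .perm A _ => ∀ ρ ∈ A, ρ.classical = true
  | .measure q c => q.classical = false ∧ c.classical = true ∧ q.top = c.top

/-- A classically controlled gate.  The controlled part `op` is active when every control register
has the required value.  If `wake = some a`, the gate sleeps until its activation register `a` is
set to `1` (WAKE-UP). The number `id` distinguishes gates that do the same thing. -/
structure Gate where
  id : ℕ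
  ctrl : Finset (Reg × ℕ)
  op : Op
  wake : Option Reg
  ctrl_classical : ∀ p ∈ ctrl, p.1.classical = true
  op_wellTyped : op.WellTyped
  ctrl_tgt : ∀ p ∈ ctrl, p.1 ∉ op.tgt
  wake_ctrl : ∀ a, wake = some a → (a, 1) ∈ ctrl

instance : DecidableEq Gate := Classical.decEq _

/-- The control registers of a gate. -/
def Gate.ctrlRegs (g : Gate) : Finset Reg := g.ctrl.image Prod.fst

/-- The target registers of a gate. -/
def Gate.tgt (g : Gate) : Finset Reg := g.op.tgt

/-- All registers of a gate. -/
def Gate.regs (g : Gate) : Finset Reg := g.ctrlRegs ∪ g.tgt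

/-- The size of a gate is the dimension of the space on which it acts, so that a gate on many
registers is not counted as elementary. -/
def Gate.size (g : Gate) : ℕ := ∏ ρ ∈ g.regs, (ρ.top + 1)

/-- The controlled part of the gate is active in the configuration `c`. -/
def Gate.Active (g : Gate) (c : Conf) : Prop := ∀ p ∈ g.ctrl, (c p.1 : ℕ) = p.2

/-- There are values of the control registers for which both gates are active. -/
def Gate.Compatible (g h : Gate) : Prop :=
  ∀ p ∈ g.ctrl, ∀ q ∈ h.ctrl, p.1 = q.1 → p.2 = q.2

/-- Overwrite the values of the registers in `A`. -/
def Conf.overwrite (c : Conf) (A : Finset Reg) (a : (ρ : A) → Val ρ.1) : Conf :=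
  fun ρ => if h : ρ ∈ A then a ⟨ρ, h⟩ else c ρ

/-- The restriction of a configuration to the registers in `A`. -/
def Conf.on (c : Conf) (A : Finset Reg) : (ρ : A) → Val ρ.1 := fun ρ => c ρ.1

open Classical in
/-- The action on a basis vector.  A register that stores the outcome of a measurement has this
outcome as initial value, and the measurement changes no classical value: a measurement whose
outcome is the value of `o` projects on the corresponding basis state of `q`; if it is not active,
the register `o` stays at zero. -/
def Gate.onBasis (g : Gate) (c : Conf) : Conf →₀ ℂ :=
  if g.Active c then
    match g.op with
    | .unitary A U =>
        ∑ a : ((ρ : A) → Val ρ.1),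
          Finsupp.single (c.overwrite A a)
            ((U : Matrix ((ρ : A) → Val ρ.1) ((ρ : A) → Val ρ.1) ℂ) a (c.on A))
    | .perm A σ => Finsupp.single (c.overwrite A (σ (c.on A))) 1
    | .measure q o => if (c q : ℕ) = (c o : ℕ) then Finsupp.single c 1 else 0
  else
    match g.op with
    | .measure _ o => if (c o : ℕ) = 0 then Finsupp.single c 1 else 0
    | _ => Finsupp.single c 1

/-- The linear action of a gate on (unnormalized) state vectors. -/
def Gate.apply (ψ : Conf →₀ ℂ) (g : Gate) : Conf →₀ ℂ :=
  ψ.sum fun c a => a • g.onBasis c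

/-! ## Circuits and their execution -/

/-- A set of gates with a value-dependent precedence relation and an output bit: `rel x g h` says
that `g` is put before `h` when `x` gives the initial values of the classical registers.  The
ordering is the transitive closure `lt`. -/
structure Setting where
  gates : Finset Gate
  rel : Conf → Gate → Gate → Prop
  out : Reg

namespace Setting

/-- The strict ordering of the gates, for the initial values `x`. -/
def lt (A : Setting) (x : Conf) : Gate → Gate → Prop := Relation.TransGen (A.rel x)

/-- The registers that receive the outcome of a measurement. -/
def outcomes (A : Setting) : Finset Reg := A.gates.biUnion fun g => g.op.outcome

/-- The initial values given by the outcomes of the measurements; every other register, and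
in particular every corruption and every activation register, is initially zero. -/
def init (A : Setting) (v : (ρ : A.outcomes) → Val ρ.1) : Conf :=
  Conf.overwrite (fun _ => 0) A.outcomes v

/-- The sequence `l` executes every gate once, in accordance with the ordering at `x`. -/
def IsSequence (A : Setting) (x : Conf) (l : List Gate) : Prop :=
  l.Nodup ∧ (∀ g, g ∈ l ↔ g ∈ A.gates) ∧ l.Pairwise fun g h => ¬ A.lt x h g

/-- The setting is a circuit. -/
structure IsCircuit (A : Setting) : Prop where
  /-- For all initial values, the gates are partially ordered. -/
  acyclic : ∀ v g, ¬ A.lt (A.init v) g g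
  /-- Two gates that access a same register, at least one of them acting on it, are ordered; a
  control register is always accessed, a common target register only matters if there are values
  of the control registers for which both gates are active. -/
  ordered : ∀ v, ∀ g ∈ A.gates, ∀ h ∈ A.gates, g ≠ h →
    ∀ ρ ∈ g.tgt, ρ ∈ h.ctrlRegs ∨ (ρ ∈ h.tgt ∧ g.Compatible h) →
      A.rel (A.init v) g h ∨ A.rel (A.init v) h g
  /-- A gate with an activation register is not executed until after the gates that set it. -/
  awake : ∀ v, ∀ g ∈ A.gates, ∀ h ∈ A.gates, ∀ a, g.wake = some a → a ∈ h.tgt →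
    A.rel (A.init v) h g
  /-- No gate can access an outcome register before the measurement. -/
  fresh : ∀ v, ∀ m ∈ A.gates, ∀ h ∈ A.gates, m ≠ h → ∀ ρ ∈ m.op.outcome, ρ ∈ h.regs →
    A.rel (A.init v) m h
  /-- The order can only depend on outcomes of measurements that have already been done. -/
  causal : ∀ v w, ∀ g ∈ A.gates,
    (∀ m ∈ A.gates, A.rel (A.init v) m g → ∀ ρ ∈ m.op.outcome, A.init v ρ = A.init w ρ) →
      ∀ h, A.rel (A.init v) h g ↔ A.rel (A.init w) h g

/-- A choice, for all initial values, of a sequence that executes the circuit.  (All choices give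
the same probabilities, because unordered gates of a circuit commute.) -/
structure Schedule (A : Setting) where
  seq : Conf → List Gate
  isSequence : ∀ v, A.IsSequence (A.init v) (seq (A.init v))

/-- The final (unnormalized) state vector, given the initial values `x`. -/
def final (x : Conf) (l : List Gate) : Conf →₀ ℂ := l.foldl Gate.apply (Finsupp.single x 1)

/-- The probability `Pr(Z = 0)` that the output bit is zero. -/
def zeroProb (A : Setting) (s : A.Schedule) : ℝ :=
  ∑ v : ((ρ : A.outcomes) → Val ρ.1),
    (final (A.init v) (s.seq (A.init v))).sum
      fun c a => if (c A.out : ℕ) = 0 then ‖a‖ ^ 2 else 0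

end Setting

/-- The relation depends on the initial values of the registers in `R` only. -/
def DependsOnlyOn (ord : Conf → Gate → Gate → Prop) (R : Finset Reg) : Prop :=
  ∀ x y : Conf, (∀ ρ ∈ R, x ρ = y ρ) → ∀ g h, ord x g h ↔ ord y g h

/-- The two gates have a register in common. -/
def ShareReg (g h : Gate) : Prop := ∃ ρ, ρ ∈ g.regs ∧ ρ ∈ h.regs

/-- The two gates have a channel register in common. -/
def ShareLink (g h : Gate) : Prop := ∃ ρ, ρ.IsLink ∧ ρ ∈ g.regs ∧ ρ ∈ h.regs

/-- The total size of a set of gates. -/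
def gatesSize (G : Finset Gate) : ℕ := ∑ g ∈ G, g.size

/-! ## Protocols -/

/-- A module-role-circuit: its identity, its own registers, its channel registers, its corruption
register (if it is corruptible), its gates and their value-dependent ordering. -/
structure Role where
  id : ℕ
  priv : Finset Reg
  links : Finset Reg
  cor : Option Reg
  gates : Finset Gate
  ord : Conf → Gate → Gate → Prop

instance : DecidableEq Role := Classical.decEq _

/-- All registers of a module-role-circuit. -/
def Role.regs (r : Role) : Finset Reg := r.priv ∪ r.links ∪ r.cor.toFinset

/-- The rules for a module-role-circuit. -/
structure Role.WellFormed (r : Role) : Prop where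
  priv_kind : ∀ ρ ∈ r.priv, ρ.kind = .storage
  links_kind : ∀ ρ ∈ r.links, ρ.IsLink ∧ ρ.accessAs r.id ≠ .none
  cor_kind : ∀ C, r.cor = some C → C.kind = .corruption ∧ C.classical = true ∧ C.top = 1
  write : ∀ g ∈ r.gates, ∀ ρ ∈ g.tgt,
    ρ ∈ r.priv ∨ (ρ ∈ r.links ∧ ρ.accessAs r.id = .full)
  read : ∀ g ∈ r.gates, ∀ ρ ∈ g.ctrlRegs, ρ ∈ r.priv ∨ ρ ∈ r.links ∨ r.cor = some ρ
  /-- The gates of a corruptible circuit do nothing when the circuit is corrupted. -/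
  honest : ∀ C, r.cor = some C → ∀ g ∈ r.gates, (C, 0) ∈ g.ctrl
  wake_kind : ∀ g ∈ r.gates, ∀ a, g.wake = some a →
    a ∈ r.links ∧ a.top = 1 ∧ ∃ t s d, a.kind = .activation t s d
  ord_gates : ∀ x g h, r.ord x g h → g ∈ r.gates ∧ h ∈ r.gates
  ord_irrefl : ∀ x g, ¬ r.ord x g g
  ord_trans : ∀ x g h k, r.ord x g h → r.ord x h k → r.ord x g k
  ord_local : DependsOnlyOn r.ord r.priv

/-- A protocol is a set of module-role-circuits; `io` is the set of its input and output channel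
registers, by which it communicates with the application that calls it. -/
structure Protocol where
  roles : Finset Role
  io : Finset Reg

namespace Protocol

def gates (P : Protocol) : Finset Gate := P.roles.biUnion Role.gates

def links (P : Protocol) : Finset Reg := P.roles.biUnion Role.links

/-- The corruption registers of the protocol. -/
def cors (P : Protocol) : Finset Reg := P.roles.biUnion fun r => r.cor.toFinset

def regs (P : Protocol) : Finset Reg := P.roles.biUnion Role.regs ∪ P.io

def size (P : Protocol) : ℕ := gatesSize P.gates

/-- The gate `g` belongs to the adversary circuit of the corruptible circuit `r` of `P`: it is
active only when `r` is corrupted. -/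
def ActsFor (P : Protocol) (g : Gate) (r : Role) : Prop :=
  r ∈ P.roles ∧ ∃ C, r.cor = some C ∧ (C, 1) ∈ g.ctrl

/-- The module-role-circuits obey the rules, and have only channel registers in common. -/
structure WellFormed (P : Protocol) : Prop where
  roles_wf : ∀ r ∈ P.roles, r.WellFormed
  roles_regs : ∀ r ∈ P.roles, ∀ s ∈ P.roles, r ≠ s → ∀ ρ, ρ ∈ r.regs → ρ ∈ s.regs → ρ.IsLink
  roles_gates : ∀ r ∈ P.roles, ∀ s ∈ P.roles, r ≠ s → Disjoint r.gates s.gates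
  io_link : ∀ ρ ∈ P.io, ρ.IsLink

/-- The channel registers by which the circuit `r` communicates with the application are also at the
disposal of a circuit of the ideal protocol `I` that has the same identity and is corrupted by
the same corruption register. -/
def IOCorrespondence (P I : Protocol) : Prop :=
  ∀ r ∈ P.roles, ∀ ρ ∈ r.links, ρ ∈ I.io →
    ∃ r' ∈ I.roles, r'.id = r.id ∧ r'.cor = r.cor ∧ ρ ∈ r'.links

end Protocol

/-! ## Environments and simulators -/

/-- A circuit that interacts with others: its own registers, its gates, the ordering `ord` of its
gates, which depends on the initial values of its own registers, and a choice `cross` of order for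
pairs of gates that are not both its own.  This choice does not depend on register values, so that
nobody learns the values of hidden registers from the order of the gates. -/
structure OpenCircuit where
  regs : Finset Reg
  gates : Finset Gate
  ord : Conf → Gate → Gate → Prop
  cross : Gate → Gate → Prop

def OpenCircuit.size (S : OpenCircuit) : ℕ := gatesSize S.gates

/-- The environment has an output bit `out`, called `Z`. -/
structure Environment extends OpenCircuit where
  out : Reg

namespace Environment

/-- `E + P`. -/
def withProtocol (E : Environment) (P : Protocol) : Setting where
  gates := E.gates ∪ P.gates
  rel x g h := E.ord x g h ∨ E.cross g h ∨ ∃ r ∈ P.roles, r.ord x g h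
  out := E.out

/-- `E + I + S`.  The environment keeps its gates and their ordering; the order of the gates of
the environment and of the ideal protocol relative to the others is chosen with the simulator. -/
def withIdeal (E : Environment) (I : Protocol) (S : OpenCircuit) : Setting where
  gates := E.gates ∪ I.gates ∪ S.gates
  rel x g h := E.ord x g h ∨ S.ord x g h ∨ S.cross g h ∨ ∃ r ∈ I.roles, r.ord x g h
  out := E.out

/-- The registers that a gate of the environment can modify: the registers of the environment, the
input/output channels, the corruption registers, the channel registers that everybody can
modify, and, for a gate of the adversary circuit of `r`, the registers of the corrupted circuit `r`
and the channel registers in the name of `r`. -/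
def MayWrite (E : Environment) (P : Protocol) (g : Gate) (ρ : Reg) : Prop :=
  ρ ∈ E.regs ∨ ρ ∈ P.io ∨ ρ ∈ P.cors ∨ (ρ ∈ P.links ∧ ρ.outsider = .full) ∨
    ∃ r, P.ActsFor g r ∧ (ρ ∈ r.priv ∨ (ρ ∈ r.links ∧ ρ.accessAs r.id = .full))

/-- The registers that a gate of the environment can read. -/
def MayRead (E : Environment) (P : Protocol) (g : Gate) (ρ : Reg) : Prop :=
  ρ ∈ E.regs ∨ ρ ∈ P.io ∨ ρ ∈ P.cors ∨ (ρ ∈ P.links ∧ ρ.outsider ≠ .none) ∨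
    ∃ r, P.ActsFor g r ∧ (ρ ∈ r.priv ∨ (ρ ∈ r.links ∧ ρ.accessAs r.id ≠ .none))

/-- Valid environments for `P`. -/
structure Valid (E : Environment) (P : Protocol) : Prop where
  regs_disjoint : Disjoint E.regs P.regs
  gates_disjoint : Disjoint E.gates P.gates
  out_mem : E.out ∈ E.regs
  out_bit : E.out.classical = true ∧ E.out.top = 1
  write : ∀ g ∈ E.gates, ∀ ρ ∈ g.tgt, E.MayWrite P g ρ
  read : ∀ g ∈ E.gates, ∀ ρ ∈ g.ctrlRegs, E.MayRead P g ρ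
  ord_gates : ∀ x g h, E.ord x g h → g ∈ E.gates ∧ h ∈ E.gates
  ord_local : DependsOnlyOn E.ord E.regs
  /-- The environment orders its gates relative to those of `P`, and the communication gates of
  distinct circuits of `P` that share a channel register. -/
  cross_pairs : ∀ g h, E.cross g h →
    (g ∈ E.gates ∧ h ∈ P.gates ∧ ShareReg g h) ∨
    (g ∈ P.gates ∧ h ∈ E.gates ∧ ShareReg g h) ∨
    (g ∈ P.gates ∧ h ∈ P.gates ∧ ShareLink g h ∧ ∀ r ∈ P.roles, ¬ (g ∈ r.gates ∧ h ∈ r.gates))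
  isCircuit : (E.withProtocol P).IsCircuit

/-- The environment does not use, for something else, names that are used in `I`. -/
def Avoids (E : Environment) (I : Protocol) : Prop :=
  Disjoint E.regs I.regs ∧ Disjoint E.gates I.gates

end Environment

namespace OpenCircuit

/-- The registers of a simulator: private ones, and the simulated registers, which are the
registers of `P` that are not shared with the ideal protocol `I`. -/
def simRegs (S : OpenCircuit) (P I : Protocol) : Finset Reg := S.regs ∪ (P.regs \ I.regs)

/-- The registers that a gate of the simulator can modify.  The simulator interacts with the ideal
protocol by adversary circuits of corrupted circuits of `I` only, and with the input/output channels
only in the name of a corrupted circuit.  It never modifies a corruption register of `I`. -/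
def SimMayWrite (S : OpenCircuit) (P I : Protocol) (g : Gate) (ρ : Reg) : Prop :=
  ρ ∈ S.simRegs P I ∨
    ∃ r, I.ActsFor g r ∧
      (ρ ∈ r.priv ∨ (ρ ∈ r.links ∧ ρ.accessAs r.id = .full) ∨
        (ρ ∈ I.links ∧ ρ ∉ I.io ∧ ρ.outsider = .full))

/-- The registers that a gate of the simulator can read. -/
def SimMayRead (S : OpenCircuit) (P I : Protocol) (g : Gate) (ρ : Reg) : Prop :=
  ρ ∈ S.simRegs P I ∨ ρ ∈ I.cors ∨
    ∃ r, I.ActsFor g r ∧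
      (ρ ∈ r.priv ∨ (ρ ∈ r.links ∧ ρ.accessAs r.id ≠ .none) ∨
        (ρ ∈ I.links ∧ ρ ∉ I.io ∧ ρ.outsider ≠ .none))

/-- Valid simulators for `P` and `I`, against the environment `E`. -/
structure ValidSimulator (S : OpenCircuit) (E : Environment) (P I : Protocol) : Prop where
  regs_disjoint : Disjoint S.regs E.regs ∧ Disjoint S.regs P.regs ∧ Disjoint S.regs I.regs
  gates_disjoint : Disjoint S.gates E.gates ∧ Disjoint S.gates I.gates
  write : ∀ g ∈ S.gates, ∀ ρ ∈ g.tgt, S.SimMayWrite P I g ρ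
  read : ∀ g ∈ S.gates, ∀ ρ ∈ g.ctrlRegs, S.SimMayRead P I g ρ
  ord_gates : ∀ x g h, S.ord x g h → g ∈ S.gates ∧ h ∈ S.gates
  ord_local : DependsOnlyOn S.ord (S.simRegs P I)
  cross_pairs : ∀ g h, S.cross g h →
    (g ∈ S.gates ∧ h ∈ E.gates ∪ I.gates ∧ ShareReg g h) ∨
    (g ∈ E.gates ∪ I.gates ∧ h ∈ S.gates ∧ ShareReg g h) ∨
    (g ∈ E.gates ∧ h ∈ I.gates ∧ ShareReg g h) ∨
    (g ∈ I.gates ∧ h ∈ E.gates ∧ ShareReg g h) ∨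
    (g ∈ I.gates ∧ h ∈ I.gates ∧ ShareLink g h ∧ ∀ r ∈ I.roles, ¬ (g ∈ r.gates ∧ h ∈ r.gates))
  isCircuit : (E.withIdeal I S).IsCircuit

end OpenCircuit

/-! ## Security definitions -/

/-- `|Pr(Z = 0) - Pr(Z' = 0)| ≤ ε` for the output bits of the two settings. -/
def Close (A B : Setting) (ε : ℝ) : Prop :=
  ∀ (s : A.Schedule) (t : B.Schedule), |A.zeroProb s - B.zeroProb t| ≤ ε

/-- `P` `ε`-securely realizes `I`, where `ε` may depend on the environment. -/
def SecurelyRealizes (P I : Protocol) (ε : Environment → ℝ) : Prop :=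
  ∀ E : Environment, E.Valid P → E.Avoids I →
    ∃ S : OpenCircuit, S.ValidSimulator E P I ∧
      Close (E.withProtocol P) (E.withIdeal I S) (ε E)

/-- `ε n m`, where `m` stands for the size of the environment, is smaller than the inverse of every
polynomial in `n` whenever `m` is bounded by a polynomial in `n`. -/
def Negligible (ε : ℕ → ℕ → ℝ) : Prop :=
  ∀ (p : Polynomial ℕ) (f : ℕ → ℕ), (∀ n, f n ≤ p.eval n) →
    ∀ q : Polynomial ℕ, ∀ᶠ n in Filter.atTop, ε n (f n) * ((q.eval n : ℕ) : ℝ) ≤ 1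

/-- The stronger variant, with an exponentially small bound. -/
def ExpNegligible (ε : ℕ → ℕ → ℝ) : Prop :=
  ∀ (p : Polynomial ℕ) (f : ℕ → ℕ), (∀ n, f n ≤ p.eval n) →
    ∃ α : ℝ, 0 < α ∧ ∀ᶠ n : ℕ in Filter.atTop, ε n (f n) ≤ (2 : ℝ) ^ (-(α * (n : ℝ)))

/-- The protocol definition `P` computationally realizes `I`.  Here `P n k` is the `k`-th copy of the
protocol for the security parameter `n`; the polynomial bounds and the negligible function (in the
sense of `Neg`) depend on the definition, not on the copy. -/
def ComputationallyRealizes (Neg : (ℕ → ℕ → ℝ) → Prop) {κ : ℕ → Type}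
    (P I : (n : ℕ) → κ n → Protocol) : Prop :=
  (∃ p : Polynomial ℕ, ∀ n k, (P n k).size ≤ p.eval n) ∧
  (∃ p : Polynomial ℕ, ∀ n k, (I n k).size ≤ p.eval n) ∧
  ∃ ε : ℕ → ℕ → ℝ, Neg ε ∧ ∃ p : Polynomial ℕ,
    ∀ n k, ∀ E : Environment, E.Valid (P n k) → E.Avoids (I n k) →
      ∃ S : OpenCircuit, S.ValidSimulator E (P n k) (I n k) ∧ S.size ≤ p.eval n ∧
        Close (E.withProtocol (P n k)) (E.withIdeal (I n k) S) (ε n E.size)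

/-! ## Trees of sub-protocols -/

/-- A finite rooted tree of sub-protocols: every node has a main module and an ideal protocol. -/
structure ProtocolTree where
  Node : Type
  fintypeNode : Fintype Node
  root : Node
  parent : Node → Option Node
  parent_root : parent root = none
  reaches_root : ∀ q, Relation.ReflTransGen (fun a b => parent a = some b) q root
  main : Node → Finset Role
  ideal : Node → Protocol

namespace ProtocolTree

instance (T : ProtocolTree) : Fintype T.Node := T.fintypeNode

/-- The node `i` belongs to the subtree with root `q`. -/
def Below (T : ProtocolTree) (i q : T.Node) : Prop :=
  Relation.ReflTransGen (fun a b => T.parent a = some b) i q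

open Classical in
/-- The nodes called by the main module of `q`. -/
def children (T : ProtocolTree) (q : T.Node) : Finset T.Node :=
  Finset.univ.filter fun i => T.parent i = some q

open Classical in
/-- The sub-protocol with main module `M(q)`: all modules in the subtree of `q`. -/
def sub (T : ProtocolTree) (q : T.Node) : Protocol where
  roles := (Finset.univ.filter fun i => T.Below i q).biUnion T.main
  io := (T.ideal q).io

/-- The main module of `q` together with the ideal protocols of the children of `q`. -/
def tilde (T : ProtocolTree) (q : T.Node) : Protocol where
  roles := T.main q ∪ (T.children q).biUnion fun i => (T.ideal i).roles
  io := (T.ideal q).io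

/-- The whole protocol. -/
def protocol (T : ProtocolTree) : Protocol := T.sub T.root

/-- The main module of `q`, as a protocol. -/
def mainProtocol (T : ProtocolTree) (q : T.Node) : Protocol where
  roles := T.main q
  io := ∅

/-- The register `ρ` occurs in a module or in an ideal protocol in the subtree of `q`. -/
def OccursBelow (T : ProtocolTree) (q : T.Node) (ρ : Reg) : Prop :=
  ∃ i, T.Below i q ∧ (ρ ∈ (T.mainProtocol i).regs ∨ ρ ∈ (T.ideal i).regs)

/-- The conventions on names: different circuits have different gates and different registers,
except that a sub-protocol shares its input/output channels with the outside, and an ideal protocol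
shares its input/output channels and corruption registers with what it replaces. -/
structure WellFormed (T : ProtocolTree) : Prop where
  main_wf : ∀ q, (T.mainProtocol q).WellFormed
  ideal_wf : ∀ q, (T.ideal q).WellFormed
  /-- The circuits of `I(q)` that correspond to the circuits with input/output. -/
  correspondence : ∀ q, (T.tilde q).IOCorrespondence (T.ideal q)
  main_outside : ∀ q j, ¬ T.Below j q → ∀ ρ, T.OccursBelow q ρ →
    ρ ∈ (T.mainProtocol j).regs → ρ ∈ (T.ideal q).io
  ideal_outside : ∀ q j, ¬ T.Below j q → ∀ ρ, T.OccursBelow q ρ →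
    ρ ∈ (T.ideal j).regs →
      ρ ∈ (T.ideal q).io ∨ (T.Below q j ∧ ρ ∈ (T.ideal q).cors)
  ideal_own : ∀ q ρ, ρ ∈ (T.ideal q).regs →
    (ρ ∈ (T.mainProtocol q).regs ∨ ∃ i ∈ T.children q, T.OccursBelow i ρ) →
      ρ ∈ (T.ideal q).io ∨ (ρ ∈ (T.tilde q).cors ∧ ρ ∈ (T.ideal q).cors)
  main_gates : ∀ i j, i ≠ j → Disjoint (T.mainProtocol i).gates (T.mainProtocol j).gates
  ideal_gates : ∀ i j, i ≠ j → Disjoint (T.ideal i).gates (T.ideal j).gates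
  main_ideal_gates : ∀ i j, Disjoint (T.mainProtocol i).gates (T.ideal j).gates

end ProtocolTree

end

noncomputable section

/-! ## Renaming registers -/

/-! The proof is a hybrid argument along the tree, from the leaves to the root. A `Hybrid` records
the set `done` of nodes already replaced, which is closed downwards, and their simulators. Its
setting consists of `E`, the main modules of the other nodes, the ideal protocols of the topmost
replaced nodes, and the simulators. Let `q` be a node outside `done` whose children are all in
`done`. Everything except `M(q)` and the ideal protocols of the children of `q` is regarded as one
environment `Hybrid.env` for `tilde q`. The hypothesis on `q` provides a simulator `S` against it,
and this environment with `I(q)` and `S` is the next hybrid setting. The regroupings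
`env_withProtocol` and `env_withIdeal` are equalities of settings and cost nothing, so the errors
simply add up by the triangle inequality. At the end only `I(root)` and the simulators are left
beside `E`, and the latter together form the simulator `Hybrid.total`.

The main work is to show that these environments and the final simulator obey the access rules
(`Invariant.env_valid`, `Invariant.total_valid`). A simulator may act in the name of a corrupted
circuit of an ideal protocol that is no longer present. If the register it accesses is not used by
the rest, the new environment or simulator owns this register. In the critical case the register is
an input/output channel that was handed upwards through several nodes. Then `exists_counterpart`
follows the correspondence from node to node to a circuit that is still present and has the same
identity and corruption register.

The given environment may use names that are internal to the tree, and simulators may reuse gates.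
Both are moved away by involutions of registers and gates that preserve all probabilities
(`Symmetry.zeroProb_schedule`, `simulates_of_fresh`, `ValidSimulator.exists_fresh`).

In the computational scenario the simulators have size bounds independent of the environment. Hence
at every stage the environment exceeds `E` by at most the size of the tree plus the sum of these
bounds (`Invariant.env_size`), and does not grow by iteration. The errors are then controlled by
`exists_negligible_bound`. Size bounds take values in `ℕ∞`, so that `⊤` covers the unconditional
scenario. -/

theorem Conf.val_congr (c : Conf) {ρ σ : Reg} (h : ρ = σ) : (c ρ : ℕ) = c σ := by
  subst h; rfl

/-- Assignments on equal sets of registers have different types. Extending them to configurations,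
and comparing values as natural numbers by `Conf.val_congr`, avoids casts. -/
theorem Conf.exists_on (A : Finset Reg) (a : (ρ : A) → Val ρ.1) : ∃ c : Conf, c.on A = a := by
  refine ⟨Conf.overwrite (fun _ => 0) A a, ?_⟩
  funext ρ
  simp [Conf.on, Conf.overwrite]

/-- An involutive change of the names of the registers. -/
structure Renaming where
  name : Reg → ℕ
  involutive : ∀ ρ : Reg,
    (⟨name ⟨name ρ, ρ.classical, ρ.top, ρ.kind⟩, ρ.classical, ρ.top, ρ.kind⟩ : Reg) = ρ

namespace Renaming

variable (π : Renaming)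

/-- The new register; it has the same basis states, by definition. -/
def reg (ρ : Reg) : Reg := ⟨π.name ρ, ρ.classical, ρ.top, ρ.kind⟩

@[simp] theorem reg_reg (ρ : Reg) : π.reg (π.reg ρ) = ρ := π.involutive ρ

@[simp] theorem reg_classical (ρ : Reg) : (π.reg ρ).classical = ρ.classical := rfl

theorem reg_injective : Function.Injective π.reg :=
  Function.Involutive.injective (f := π.reg) π.reg_reg

/-- The image of a set of registers. -/
def regs (A : Finset Reg) : Finset Reg := A.image π.reg

@[simp] theorem mem_regs {A : Finset Reg} {ρ : Reg} : ρ ∈ π.regs A ↔ π.reg ρ ∈ A := by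
  unfold regs
  rw [Finset.mem_image]
  constructor
  · rintro ⟨σ, hσ, rfl⟩
    simpa using hσ
  · intro h
    exact ⟨_, h, by simp⟩

@[simp] theorem regs_regs (A : Finset Reg) : π.regs (π.regs A) = A := by
  ext ρ; simp

theorem regs_eq_self {A : Finset Reg} (h : ∀ ρ ∈ A, π.reg ρ = ρ) : π.regs A = A := by
  ext ρ
  rw [mem_regs]
  constructor
  · intro hρ
    have := h _ hρ
    rw [reg_reg] at this
    rwa [← this] at hρ
  · intro hρ
    rwa [h ρ hρ]

/-- The action on configurations. -/
def conf (c : Conf) : Conf := fun ρ => c (π.reg ρ)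

theorem conf_val (c : Conf) (ρ : Reg) : (π.conf c ρ : ℕ) = c (π.reg ρ) := rfl

@[simp] theorem conf_conf (c : Conf) : π.conf (π.conf c) = c := by
  funext ρ
  exact Fin.ext (c.val_congr (π.reg_reg ρ))

theorem conf_injective : Function.Injective π.conf :=
  Function.Involutive.injective (f := π.conf) π.conf_conf

/-- The values of renamed registers. -/
def valEquiv (A : Finset Reg) : ((ρ : π.regs A) → Val ρ.1) ≃ ((ρ : A) → Val ρ.1) where
  toFun a := fun ρ => a ⟨π.reg ρ.1, by simp [ρ.2]⟩
  invFun b := fun ρ => b ⟨π.reg ρ.1, π.mem_regs.1 ρ.2⟩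
  left_inv a := by
    obtain ⟨c, rfl⟩ := Conf.exists_on _ a
    funext ρ
    exact Fin.ext (c.val_congr (π.reg_reg ρ.1))
  right_inv b := by
    obtain ⟨c, rfl⟩ := Conf.exists_on _ b
    funext ρ
    exact Fin.ext (c.val_congr (π.reg_reg ρ.1))

theorem conf_overwrite (A : Finset Reg) (c : Conf) (a : (ρ : π.regs A) → Val ρ.1) :
    π.conf (c.overwrite (π.regs A) a) = (π.conf c).overwrite A (π.valEquiv A a) := by
  funext ρ
  by_cases h : ρ ∈ A
  · have h' : π.reg ρ ∈ π.regs A := by simpa using h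
    have h₁ : π.conf (c.overwrite (π.regs A) a) ρ = a ⟨π.reg ρ, h'⟩ := dif_pos h'
    have h₂ : (π.conf c).overwrite A (π.valEquiv A a) ρ = π.valEquiv A a ⟨ρ, h⟩ := dif_pos h
    exact h₁.trans h₂.symm
  · have h' : π.reg ρ ∉ π.regs A := by simpa using h
    have h₁ : π.conf (c.overwrite (π.regs A) a) ρ = c (π.reg ρ) := dif_neg h'
    have h₂ : (π.conf c).overwrite A (π.valEquiv A a) ρ = π.conf c ρ := dif_neg h
    exact h₁.trans h₂.symm

end Renaming

/-! ### Operations -/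

/-- The matrices have different index types when `A = B` is not definitional, so the entries are
compared at restrictions of full configurations. -/
theorem Op.unitary_ext {A B : Finset Reg} (h : A = B)
    (U : Matrix.unitaryGroup ((ρ : A) → Val ρ.1) ℂ) (V : Matrix.unitaryGroup ((ρ : B) → Val ρ.1) ℂ)
    (hUV : ∀ c d : Conf, U.1 (c.on A) (d.on A) = V.1 (c.on B) (d.on B)) :
    Op.unitary A U = Op.unitary B V := by
  subst h
  congr 1
  apply Subtype.ext
  ext a b
  obtain ⟨c, rfl⟩ := Conf.exists_on _ a
  obtain ⟨d, rfl⟩ := Conf.exists_on _ b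
  exact hUV c d

theorem Op.perm_ext {A B : Finset Reg} (h : A = B)
    (σ : Equiv.Perm ((ρ : A) → Val ρ.1)) (τ : Equiv.Perm ((ρ : B) → Val ρ.1))
    (hστ : ∀ (c : Conf) (ρ : Reg) (h₁ : ρ ∈ A) (h₂ : ρ ∈ B),
      (σ (c.on A) ⟨ρ, h₁⟩ : ℕ) = τ (c.on B) ⟨ρ, h₂⟩) :
    Op.perm A σ = Op.perm B τ := by
  subst h
  congr 1
  ext a ρ
  obtain ⟨c, rfl⟩ := Conf.exists_on _ a
  exact hστ c ρ.1 ρ.2 ρ.2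

namespace Renaming

variable (π : Renaming)

/-- The same operation, on renamed registers. -/
def op : Op → Op
  | .unitary A U => .unitary (π.regs A)
      ⟨U.1.submatrix (π.valEquiv A) (π.valEquiv A), by
        have h := U.2
        rw [Matrix.mem_unitaryGroup_iff, Matrix.star_eq_conjTranspose] at h ⊢
        rw [Matrix.conjTranspose_submatrix, Matrix.submatrix_mul_equiv, h,
          Matrix.submatrix_one_equiv]⟩
  | .perm A σ => .perm (π.regs A) (((π.valEquiv A).trans σ).trans (π.valEquiv A).symm)
  | .measure q c => .measure (π.reg q) (π.reg c)

@[simp] theorem op_tgt (o : Op) : (π.op o).tgt = π.regs o.tgt := by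
  cases o <;> simp [op, Op.tgt, regs]

@[simp] theorem op_outcome (o : Op) : (π.op o).outcome = π.regs o.outcome := by
  cases o <;> simp [op, Op.outcome, regs]

theorem op_wellTyped {o : Op} (h : o.WellTyped) : (π.op o).WellTyped := by
  cases o with
  | unitary A U =>
    intro ρ hρ
    have := h _ (π.mem_regs.1 hρ)
    simpa using this
  | perm A σ =>
    intro ρ hρ
    have := h _ (π.mem_regs.1 hρ)
    simpa using this
  | measure q c => exact h

theorem conf_on_eq {A : Finset Reg} (h : ∀ ρ ∈ A, π.reg ρ = ρ) (c : Conf) :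
    (π.conf c).on A = c.on A := by
  funext ρ
  exact Fin.ext (c.val_congr (h ρ.1 ρ.2))

@[simp] theorem op_op (o : Op) : π.op (π.op o) = o := by
  cases o with
  | unitary A U =>
    refine Op.unitary_ext (π.regs_regs A) _ _ fun c d => ?_
    change U.1 ((π.conf (π.conf c)).on A) ((π.conf (π.conf d)).on A) = _
    rw [conf_conf, conf_conf]
  | perm A σ =>
    refine Op.perm_ext (π.regs_regs A) _ _ fun c ρ h₁ h₂ => ?_
    change (σ ((π.conf (π.conf c)).on A) ⟨π.reg (π.reg ρ), _⟩ : ℕ) = _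
    rw [conf_conf]
    obtain ⟨d, hd⟩ := Conf.exists_on A (σ (c.on A))
    rw [← hd]
    exact d.val_congr (π.reg_reg ρ)
  | measure q c => simp [op]

theorem op_eq_self {o : Op} (h : ∀ ρ ∈ o.tgt, π.reg ρ = ρ) : π.op o = o := by
  cases o with
  | unitary A U =>
    change ∀ ρ ∈ A, π.reg ρ = ρ at h
    refine Op.unitary_ext (π.regs_eq_self h) _ _ fun c d => ?_
    change U.1 ((π.conf c).on A) ((π.conf d).on A) = _
    rw [conf_on_eq π h, conf_on_eq π h]
  | perm A σ =>
    change ∀ ρ ∈ A, π.reg ρ = ρ at h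
    refine Op.perm_ext (π.regs_eq_self h) _ _ fun c ρ h₁ h₂ => ?_
    change (σ ((π.conf c).on A) ⟨π.reg ρ, _⟩ : ℕ) = _
    rw [conf_on_eq π h]
    obtain ⟨d, hd⟩ := Conf.exists_on A (σ (c.on A))
    rw [← hd]
    exact d.val_congr (h ρ h₂)
  | measure q c =>
    simp only [Op.tgt, Finset.mem_insert, Finset.mem_singleton, forall_eq_or_imp, forall_eq] at h
    simp [op, h.1, h.2]

/-- Renaming the controls. -/
def ctrl (C : Finset (Reg × ℕ)) : Finset (Reg × ℕ) := C.image fun p => (π.reg p.1, p.2)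

@[simp] theorem mem_ctrl {C : Finset (Reg × ℕ)} {p : Reg × ℕ} :
    p ∈ π.ctrl C ↔ (π.reg p.1, p.2) ∈ C := by
  unfold ctrl
  rw [Finset.mem_image]
  constructor
  · rintro ⟨q, hq, rfl⟩
    simpa using hq
  · intro h
    exact ⟨_, h, by simp⟩

@[simp] theorem ctrl_ctrl (C : Finset (Reg × ℕ)) : π.ctrl (π.ctrl C) = C := by
  ext p; simp

/-- The same gate, on renamed registers. -/
def gate (g : Gate) : Gate where
  id := g.id
  ctrl := π.ctrl g.ctrl
  op := π.op g.op
  wake := g.wake.map π.reg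
  ctrl_classical p hp := by simpa using g.ctrl_classical _ (π.mem_ctrl.1 hp)
  op_wellTyped := π.op_wellTyped g.op_wellTyped
  ctrl_tgt p hp := by simpa using g.ctrl_tgt _ (π.mem_ctrl.1 hp)
  wake_ctrl a ha := by
    obtain ⟨b, hb, rfl⟩ := Option.map_eq_some_iff.1 ha
    simpa using g.wake_ctrl _ hb

theorem _root_.Gate.ext_fields {g h : Gate} (h₁ : g.id = h.id) (h₂ : g.ctrl = h.ctrl)
    (h₃ : g.op = h.op) (h₄ : g.wake = h.wake) : g = h := by
  cases g; cases h; simp_all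

theorem gate_gate (g : Gate) : π.gate (π.gate g) = g := by
  apply Gate.ext_fields <;> simp [gate, Function.comp_def]

theorem ctrl_eq_self {C : Finset (Reg × ℕ)} (h : ∀ p ∈ C, π.reg p.1 = p.1) : π.ctrl C = C := by
  ext p
  rw [mem_ctrl]
  constructor
  · intro hp
    have := h _ hp
    simp only [reg_reg] at this
    rwa [← this] at hp
  · intro hp
    simpa [h p hp] using hp

theorem _root_.Gate.mem_ctrlRegs {g : Gate} {ρ : Reg} : ρ ∈ g.ctrlRegs ↔ ∃ n, (ρ, n) ∈ g.ctrl := by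
  unfold Gate.ctrlRegs
  simp

theorem gate_eq_self {g : Gate} (h : ∀ ρ ∈ g.regs, π.reg ρ = ρ) : π.gate g = g := by
  have hc : ∀ p ∈ g.ctrl, π.reg p.1 = p.1 := fun p hp =>
    h _ (Finset.mem_union_left _ (Gate.mem_ctrlRegs.2 ⟨p.2, hp⟩))
  apply Gate.ext_fields
  · rfl
  · exact π.ctrl_eq_self hc
  · exact π.op_eq_self fun ρ hρ => h ρ (Finset.mem_union_right _ hρ)
  · change g.wake.map π.reg = g.wake
    rcases hw : g.wake with _ | a
    · rfl
    · simp [hc _ (g.wake_ctrl a hw)]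

/-- The renaming that changes nothing. -/
def refl : Renaming := ⟨Reg.name, fun _ => rfl⟩

end Renaming

/-! ## Symmetries -/

/-- An involutive permutation of the gates that is compatible with a renaming of the registers; the
identifying numbers of the gates may change. -/
structure Symmetry extends Renaming where
  gateMap : Gate → Gate
  gateMap_involutive : ∀ g, gateMap (gateMap g) = g
  ctrl_gateMap : ∀ g, (gateMap g).ctrl = toRenaming.ctrl g.ctrl
  op_gateMap : ∀ g, (gateMap g).op = toRenaming.op g.op
  wake_gateMap : ∀ g, (gateMap g).wake = g.wake.map toRenaming.reg

namespace Symmetry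

variable (σ : Symmetry)

attribute [simp] gateMap_involutive

theorem gateMap_injective : Function.Injective σ.gateMap :=
  Function.Involutive.injective (f := σ.gateMap) σ.gateMap_involutive

/-- The image of a set of gates. -/
def gates (G : Finset Gate) : Finset Gate := G.image σ.gateMap

@[simp] theorem mem_gates {G : Finset Gate} {g : Gate} : g ∈ σ.gates G ↔ σ.gateMap g ∈ G := by
  unfold gates
  rw [Finset.mem_image]
  constructor
  · rintro ⟨h, hh, rfl⟩
    simpa using hh
  · intro h
    exact ⟨_, h, by simp⟩

@[simp] theorem gates_gates (G : Finset Gate) : σ.gates (σ.gates G) = G := by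
  ext g; simp

theorem gates_eq_self {G : Finset Gate} (h : ∀ g ∈ G, σ.gateMap g = g) : σ.gates G = G := by
  ext g
  rw [mem_gates]
  constructor
  · intro hg
    have := h _ hg
    rw [gateMap_involutive] at this
    rwa [← this] at hg
  · intro hg
    rwa [h g hg]

theorem tgt_gateMap (g : Gate) : (σ.gateMap g).tgt = σ.regs g.tgt := by
  simp [Gate.tgt, op_gateMap]

theorem mem_tgt_gateMap {g : Gate} {ρ : Reg} : ρ ∈ (σ.gateMap g).tgt ↔ σ.reg ρ ∈ g.tgt := by
  simp [tgt_gateMap]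

theorem outcome_gateMap (g : Gate) : (σ.gateMap g).op.outcome = σ.regs g.op.outcome := by
  simp [op_gateMap]

theorem mem_ctrl_gateMap {g : Gate} {p : Reg × ℕ} :
    p ∈ (σ.gateMap g).ctrl ↔ (σ.reg p.1, p.2) ∈ g.ctrl := by
  simp [ctrl_gateMap]

theorem mem_ctrlRegs_gateMap {g : Gate} {ρ : Reg} :
    ρ ∈ (σ.gateMap g).ctrlRegs ↔ σ.reg ρ ∈ g.ctrlRegs := by
  simp [Gate.mem_ctrlRegs, ctrl_gateMap]

theorem mem_regs_gateMap {g : Gate} {ρ : Reg} :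
    ρ ∈ (σ.gateMap g).regs ↔ σ.reg ρ ∈ g.regs := by
  simp [Gate.regs, mem_ctrlRegs_gateMap, mem_tgt_gateMap]

theorem size_gateMap (g : Gate) : (σ.gateMap g).size = g.size := by
  have : (σ.gateMap g).regs = g.regs.image σ.reg := by
    ext ρ
    rw [mem_regs_gateMap]
    exact (σ.mem_regs (A := g.regs)).symm
  unfold Gate.size
  rw [this, Finset.prod_image fun a _ b _ h => σ.reg_injective h]
  rfl

theorem gatesSize_gates (G : Finset Gate) : gatesSize (σ.gates G) = gatesSize G := by
  unfold gatesSize gates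
  rw [Finset.sum_image fun a _ b _ h => σ.gateMap_injective h]
  exact Finset.sum_congr rfl fun g _ => σ.size_gateMap g

theorem shareReg_gateMap {g h : Gate} : ShareReg (σ.gateMap g) (σ.gateMap h) ↔ ShareReg g h := by
  unfold ShareReg
  simp only [mem_regs_gateMap]
  constructor
  · rintro ⟨ρ, hρ⟩
    exact ⟨_, hρ⟩
  · rintro ⟨ρ, hρ⟩
    exact ⟨σ.reg ρ, by simpa using hρ⟩

theorem shareLink_gateMap {g h : Gate} :
    ShareLink (σ.gateMap g) (σ.gateMap h) ↔ ShareLink g h := by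
  unfold ShareLink
  simp only [mem_regs_gateMap]
  constructor
  · rintro ⟨ρ, hl, hρ⟩
    exact ⟨σ.reg ρ, hl, hρ⟩
  · rintro ⟨ρ, hl, hρ⟩
    exact ⟨σ.reg ρ, hl, by simpa using hρ⟩

theorem compatible_gateMap {g h : Gate} :
    (σ.gateMap g).Compatible (σ.gateMap h) ↔ g.Compatible h := by
  have key : ∀ g h : Gate, g.Compatible h → (σ.gateMap g).Compatible (σ.gateMap h) := by
    intro g h H p hp q hq hpq
    rw [mem_ctrl_gateMap] at hp hq
    exact H _ hp (σ.reg q.1, q.2) hq (congrArg σ.reg hpq)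
  refine ⟨fun H => ?_, key g h⟩
  simpa using key _ _ H

/-! ### The action on state vectors -/

theorem active_gateMap {g : Gate} {c : Conf} :
    (σ.gateMap g).Active c ↔ g.Active (σ.conf c) := by
  unfold Gate.Active
  constructor
  · intro H p hp
    have := H (σ.reg p.1, p.2) (by rw [mem_ctrl_gateMap]; simpa using hp)
    exact this
  · intro H p hp
    rw [mem_ctrl_gateMap] at hp
    have := H _ hp
    rw [Renaming.conf_val] at this
    rw [← this]
    exact c.val_congr (σ.reg_reg _).symm

/-- Equivariance of the dynamics. The matrix and the permutation were conjugated by `valEquiv`, so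
in the unitary case only the index of summation changes; tests on values are carried over by `conf`.
-/
theorem onBasis_gateMap (g : Gate) (c : Conf) :
    (σ.gateMap g).onBasis c = Finsupp.mapDomain σ.conf (g.onBasis (σ.conf c)) := by
  unfold Gate.onBasis
  rw [σ.op_gateMap g]
  by_cases ha : g.Active (σ.conf c)
  · rw [if_pos ha, if_pos (σ.active_gateMap.2 ha)]
    rcases g.op with ⟨A, U⟩ | ⟨A, p⟩ | ⟨q, o⟩
    · simp only [Renaming.op]
      rw [Finsupp.mapDomain_finsetSum]
      refine Fintype.sum_equiv (σ.valEquiv A) _ _ fun a => ?_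
      rw [Finsupp.mapDomain_single, ← Renaming.conf_overwrite, Renaming.conf_conf]
      rfl
    · simp only [Renaming.op]
      rw [Finsupp.mapDomain_single]
      congr 1
      apply σ.conf_injective
      rw [Renaming.conf_conf, Renaming.conf_overwrite]
      simp only [Equiv.trans_apply, Equiv.apply_symm_apply]
      rfl
    · simp only [Renaming.op, Renaming.conf_val]
      change (if (c (σ.reg q) : ℕ) = c (σ.reg o) then _ else _) =
        Finsupp.mapDomain σ.conf (if (c (σ.reg q) : ℕ) = c (σ.reg o) then _ else _)
      split_ifs <;> simp
  · rw [if_neg ha, if_neg (fun h => ha (σ.active_gateMap.1 h))]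
    rcases g.op with ⟨A, U⟩ | ⟨A, p⟩ | ⟨q, o⟩
    · simp [Renaming.op]
    · simp [Renaming.op]
    · simp only [Renaming.op, Renaming.conf_val]
      change (if (c (σ.reg o) : ℕ) = 0 then _ else _) =
        Finsupp.mapDomain σ.conf (if (c (σ.reg o) : ℕ) = 0 then _ else _)
      split_ifs <;> simp

theorem apply_gateMap (ψ : Conf →₀ ℂ) (g : Gate) :
    Gate.apply (Finsupp.mapDomain σ.conf ψ) (σ.gateMap g) =
      Finsupp.mapDomain σ.conf (Gate.apply ψ g) := by
  unfold Gate.apply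
  rw [Finsupp.sum_mapDomain_index_inj σ.conf_injective]
  unfold Finsupp.sum
  rw [Finsupp.mapDomain_finsetSum]
  refine Finset.sum_congr rfl fun c _ => ?_
  change ψ c • (σ.gateMap g).onBasis (σ.conf c) = Finsupp.mapDomain σ.conf (ψ c • g.onBasis c)
  rw [onBasis_gateMap, Renaming.conf_conf, Finsupp.mapDomain_smul]

theorem final_map (x : Conf) (l : List Gate) :
    Setting.final (σ.conf x) (l.map σ.gateMap) =
      Finsupp.mapDomain σ.conf (Setting.final x l) := by
  have key : ∀ (l : List Gate) (ψ : Conf →₀ ℂ),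
      (l.map σ.gateMap).foldl Gate.apply (Finsupp.mapDomain σ.conf ψ) =
        Finsupp.mapDomain σ.conf (l.foldl Gate.apply ψ) := by
    intro l
    induction l with
    | nil => intro ψ; rfl
    | cons g l ih =>
      intro ψ
      simp only [List.map_cons, List.foldl_cons]
      rw [apply_gateMap, ih]
  unfold Setting.final
  rw [← key, Finsupp.mapDomain_single]

/-! ### The action on settings -/

/-- The action on a value-dependent relation. -/
def rel (r : Conf → Gate → Gate → Prop) : Conf → Gate → Gate → Prop :=
  fun x g h => r (σ.conf x) (σ.gateMap g) (σ.gateMap h)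

theorem rel_rel (r : Conf → Gate → Gate → Prop) : σ.rel (σ.rel r) = r := by
  funext x g h
  simp [rel]

/-- The action on settings. -/
def setting (A : Setting) : Setting := ⟨σ.gates A.gates, σ.rel A.rel, σ.reg A.out⟩

theorem setting_setting (A : Setting) : σ.setting (σ.setting A) = A := by
  cases A
  simp [setting, rel_rel]

theorem outcomes_setting (A : Setting) : (σ.setting A).outcomes = σ.regs A.outcomes := by
  ext ρ
  simp only [Setting.outcomes, setting, Finset.mem_biUnion, Renaming.mem_regs]
  constructor
  · rintro ⟨g, hg, hρ⟩
    refine ⟨σ.gateMap g, σ.mem_gates.1 hg, ?_⟩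
    simpa [outcome_gateMap] using hρ
  · rintro ⟨g, hg, hρ⟩
    refine ⟨σ.gateMap g, by simpa using hg, ?_⟩
    simpa [outcome_gateMap] using hρ

/-- The set of outcome registers occurs in the type of `v`, so an equality of sets is used by
substitution only. -/
theorem init_congr {O O' : Finset Reg} (h : O = O') (v : (ρ : O) → Val ρ.1) :
    ∃ w : (ρ : O') → Val ρ.1,
      Conf.overwrite (fun _ => 0) O v = Conf.overwrite (fun _ => 0) O' w := by
  subst h
  exact ⟨v, rfl⟩

/-- The axioms of a circuit and of a schedule quantify over initial values of this form; this makes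
them transportable. -/
theorem exists_init (A : Setting) (v : (ρ : (σ.setting A).outcomes) → Val ρ.1) :
    ∃ w, σ.conf ((σ.setting A).init v) = A.init w := by
  obtain ⟨w, hw⟩ := init_congr (σ.outcomes_setting A) v
  refine ⟨σ.valEquiv A.outcomes w, ?_⟩
  unfold Setting.init
  rw [hw, Renaming.conf_overwrite]
  rfl

theorem lt_setting (A : Setting) (x : Conf) (g h : Gate) :
    (σ.setting A).lt x g h ↔ A.lt (σ.conf x) (σ.gateMap g) (σ.gateMap h) := by
  constructor
  · intro H
    exact Relation.TransGen.lift (p := A.rel (σ.conf x)) σ.gateMap (fun a b hab => hab) g h H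
  · intro H
    have := Relation.TransGen.lift (p := (σ.setting A).rel x) σ.gateMap
      (fun a b hab => by simpa [setting, rel] using hab) _ _ H
    change Relation.TransGen ((σ.setting A).rel x) g h
    simpa [Function.onFun] using this

theorem isCircuit_setting {A : Setting} (hA : A.IsCircuit) : (σ.setting A).IsCircuit where
  acyclic v g H := by
    rw [lt_setting] at H
    obtain ⟨w, hw⟩ := σ.exists_init A v
    rw [hw] at H
    exact hA.acyclic w _ H
  ordered v g hg h hh hne ρ hρ hc := by
    obtain ⟨w, hw⟩ := σ.exists_init A v
    simp only [setting, rel] at *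
    rw [hw]
    refine hA.ordered w _ (σ.mem_gates.1 hg) _ (σ.mem_gates.1 hh)
      (fun e => hne (σ.gateMap_injective e)) (σ.reg ρ) ?_ ?_
    · simpa [mem_tgt_gateMap] using hρ
    · simpa [mem_tgt_gateMap, mem_ctrlRegs_gateMap, compatible_gateMap] using hc
  awake v g hg h hh a ha hat := by
    obtain ⟨w, hw⟩ := σ.exists_init A v
    simp only [setting, rel] at *
    rw [hw]
    refine hA.awake w _ (σ.mem_gates.1 hg) _ (σ.mem_gates.1 hh) (σ.reg a) ?_ ?_
    · rw [wake_gateMap, ha]; rfl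
    · simpa [mem_tgt_gateMap] using hat
  fresh v m hm h hh hne ρ hρ hρh := by
    obtain ⟨w, hw⟩ := σ.exists_init A v
    simp only [setting, rel] at *
    rw [hw]
    refine hA.fresh w _ (σ.mem_gates.1 hm) _ (σ.mem_gates.1 hh)
      (fun e => hne (σ.gateMap_injective e)) (σ.reg ρ) ?_ ?_
    · simpa [outcome_gateMap] using hρ
    · simpa [mem_regs_gateMap] using hρh
  causal v v' g hg H h := by
    obtain ⟨w, hw⟩ := σ.exists_init A v
    obtain ⟨w', hw'⟩ := σ.exists_init A v'
    simp only [setting, rel] at H ⊢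
    simp only [setting] at hw hw'
    rw [hw, hw']
    refine hA.causal w w' _ (σ.mem_gates.1 hg) (fun m hm hmg ρ hρ => ?_) _
    rw [← hw, ← hw']
    refine H (σ.gateMap m) (by simpa using hm) ?_ (σ.reg ρ) ?_
    · simp only [setting] at *
      rw [hw]
      simpa using hmg
    · simpa [outcome_gateMap] using hρ

/-- The action on schedules. -/
def schedule {A : Setting} (s : A.Schedule) : (σ.setting A).Schedule where
  seq x := (s.seq (σ.conf x)).map σ.gateMap
  isSequence v := by
    obtain ⟨w, hw⟩ := σ.exists_init A v
    obtain ⟨h₁, h₂, h₃⟩ := s.isSequence w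
    rw [hw]
    refine ⟨h₁.map σ.gateMap_injective, fun g => ?_, ?_⟩
    · simp only [setting, mem_gates, ← h₂, List.mem_map]
      constructor
      · rintro ⟨h, hh, rfl⟩
        simpa using hh
      · intro h
        exact ⟨_, h, by simp⟩
    · rw [List.pairwise_map]
      refine h₃.imp fun {a b} hab => ?_
      rw [lt_setting, hw]
      simpa using hab

theorem zeroProb_congr {O O' : Finset Reg} (h : O = O') (f : Conf → ℝ) :
    ∑ v : ((ρ : O) → Val ρ.1), f (Conf.overwrite (fun _ => 0) O v) =
      ∑ v : ((ρ : O') → Val ρ.1), f (Conf.overwrite (fun _ => 0) O' v) := by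
  subst h
  rfl

/-- The final state is permuted by `conf`, the output register moves along, and the outcomes are
reindexed by `valEquiv`; hence the sum of squared amplitudes is the same. -/
theorem zeroProb_schedule {A : Setting} (s : A.Schedule) :
    (σ.setting A).zeroProb (σ.schedule s) = A.zeroProb s := by
  unfold Setting.zeroProb Setting.init
  rw [zeroProb_congr (σ.outcomes_setting A) fun x =>
    (Setting.final x ((σ.schedule s).seq x)).sum
      fun c a => if (c (σ.setting A).out : ℕ) = 0 then ‖a‖ ^ 2 else 0]
  refine Fintype.sum_equiv (σ.valEquiv A.outcomes) _ _ fun v => ?_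
  have hx : σ.conf (Conf.overwrite (fun _ => 0) (σ.regs A.outcomes) v) =
      Conf.overwrite (fun _ => 0) A.outcomes (σ.valEquiv A.outcomes v) := by
    rw [Renaming.conf_overwrite]; rfl
  rw [← hx]
  generalize Conf.overwrite (fun _ => 0) (σ.regs A.outcomes) v = x
  have hf : Setting.final x ((σ.schedule s).seq x) =
      Finsupp.mapDomain σ.conf (Setting.final (σ.conf x) (s.seq (σ.conf x))) := by
    rw [← final_map, Renaming.conf_conf]
    rfl
  rw [hf, Finsupp.sum_mapDomain_index_inj σ.conf_injective]
  refine Finsupp.sum_congr fun c _ => ?_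
  have : (σ.conf c (σ.setting A).out : ℕ) = c A.out := c.val_congr (σ.reg_reg A.out)
  rw [this]

theorem close_of_setting {A B : Setting} {ε : ℝ} (h : Close (σ.setting A) (σ.setting B) ε) :
    Close A B ε := by
  intro s t
  have := h (σ.schedule s) (σ.schedule t)
  rwa [zeroProb_schedule, zeroProb_schedule] at this

end Symmetry

/-! ### Membership in the registers and gates of a protocol -/

namespace Protocol

variable {P : Protocol} {r : Role} {ρ : Reg}

theorem mem_regs_of_role (hr : r ∈ P.roles) (h : ρ ∈ r.regs) : ρ ∈ P.regs :=
  Finset.mem_union_left _ (Finset.mem_biUnion.2 ⟨r, hr, h⟩)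

theorem mem_regs_of_io (h : ρ ∈ P.io) : ρ ∈ P.regs := Finset.mem_union_right _ h

theorem mem_links : ρ ∈ P.links ↔ ∃ r ∈ P.roles, ρ ∈ r.links := Finset.mem_biUnion

theorem mem_cors : ρ ∈ P.cors ↔ ∃ r ∈ P.roles, r.cor = some ρ := by
  simp [cors]

theorem mem_gates {g : Gate} : g ∈ P.gates ↔ ∃ r ∈ P.roles, g ∈ r.gates := Finset.mem_biUnion

theorem _root_.Role.mem_regs :
    ρ ∈ r.regs ↔ ρ ∈ r.priv ∨ ρ ∈ r.links ∨ r.cor = some ρ := by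
  simp [Role.regs]

theorem mem_regs : ρ ∈ P.regs ↔ (∃ r ∈ P.roles, ρ ∈ r.regs) ∨ ρ ∈ P.io := by
  simp [regs]

theorem mem_regs_of_links (h : ρ ∈ P.links) : ρ ∈ P.regs := by
  obtain ⟨r, hr, h⟩ := mem_links.1 h
  exact mem_regs_of_role hr (Role.mem_regs.2 (.inr (.inl h)))

theorem mem_regs_of_cors (h : ρ ∈ P.cors) : ρ ∈ P.regs := by
  obtain ⟨r, hr, h⟩ := mem_cors.1 h
  exact mem_regs_of_role hr (Role.mem_regs.2 (.inr (.inr h)))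

theorem _root_.Role.WellFormed.gate_regs (hr : r.WellFormed) {g : Gate} (hg : g ∈ r.gates)
    (h : ρ ∈ g.regs) : ρ ∈ r.regs := by
  rw [Role.mem_regs]
  rcases Finset.mem_union.1 h with h | h
  · exact hr.read g hg ρ h
  · rcases hr.write g hg ρ h with h | h
    · exact .inl h
    · exact .inr (.inl h.1)

end Protocol

/-! ### The action of symmetries on environments and simulators -/

namespace Symmetry

variable (σ : Symmetry)

/-- The action on open circuits. -/
def openCircuit (S : OpenCircuit) : OpenCircuit :=
  ⟨σ.regs S.regs, σ.gates S.gates, σ.rel S.ord, fun g h => S.cross (σ.gateMap g) (σ.gateMap h)⟩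

/-- The action on environments. -/
def environment (E : Environment) : Environment :=
  ⟨σ.openCircuit E.toOpenCircuit, σ.reg E.out⟩

theorem openCircuit_openCircuit (S : OpenCircuit) : σ.openCircuit (σ.openCircuit S) = S := by
  cases S
  simp [openCircuit, rel_rel]

theorem environment_environment (E : Environment) : σ.environment (σ.environment E) = E := by
  cases E
  simp [environment, openCircuit_openCircuit]

theorem size_openCircuit (S : OpenCircuit) : (σ.openCircuit S).size = S.size :=
  σ.gatesSize_gates S.gates

/-- The symmetry leaves the registers and gates of the protocol as they are. -/
structure Fixes (P : Protocol) : Prop where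
  regs : ∀ ρ ∈ P.regs, σ.reg ρ = ρ
  gates : ∀ g ∈ P.gates, σ.gateMap g = g

variable {σ} {P I : Protocol} {E : Environment}

theorem Fixes.reg_eq (hσ : σ.Fixes P) {ρ : Reg} (h : σ.reg ρ ∈ P.regs) : σ.reg ρ = ρ := by
  have := hσ.regs _ h
  rw [Renaming.reg_reg] at this
  exact this.symm

theorem Fixes.gateMap_eq (hσ : σ.Fixes P) {g : Gate} (h : σ.gateMap g ∈ P.gates) :
    σ.gateMap g = g := by
  have := hσ.gates _ h
  rw [gateMap_involutive] at this
  exact this.symm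

theorem Fixes.mem_gates (hσ : σ.Fixes P) {g : Gate} : σ.gateMap g ∈ P.gates ↔ g ∈ P.gates :=
  ⟨fun h => by rwa [hσ.gateMap_eq h] at h, fun h => by rwa [hσ.gates g h]⟩

theorem Fixes.conf_eq (hσ : σ.Fixes P) (x : Conf) {ρ : Reg} (h : ρ ∈ P.regs) :
    σ.conf x ρ = x ρ := by
  apply Fin.ext
  rw [Renaming.conf_val]
  exact x.val_congr (hσ.regs ρ h)

theorem Fixes.role_mem_gates (hσ : σ.Fixes P) {r : Role} (hr : r ∈ P.roles) {g : Gate} :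
    σ.gateMap g ∈ r.gates ↔ g ∈ r.gates := by
  have hP : ∀ {g}, g ∈ r.gates → g ∈ P.gates := fun h => Protocol.mem_gates.2 ⟨r, hr, h⟩
  exact ⟨fun h => by rwa [hσ.gateMap_eq (hP h)] at h, fun h => by rwa [hσ.gates g (hP h)]⟩

/-- The ordering of a circuit relates its own gates only and depends on its private registers only,
and both are fixed. -/
theorem Fixes.role_ord (hσ : σ.Fixes P) (hP : ∀ r ∈ P.roles, r.WellFormed) {r : Role}
    (hr : r ∈ P.roles) (x : Conf) (g h : Gate) :
    r.ord (σ.conf x) (σ.gateMap g) (σ.gateMap h) ↔ r.ord x g h := by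
  have hx : r.ord (σ.conf x) g h ↔ r.ord x g h := (hP r hr).ord_local _ _ (fun ρ hρ =>
    hσ.conf_eq x (Protocol.mem_regs_of_role hr (Role.mem_regs.2 (.inl hρ)))) g h
  rw [← hx]
  constructor
  · intro H
    have := (hP r hr).ord_gates _ _ _ H
    rwa [hσ.gateMap_eq (Protocol.mem_gates.2 ⟨r, hr, this.1⟩),
      hσ.gateMap_eq (Protocol.mem_gates.2 ⟨r, hr, this.2⟩)] at H
  · intro H
    have := (hP r hr).ord_gates _ _ _ H
    rwa [hσ.gates _ (Protocol.mem_gates.2 ⟨r, hr, this.1⟩),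
      hσ.gates _ (Protocol.mem_gates.2 ⟨r, hr, this.2⟩)]

theorem Fixes.exists_role_ord (hσ : σ.Fixes P) (hP : ∀ r ∈ P.roles, r.WellFormed) (x : Conf)
    (g h : Gate) :
    (∃ r ∈ P.roles, r.ord (σ.conf x) (σ.gateMap g) (σ.gateMap h)) ↔
      ∃ r ∈ P.roles, r.ord x g h :=
  exists_congr fun _ => and_congr_right fun hr => hσ.role_ord hP hr x g h

theorem Fixes.actsFor (hσ : σ.Fixes P) {g : Gate} {r : Role} (h : P.ActsFor (σ.gateMap g) r) :
    P.ActsFor g r := by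
  obtain ⟨hr, C, hC, hg⟩ := h
  refine ⟨hr, C, hC, ?_⟩
  rw [mem_ctrl_gateMap] at hg
  rwa [hσ.regs C (Protocol.mem_regs_of_role hr (Role.mem_regs.2 (.inr (.inr hC))))] at hg

theorem Fixes.gates_eq (hσ : σ.Fixes P) : σ.gates P.gates = P.gates := σ.gates_eq_self hσ.gates

theorem Fixes.setting_withProtocol (hσ : σ.Fixes P) (hP : ∀ r ∈ P.roles, r.WellFormed) :
    σ.setting (E.withProtocol P) = (σ.environment E).withProtocol P := by
  unfold setting Environment.withProtocol
  congr 1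
  · change σ.gates (E.gates ∪ P.gates) = _
    rw [Symmetry.gates, Finset.image_union]
    exact congrArg _ hσ.gates_eq
  · funext x g h
    simp only [rel, hσ.exists_role_ord hP]
    rfl

/-- `withIdeal` ignores the `cross` of the environment, so `E'` has to match the image of `E` only
in gates, ordering and output. This permits `E' = E` even if `σ` moves gates of `P` that occur in
`E.cross`. -/
theorem Fixes.setting_withIdeal (hσ : σ.Fixes I) (hI : ∀ r ∈ I.roles, r.WellFormed)
    {E E' : Environment} (hgates : E'.gates = σ.gates E.gates) (hord : E'.ord = σ.rel E.ord)
    (hout : E'.out = σ.reg E.out) (S : OpenCircuit) :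
    σ.setting (E.withIdeal I S) = E'.withIdeal I (σ.openCircuit S) := by
  unfold setting Environment.withIdeal
  congr 1
  · change σ.gates (E.gates ∪ I.gates ∪ S.gates) = _
    rw [Symmetry.gates, Finset.image_union, Finset.image_union, hgates]
    congr 2
    exact hσ.gates_eq
  · funext x g h
    simp only [rel, hσ.exists_role_ord hI, hord]
    rfl
  · exact hout.symm

theorem dependsOnlyOn_rel {r : Conf → Gate → Gate → Prop} {A B : Finset Reg}
    (h : DependsOnlyOn r A) (hAB : ∀ ρ ∈ A, σ.reg ρ ∈ B) : DependsOnlyOn (σ.rel r) B := by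
  intro x y hxy g k
  refine h _ _ (fun ρ hρ => ?_) _ _
  exact hxy _ (hAB ρ hρ)

theorem Fixes.disjoint_regs (hσ : σ.Fixes P) {A : Finset Reg} (h : Disjoint A P.regs) :
    Disjoint (σ.regs A) P.regs := by
  rw [Finset.disjoint_left] at h ⊢
  intro ρ hρ hρB
  rw [Renaming.mem_regs, hσ.regs ρ hρB] at hρ
  exact h hρ hρB

theorem Fixes.disjoint_gates (hσ : σ.Fixes P) {A : Finset Gate} (h : Disjoint A P.gates) :
    Disjoint (σ.gates A) P.gates := by
  rw [Finset.disjoint_left] at h ⊢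
  intro g hg hgB
  rw [Symmetry.mem_gates, hσ.gates g hgB] at hg
  exact h hg hgB

theorem Fixes.avoids (hσ : σ.Fixes I) (h : E.Avoids I) : (σ.environment E).Avoids I :=
  ⟨hσ.disjoint_regs h.1, hσ.disjoint_gates h.2⟩

theorem Fixes.valid (hσ : σ.Fixes P) (hP : ∀ r ∈ P.roles, r.WellFormed) (h : E.Valid P) :
    (σ.environment E).Valid P where
  regs_disjoint := hσ.disjoint_regs h.regs_disjoint
  gates_disjoint := hσ.disjoint_gates h.gates_disjoint
  out_mem := by
    change σ.reg E.out ∈ σ.regs E.regs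
    simpa using h.out_mem
  out_bit := h.out_bit
  write g hg ρ hρ := by
    have H := h.write _ (σ.mem_gates.1 hg) (σ.reg ρ) (by simpa [mem_tgt_gateMap] using hρ)
    rcases H with H | H | H | ⟨H, H'⟩ | ⟨r, hr, H⟩
    · exact .inl (σ.mem_regs.2 H)
    · rw [hσ.reg_eq (Protocol.mem_regs_of_io H)] at H
      exact .inr (.inl H)
    · rw [hσ.reg_eq (Protocol.mem_regs_of_cors H)] at H
      exact .inr (.inr (.inl H))
    · have hρ' := hσ.reg_eq (Protocol.mem_regs_of_links H)
      rw [hρ'] at H H'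
      exact .inr (.inr (.inr (.inl ⟨H, H'⟩)))
    · have hρP : σ.reg ρ ∈ P.regs := Protocol.mem_regs_of_role hr.1
        (Role.mem_regs.2 (H.imp_right fun H => .inl H.1))
      rw [hσ.reg_eq hρP] at H
      exact .inr (.inr (.inr (.inr ⟨r, hσ.actsFor hr, H⟩)))
  read g hg ρ hρ := by
    have H := h.read _ (σ.mem_gates.1 hg) (σ.reg ρ) (by simpa [mem_ctrlRegs_gateMap] using hρ)
    rcases H with H | H | H | ⟨H, H'⟩ | ⟨r, hr, H⟩
    · exact .inl (σ.mem_regs.2 H)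
    · rw [hσ.reg_eq (Protocol.mem_regs_of_io H)] at H
      exact .inr (.inl H)
    · rw [hσ.reg_eq (Protocol.mem_regs_of_cors H)] at H
      exact .inr (.inr (.inl H))
    · have hρ' := hσ.reg_eq (Protocol.mem_regs_of_links H)
      rw [hρ'] at H H'
      exact .inr (.inr (.inr (.inl ⟨H, H'⟩)))
    · have hρP : σ.reg ρ ∈ P.regs := Protocol.mem_regs_of_role hr.1
        (Role.mem_regs.2 (H.imp_right fun H => .inl H.1))
      rw [hσ.reg_eq hρP] at H
      exact .inr (.inr (.inr (.inr ⟨r, hσ.actsFor hr, H⟩)))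
  ord_gates x g k H := by
    have := h.ord_gates _ _ _ H
    exact ⟨σ.mem_gates.2 this.1, σ.mem_gates.2 this.2⟩
  ord_local := dependsOnlyOn_rel h.ord_local fun ρ hρ => σ.mem_regs.2 (by simpa using hρ)
  cross_pairs g k H := by
    have H' := h.cross_pairs _ _ H
    rw [hσ.mem_gates, hσ.mem_gates, shareReg_gateMap, shareLink_gateMap, ← σ.mem_gates,
      ← σ.mem_gates] at H'
    refine H'.imp_right (Or.imp_right ?_)
    rintro ⟨h₁, h₂, h₃, h₄⟩
    refine ⟨h₁, h₂, h₃, fun r hr => ?_⟩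
    rw [← hσ.role_mem_gates hr, ← hσ.role_mem_gates hr (g := k)]
    exact h₄ r hr
  isCircuit := by
    rw [← hσ.setting_withProtocol hP]
    exact σ.isCircuit_setting h.isCircuit

/-- Only the registers of `P` need to be fixed, because the rules for simulators do not mention the
gates of `P`. -/
theorem Fixes.validSimulator (hσ : σ.Fixes I) (hP : ∀ ρ ∈ P.regs, σ.reg ρ = ρ)
    (hI : ∀ r ∈ I.roles, r.WellFormed) {E E' : Environment} (hregs : E'.regs = σ.regs E.regs)
    (hgates : E'.gates = σ.gates E.gates) (hord : E'.ord = σ.rel E.ord)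
    (hout : E'.out = σ.reg E.out) {S : OpenCircuit} (h : S.ValidSimulator E P I) :
    (σ.openCircuit S).ValidSimulator E' P I := by
  have hP' : ∀ {ρ}, σ.reg ρ ∈ P.regs → σ.reg ρ = ρ := by
    intro ρ h
    have := hP _ h
    rw [Renaming.reg_reg] at this
    exact this.symm
  have hsim : ∀ {ρ}, σ.reg ρ ∈ S.simRegs P I → ρ ∈ (σ.openCircuit S).simRegs P I := by
    intro ρ h
    rcases Finset.mem_union.1 h with h | h
    · exact Finset.mem_union_left _ (σ.mem_regs.2 h)
    · rw [hP' (Finset.mem_sdiff.1 h).1] at h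
      exact Finset.mem_union_right _ h
  have hgE : ∀ {g}, σ.gateMap g ∈ E.gates ↔ g ∈ E'.gates := by
    intro g
    rw [hgates, σ.mem_gates]
  have hgEI : ∀ {g}, σ.gateMap g ∈ E.gates ∪ I.gates ↔ g ∈ E'.gates ∪ I.gates := by
    intro g
    rw [Finset.mem_union, Finset.mem_union, hgE, hσ.mem_gates]
  exact
  { regs_disjoint := by
      refine ⟨?_, ?_, hσ.disjoint_regs h.regs_disjoint.2.2⟩
      · have := h.regs_disjoint.1
        rw [hregs, Finset.disjoint_left] at *
        intro ρ h₁ h₂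
        exact this (σ.mem_regs.1 h₁) (σ.mem_regs.1 h₂)
      · have := h.regs_disjoint.2.1
        rw [Finset.disjoint_left] at *
        intro ρ h₁ h₂
        refine this (σ.mem_regs.1 h₁) ?_
        rwa [hP ρ h₂]
    gates_disjoint := by
      refine ⟨?_, hσ.disjoint_gates h.gates_disjoint.2⟩
      have := h.gates_disjoint.1
      rw [hgates, Finset.disjoint_left] at *
      intro ρ h₁ h₂
      exact this (σ.mem_gates.1 h₁) (σ.mem_gates.1 h₂)
    write := fun g hg ρ hρ => by
      have H := h.write _ (σ.mem_gates.1 hg) (σ.reg ρ) (by simpa [mem_tgt_gateMap] using hρ)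
      rcases H with H | ⟨r, hr, H⟩
      · exact .inl (hsim H)
      · have hρI : σ.reg ρ ∈ I.regs := by
          rcases H with H | H | H
          · exact Protocol.mem_regs_of_role hr.1 (Role.mem_regs.2 (.inl H))
          · exact Protocol.mem_regs_of_role hr.1 (Role.mem_regs.2 (.inr (.inl H.1)))
          · exact Protocol.mem_regs_of_links H.1
        rw [hσ.reg_eq hρI] at H
        exact .inr ⟨r, hσ.actsFor hr, H⟩
    read := fun g hg ρ hρ => by
      have H := h.read _ (σ.mem_gates.1 hg) (σ.reg ρ) (by simpa [mem_ctrlRegs_gateMap] using hρ)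
      rcases H with H | H | ⟨r, hr, H⟩
      · exact .inl (hsim H)
      · rw [hσ.reg_eq (Protocol.mem_regs_of_cors H)] at H
        exact .inr (.inl H)
      · have hρI : σ.reg ρ ∈ I.regs := by
          rcases H with H | H | H
          · exact Protocol.mem_regs_of_role hr.1 (Role.mem_regs.2 (.inl H))
          · exact Protocol.mem_regs_of_role hr.1 (Role.mem_regs.2 (.inr (.inl H.1)))
          · exact Protocol.mem_regs_of_links H.1
        rw [hσ.reg_eq hρI] at H
        exact .inr (.inr ⟨r, hσ.actsFor hr, H⟩)
    ord_gates := fun x g k H => by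
      have := h.ord_gates _ _ _ H
      exact ⟨σ.mem_gates.2 this.1, σ.mem_gates.2 this.2⟩
    ord_local := dependsOnlyOn_rel h.ord_local fun ρ hρ => hsim (by simpa using hρ)
    cross_pairs := fun g k H => by
      have H' := h.cross_pairs _ _ H
      simp only [hσ.mem_gates, shareReg_gateMap, shareLink_gateMap, ← σ.mem_gates (G := S.gates),
        hgE, hgEI] at H'
      refine H'.imp_right (Or.imp_right (Or.imp_right (Or.imp_right ?_)))
      rintro ⟨h₁, h₂, h₃, h₄⟩
      refine ⟨h₁, h₂, h₃, fun r hr => ?_⟩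
      rw [← hσ.role_mem_gates hr, ← hσ.role_mem_gates hr (g := k)]
      exact h₄ r hr
    isCircuit := by
      rw [← hσ.setting_withIdeal hI hgates hord hout]
      exact σ.isCircuit_setting h.isCircuit }

end Symmetry

/-! ### Fresh names -/

/-- The involution that shifts the numbers of the elements of `A` by a large number, and shifts their
copies back. -/
theorem exists_shift {X : Type*} (num : X → ℕ) (renum : X → ℕ → X)
    (hnum : ∀ x n, num (renum x n) = n) (hself : ∀ x, renum x (num x) = x)
    (hrenum : ∀ x m n, renum (renum x m) n = renum x n) (A F : Finset X) :
    ∃ f : X → ℕ, (∀ x, renum (renum x (f x)) (f (renum x (f x))) = x) ∧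
      (∀ x ∈ F, x ∉ A → f x = num x) ∧ ∀ x ∈ A, renum x (f x) ∉ F := by
  classical
  -- All numbers in `A ∪ F` are below `N`. So shifted elements lie outside `A ∪ F`, and the cases
  -- "shift up" and "shift back" of the involution exclude each other.
  obtain ⟨N, hN⟩ : ∃ N, ∀ x ∈ A ∪ F, num x < N :=
    ⟨(A ∪ F).sup num + 1, fun x hx => Nat.lt_succ_of_le (Finset.le_sup hx)⟩
  have hNA : ∀ x ∈ A, num x < N := fun x hx => hN x (Finset.mem_union_left _ hx)
  have hNF : ∀ x ∈ F, num x < N := fun x hx => hN x (Finset.mem_union_right _ hx)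
  refine ⟨fun x => if x ∈ A then num x + N else
    if N ≤ num x ∧ renum x (num x - N) ∈ A then num x - N else num x, fun x => ?_,
    fun x hx hxA => ?_, fun x hx hxF => ?_⟩
  · rw [hrenum]
    by_cases hx : x ∈ A
    · have h₁ : renum x (num x + N) ∉ A := fun h => by
        have := hNA _ h
        rw [hnum] at this
        omega
      simp only [if_neg h₁, hnum, hrenum, Nat.le_add_left, Nat.add_sub_cancel, hself,
        hx, and_self, if_true]
    · by_cases hx' : N ≤ num x ∧ renum x (num x - N) ∈ A
      · simp only [if_neg hx, if_pos hx', if_pos hx'.2, hnum]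
        rw [Nat.sub_add_cancel hx'.1, hself]
      · simp only [if_neg hx, if_neg hx', hself]
  · have := hNF x hx
    simp only [if_neg hxA]
    rw [if_neg]
    omega
  · simp only [if_pos hx] at hxF
    have := hNF _ hxF
    rw [hnum] at this
    omega

/-- A symmetry that gives fresh numbers to the gates in `A`. -/
theorem Symmetry.exists_gate_shift (A F : Finset Gate) :
    ∃ σ : Symmetry, (∀ ρ, σ.reg ρ = ρ) ∧ (∀ g ∈ F, g ∉ A → σ.gateMap g = g) ∧
      Disjoint (σ.gates A) F := by
  obtain ⟨f, h₁, h₂, h₃⟩ := exists_shift Gate.id (fun g n => { g with id := n })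
    (fun _ _ => rfl) (fun _ => rfl) (fun _ _ _ => rfl) A F
  refine ⟨{ Renaming.refl with
    gateMap := fun g => { g with id := f g }
    gateMap_involutive := h₁
    ctrl_gateMap := fun g => (Renaming.refl.ctrl_eq_self fun _ _ => rfl).symm
    op_gateMap := fun g => (Renaming.refl.op_eq_self fun _ _ => rfl).symm
    wake_gateMap := fun g => by
      change g.wake = g.wake.map id
      simp }, fun ρ => rfl, fun g hg hgA => ?_, ?_⟩
  · change { g with id := f g } = g
    rw [h₂ g hg hgA]
  · rw [Finset.disjoint_left]
    intro g hg hgF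
    rw [Symmetry.mem_gates] at hg
    have := h₃ _ hg
    rw [show g = _ from (h₁ g).symm] at hgF
    exact this hgF

/-- A symmetry that gives fresh names to the registers in `A`. -/
theorem Symmetry.exists_reg_shift (A F : Finset Reg) :
    ∃ σ : Symmetry, (∀ g : Gate, (∀ ρ ∈ g.regs, σ.reg ρ = ρ) → σ.gateMap g = g) ∧
      (∀ ρ ∈ F, ρ ∉ A → σ.reg ρ = ρ) ∧
      Disjoint (σ.regs A) F := by
  obtain ⟨f, h₁, h₂, h₃⟩ := exists_shift Reg.name (fun ρ n => { ρ with name := n })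
    (fun _ _ => rfl) (fun _ => rfl) (fun _ _ _ => rfl) A F
  let π : Renaming := ⟨f, h₁⟩
  refine ⟨{ π with
    gateMap := π.gate
    gateMap_involutive := π.gate_gate
    ctrl_gateMap := fun g => rfl
    op_gateMap := fun g => rfl
    wake_gateMap := fun g => rfl }, fun g hg => π.gate_eq_self hg, fun ρ hρ hρA => ?_, ?_⟩
  · change (⟨f ρ, ρ.classical, ρ.top, ρ.kind⟩ : Reg) = ρ
    rw [h₂ ρ hρ hρA]
  · rw [Finset.disjoint_left]
    intro ρ hρ hρF
    rw [Renaming.mem_regs] at hρ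
    have := h₃ _ hρ
    rw [show ρ = _ from (h₁ ρ).symm] at hρF
    exact this hρF

/-! ## Schedules -/

/-- An element with the fewest predecessors is minimal, since any predecessor would have strictly
fewer. It serves both for sequences of gates and for the choice of the next node. -/
theorem exists_forall_not_lt {X : Type*} (lt : X → X → Prop)
    (htrans : ∀ a b c, lt a b → lt b c → lt a c) (hirrefl : ∀ a, ¬ lt a a) {s : Finset X}
    (hs : s.Nonempty) : ∃ g ∈ s, ∀ h ∈ s, ¬ lt h g := by
  classical
  obtain ⟨g, hg, hmin⟩ := s.exists_min_image (fun g => (s.filter fun h => lt h g).card) hs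
  refine ⟨g, hg, fun h hh hlt => (hmin h hh).not_gt (Finset.card_lt_card ?_)⟩
  refine Finset.ssubset_iff_of_subset (fun k hk => ?_) |>.2 ⟨h, ?_, ?_⟩
  · rw [Finset.mem_filter] at hk ⊢
    exact ⟨hk.1, htrans _ _ _ hk.2 hlt⟩
  · exact Finset.mem_filter.2 ⟨hh, hlt⟩
  · exact fun hk => hirrefl h (Finset.mem_filter.1 hk).2

theorem exists_topological_sort {X : Type*} [DecidableEq X] (lt : X → X → Prop)
    (htrans : ∀ a b c, lt a b → lt b c → lt a c) (hirrefl : ∀ a, ¬ lt a a) (s : Finset X) :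
    ∃ l : List X, l.Nodup ∧ (∀ g, g ∈ l ↔ g ∈ s) ∧ l.Pairwise fun g h => ¬ lt h g := by
  induction s using Finset.strongInduction with
  | _ s ih =>
    rcases s.eq_empty_or_nonempty with rfl | hs
    · exact ⟨[], by simp⟩
    · obtain ⟨g, hg, hmin⟩ := exists_forall_not_lt lt htrans hirrefl hs
      obtain ⟨l, h₁, h₂, h₃⟩ := ih (s.erase g) (Finset.erase_ssubset hg)
      refine ⟨g :: l, ?_, fun h => ?_, ?_⟩
      · rw [List.nodup_cons]
        exact ⟨fun h => by simp [h₂] at h, h₁⟩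
      · rw [List.mem_cons, h₂, Finset.mem_erase]
        by_cases hh : h = g <;> simp [hh, hg]
      · rw [List.pairwise_cons]
        exact ⟨fun h hh => hmin h (Finset.mem_of_mem_erase ((h₂ h).1 hh)), h₃⟩

open Classical in
theorem Setting.IsCircuit.nonempty_schedule {A : Setting} (hA : A.IsCircuit) :
    Nonempty A.Schedule := by
  have H : ∀ v, ∃ l, A.IsSequence (A.init v) l := fun v =>
    exists_topological_sort (A.lt (A.init v)) (fun _ _ _ => Relation.TransGen.trans)
      (hA.acyclic v) A.gates
  -- A schedule is a function of the configuration and not of `v`; configurations without a sequence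
  -- get an arbitrary value.
  refine ⟨⟨fun x => if h : ∃ l, A.IsSequence x l then h.choose else [], fun v => ?_⟩⟩
  rw [dif_pos (H v)]
  exact (H v).choose_spec

/-- `Close` quantifies over all schedules and would be vacuous for a `B` without any; `IsCircuit`
provides one through which the triangle inequality passes. -/
theorem Close.trans {A B C : Setting} {ε δ : ℝ} (hB : B.IsCircuit) (h : Close A B ε)
    (h' : Close B C δ) : Close A C (ε + δ) := by
  obtain ⟨t⟩ := hB.nonempty_schedule
  intro s u
  exact (abs_sub_le _ (B.zeroProb t) _).trans (add_le_add (h s t) (h' t u))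

theorem Symmetry.close_setting_right (σ : Symmetry) {A B : Setting} {ε : ℝ} (h : Close A B ε) :
    Close A (σ.setting B) ε := by
  intro s t
  rw [← σ.zeroProb_schedule t]
  -- `σ.setting (σ.setting B)` equals `B` only propositionally, and schedules depend on the setting,
  -- so the bound is stated for every `C = B`.
  have key : ∀ C : Setting, C = B → ∀ u : C.Schedule, |A.zeroProb s - C.zeroProb u| ≤ ε := by
    rintro _ rfl u
    exact h s u
  exact key _ (σ.setting_setting B) _

/-! ## Fresh environments and simulators -/

/-- The gates of a simulator may be chosen outside of a given set of gates. -/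
theorem OpenCircuit.ValidSimulator.exists_fresh {S : OpenCircuit} {E : Environment}
    {P I : Protocol} (h : S.ValidSimulator E P I) (hI : ∀ r ∈ I.roles, r.WellFormed)
    (hE : ∀ x g k, E.ord x g k → g ∈ E.gates ∧ k ∈ E.gates) (F : Finset Gate) :
    ∃ S' : OpenCircuit, S'.ValidSimulator E P I ∧ S'.size = S.size ∧ Disjoint S'.gates F ∧
      ∀ A ε, Close A (E.withIdeal I S) ε → Close A (E.withIdeal I S') ε := by
  -- The gates of `E` and `I` are put in the set of gates to be kept; they stay fixed since `S` has
  -- no gate in common with them.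
  obtain ⟨σ, hreg, hfix, hdisj⟩ := Symmetry.exists_gate_shift S.gates (F ∪ E.gates ∪ I.gates)
  have hσE : ∀ g ∈ E.gates, σ.gateMap g = g := fun g hg =>
    hfix g (by simp [hg]) fun hS => Finset.disjoint_left.1 h.gates_disjoint.1 hS hg
  have hσI : σ.Fixes I := ⟨fun ρ _ => hreg ρ, fun g hg =>
    hfix g (by simp [hg]) fun hS => Finset.disjoint_left.1 h.gates_disjoint.2 hS hg⟩
  have hconf : ∀ x, σ.conf x = x := fun x => by
    funext ρ
    exact Fin.ext (x.val_congr (hreg ρ))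
  have hσE' : ∀ {g}, σ.gateMap g ∈ E.gates → σ.gateMap g = g := fun hg => by
    have := hσE _ hg
    rw [σ.gateMap_involutive] at this
    exact this.symm
  have hord : E.ord = σ.rel E.ord := by
    funext x g k
    simp only [Symmetry.rel, hconf]
    refine propext ⟨fun H => ?_, fun H => ?_⟩
    · rwa [hσE g (hE _ _ _ H).1, hσE k (hE _ _ _ H).2]
    · have := hE _ _ _ H
      rwa [hσE' this.1, hσE' this.2] at H
  have hregs : E.regs = σ.regs E.regs := (σ.regs_eq_self fun ρ _ => hreg ρ).symm
  have hgates : E.gates = σ.gates E.gates := (σ.gates_eq_self hσE).symm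
  have hout : E.out = σ.reg E.out := (hreg _).symm
  refine ⟨σ.openCircuit S,
    hσI.validSimulator (fun ρ _ => hreg ρ) hI hregs hgates hord hout h, σ.size_openCircuit S,
    hdisj.mono_right fun g hg => by simp [hg], fun A ε hA => ?_⟩
  rw [← hσI.setting_withIdeal hI hgates hord hout]
  exact σ.close_setting_right hA

/-- There is a good simulator against `E`. -/
def Simulates (P I : Protocol) (E : Environment) (Q : ℕ → ℝ → Prop) : Prop :=
  ∃ (S : OpenCircuit) (ε : ℝ), S.ValidSimulator E P I ∧ Q S.size ε ∧
    Close (E.withProtocol P) (E.withIdeal I S) ε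

/-- A simulator against the image of `E` is pulled back by `σ` itself, which is its own inverse. -/
theorem Symmetry.Fixes.simulates {σ : Symmetry} {P I : Protocol} {E : Environment}
    {Q : ℕ → ℝ → Prop} (hP : ∀ r ∈ P.roles, r.WellFormed) (hI : ∀ r ∈ I.roles, r.WellFormed)
    (hσP : σ.Fixes P) (hσI : σ.Fixes I) (h : Simulates P I (σ.environment E) Q) :
    Simulates P I E Q := by
  obtain ⟨S, ε, h₁, h₂, h₃⟩ := h
  have hE := σ.environment_environment E
  refine ⟨σ.openCircuit S, ε, ?_, by rwa [σ.size_openCircuit], ?_⟩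
  · have := hσI.validSimulator (E' := σ.environment (σ.environment E)) hσP.regs hI rfl rfl rfl rfl
      h₁
    rwa [hE] at this
  · apply σ.close_of_setting
    rw [hσP.setting_withProtocol hP, hσI.setting_withIdeal (E' := σ.environment E) hI rfl rfl rfl,
      σ.openCircuit_openCircuit]
    exact h₃

/-- It suffices to consider environments that do not use given names. -/
theorem simulates_of_fresh {P I : Protocol} {Q : ℕ → ℝ → Prop}
    (hP : ∀ r ∈ P.roles, r.WellFormed) (hI : ∀ r ∈ I.roles, r.WellFormed)
    (FR : Finset Reg) (FG : Finset Gate) {E : Environment} (hE : E.Valid P) (hEI : E.Avoids I)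
    (h : ∀ E' : Environment, E'.Valid P → E'.Avoids I → Disjoint E'.regs FR →
      Disjoint E'.gates FG → E'.size = E.size → Simulates P I E' Q) :
    Simulates P I E Q := by
  have hgate : ∀ {P : Protocol}, (∀ r ∈ P.roles, r.WellFormed) → ∀ g ∈ P.gates, ∀ ρ ∈ g.regs,
      ρ ∈ P.regs := by
    intro P hP g hg ρ hρ
    obtain ⟨r, hr, hg⟩ := Protocol.mem_gates.1 hg
    exact Protocol.mem_regs_of_role hr ((hP r hr).gate_regs hg hρ)
  obtain ⟨σ, h₁, h₂, h₃⟩ := Symmetry.exists_reg_shift E.regs (FR ∪ P.regs ∪ I.regs)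
  have hσP : ∀ ρ ∈ P.regs, σ.reg ρ = ρ := fun ρ hρ => h₂ ρ (by simp [hρ]) fun h =>
    Finset.disjoint_left.1 hE.regs_disjoint h hρ
  have hσI : ∀ ρ ∈ I.regs, σ.reg ρ = ρ := fun ρ hρ => h₂ ρ (by simp [hρ]) fun h =>
    Finset.disjoint_left.1 hEI.1 h hρ
  -- A gate of `P` or of `I` is fixed because all its registers are.
  have fP : σ.Fixes P := ⟨hσP, fun g hg => h₁ g fun ρ hρ => hσP ρ (hgate hP g hg ρ hρ)⟩
  have fI : σ.Fixes I := ⟨hσI, fun g hg => h₁ g fun ρ hρ => hσI ρ (hgate hI g hg ρ hρ)⟩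
  refine fP.simulates hP hI fI ?_
  have hE' := fP.valid hP hE
  have hEI' := fI.avoids hEI
  -- Gates are renumbered after the renaming of registers, since that renaming could turn a gate of
  -- `E` into one of `FG`.
  obtain ⟨τ, k₁, k₂, k₃⟩ := Symmetry.exists_gate_shift (σ.environment E).gates
    (FG ∪ P.gates ∪ I.gates)
  have gP : τ.Fixes P := ⟨fun ρ _ => k₁ ρ, fun g hg => k₂ g (by simp [hg]) fun h =>
    Finset.disjoint_left.1 hE'.gates_disjoint h hg⟩
  have gI : τ.Fixes I := ⟨fun ρ _ => k₁ ρ, fun g hg => k₂ g (by simp [hg]) fun h =>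
    Finset.disjoint_left.1 hEI'.2 h hg⟩
  refine gP.simulates hP hI gI (h _ (gP.valid hP hE') (gI.avoids hEI') ?_ ?_ ?_)
  · change Disjoint (τ.regs (σ.regs E.regs)) FR
    rw [τ.regs_eq_self fun ρ _ => k₁ ρ]
    exact h₃.mono_right fun ρ hρ => by simp [hρ]
  · exact k₃.mono_right fun g hg => by simp [hg]
  · exact (τ.size_openCircuit _).trans (σ.size_openCircuit _)

namespace ProtocolTree

variable {T : ProtocolTree}

/-! ## The order of the nodes -/

theorem Below.refl (q : T.Node) : T.Below q q := Relation.ReflTransGen.refl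

theorem Below.trans {a b c : T.Node} (h : T.Below a b) (h' : T.Below b c) : T.Below a c :=
  Relation.ReflTransGen.trans h h'

theorem below_of_parent {a b : T.Node} (h : T.parent a = some b) : T.Below a b :=
  Relation.ReflTransGen.single h

theorem Below.exists_parent {j q : T.Node} (h : T.Below j q) (hne : j ≠ q) :
    ∃ p, T.parent j = some p ∧ T.Below p q := by
  rcases Relation.ReflTransGen.cases_head h with h | h
  · exact absurd h hne
  · exact h

theorem Below.exists_child {j q : T.Node} (h : T.Below j q) (hne : j ≠ q) :
    ∃ i, T.parent i = some q ∧ T.Below j i := by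
  rcases Relation.ReflTransGen.cases_tail h with h | ⟨i, h, h'⟩
  · exact absurd h.symm hne
  · exact ⟨i, h', h⟩

/-- There are no cycles: a cycle through a node would also pass through its parent, and so on up to
the root, which has no parent. -/
theorem not_below_of_parent {j p : T.Node} (h : T.parent j = some p) : ¬ T.Below p j := by
  have key : ∀ j, ∀ p, T.parent j = some p → ¬ T.Below p j := fun j => by
    refine Relation.ReflTransGen.head_induction_on
      (motive := fun j _ => ∀ p, T.parent j = some p → ¬ T.Below p j) (T.reaches_root j) ?_ ?_
    · intro p h
      rw [T.parent_root] at h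
      cases h
    · intro a b hab _ ih p h hpa
      rw [hab] at h
      obtain rfl := Option.some.inj h
      by_cases hba : b = a
      · subst hba
        exact ih _ hab (Below.refl _)
      · obtain ⟨c, hbc, hca⟩ := hpa.exists_parent hba
        exact ih c hbc (hca.trans (below_of_parent hab))
  exact key j p h

theorem Below.antisymm {a b : T.Node} (h : T.Below a b) (h' : T.Below b a) : a = b := by
  by_contra hne
  obtain ⟨p, hp, hpb⟩ := h.exists_parent hne
  exact not_below_of_parent hp (hpb.trans h')

theorem below_root (q : T.Node) : T.Below q T.root := T.reaches_root q

theorem mem_children {i q : T.Node} : i ∈ T.children q ↔ T.parent i = some q := by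
  simp [children]

theorem below_of_child {k q j : T.Node} (hk : T.parent k = some q) (h : T.Below k j) :
    k = j ∨ T.Below q j := by
  by_cases hne : k = j
  · exact .inl hne
  · obtain ⟨p, hp, hpj⟩ := h.exists_parent hne
    rw [hk] at hp
    cases hp
    exact .inr hpj

/-! ## The registers of the tree -/

/-- The register occurs at the node `j`. -/
def Occurs (T : ProtocolTree) (j : T.Node) (ρ : Reg) : Prop :=
  ρ ∈ (T.mainProtocol j).regs ∨ ρ ∈ (T.ideal j).regs

/-- All registers of the tree. -/
def allRegs (T : ProtocolTree) : Finset Reg :=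
  Finset.univ.biUnion fun j => (T.mainProtocol j).regs ∪ (T.ideal j).regs

/-- All gates of the tree. -/
def allGates (T : ProtocolTree) : Finset Gate :=
  Finset.univ.biUnion fun j => (T.mainProtocol j).gates ∪ (T.ideal j).gates

theorem mem_allRegs {ρ : Reg} : ρ ∈ T.allRegs ↔ ∃ j, T.Occurs j ρ := by
  simp [allRegs, Occurs]

theorem mem_allGates {g : Gate} :
    g ∈ T.allGates ↔ ∃ j, g ∈ (T.mainProtocol j).gates ∨ g ∈ (T.ideal j).gates := by
  simp [allGates]

theorem mem_tilde_roles {q : T.Node} {r : Role} :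
    r ∈ (T.tilde q).roles ↔ r ∈ T.main q ∨ ∃ i, T.parent i = some q ∧ r ∈ (T.ideal i).roles := by
  simp [tilde, mem_children]

theorem mem_protocol_roles {r : Role} : r ∈ T.protocol.roles ↔ ∃ j, r ∈ T.main j := by
  classical
  simp [protocol, sub, below_root]

theorem mem_main_regs {q : T.Node} {r : Role} (hr : r ∈ T.main q) {ρ : Reg} (h : ρ ∈ r.regs) :
    ρ ∈ (T.mainProtocol q).regs :=
  Protocol.mem_regs_of_role (P := T.mainProtocol q) hr h

theorem occursBelow_of_role {q : T.Node} {r : Role} (hr : r ∈ (T.tilde q).roles) {ρ : Reg}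
    (h : ρ ∈ r.regs) :
    ρ ∈ (T.mainProtocol q).regs ∨ ∃ i ∈ T.children q, T.OccursBelow i ρ := by
  rcases mem_tilde_roles.1 hr with hr | ⟨i, hi, hr⟩
  · exact .inl (mem_main_regs hr h)
  · exact .inr ⟨i, mem_children.2 hi, i, Below.refl i, .inr (Protocol.mem_regs_of_role hr h)⟩

theorem occursBelow_of_own {q : T.Node} {ρ : Reg}
    (h : ρ ∈ (T.mainProtocol q).regs ∨ ∃ i ∈ T.children q, T.OccursBelow i ρ) :
    T.OccursBelow q ρ := by
  rcases h with h | ⟨i, hi, j, hj, h⟩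
  · exact ⟨q, Below.refl q, .inl h⟩
  · exact ⟨j, hj.trans (below_of_parent (mem_children.1 hi)), h⟩

theorem occursBelow_of_ideal {q : T.Node} {ρ : Reg} (h : ρ ∈ (T.ideal q).regs) :
    T.OccursBelow q ρ := ⟨q, Below.refl q, .inr h⟩

theorem occursBelow_of_tilde {q : T.Node} {ρ : Reg} (h : ρ ∈ (T.tilde q).regs) :
    T.OccursBelow q ρ := by
  rcases Protocol.mem_regs.1 h with ⟨r, hr, h⟩ | h
  · exact occursBelow_of_own (occursBelow_of_role hr h)
  · exact occursBelow_of_ideal (Protocol.mem_regs_of_io (P := T.ideal q) h)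

theorem OccursBelow.mem_allRegs {q : T.Node} {ρ : Reg} (h : T.OccursBelow q ρ) :
    ρ ∈ T.allRegs := by
  obtain ⟨i, -, h⟩ := h
  exact ProtocolTree.mem_allRegs.2 ⟨i, h⟩

theorem _root_.Reg.IsLink.kind_ne {ρ : Reg} (h : ρ.IsLink) :
    ρ.kind ≠ .storage ∧ ρ.kind ≠ .corruption := by
  rcases h with ⟨t, s, d, h⟩ | ⟨t, s, d, h⟩ <;> simp [h]

theorem mem_ideal_regs {q : T.Node} {ρ : Reg}
    (h : ρ ∈ (T.ideal q).io ∨ ρ ∈ (T.ideal q).cors) : ρ ∈ (T.ideal q).regs :=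
  h.elim Protocol.mem_regs_of_io Protocol.mem_regs_of_cors

/-- The register occurs outside of the subtree of `p`, or in the ideal protocol of `p`. -/
def Outer (T : ProtocolTree) (ρ : Reg) (p : T.Node) : Prop :=
  (∃ j, ¬ T.Below j p ∧ T.Occurs j ρ) ∨ ρ ∈ (T.ideal p).regs

/-- What is outside of a subtree is outside of the smaller one, and `I(p)` itself sits at `p`, which
is not below its child `j`. -/
theorem outer_of_parent {j p : T.Node} (h : T.parent j = some p) {ρ : Reg} (hρ : T.Outer ρ p) :
    T.Outer ρ j := by
  rcases hρ with ⟨i, hi, hρ⟩ | hρ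
  · exact .inl ⟨i, fun hij => hi (hij.trans (below_of_parent h)), hρ⟩
  · exact .inl ⟨p, not_below_of_parent h, .inr hρ⟩

theorem outer_of_below {j p : T.Node} (h : T.Below j p) {ρ : Reg} (hρ : T.Outer ρ p) :
    T.Outer ρ j := by
  refine Relation.ReflTransGen.head_induction_on (motive := fun j _ => T.Outer ρ j) h hρ ?_
  intro a b hab _ ih
  exact outer_of_parent hab ih

namespace WellFormed

variable (hT : T.WellFormed)
include hT

theorem tilde_role {q : T.Node} {r : Role} (hr : r ∈ (T.tilde q).roles) : r.WellFormed := by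
  rcases mem_tilde_roles.1 hr with hr | ⟨i, _, hr⟩
  · exact (hT.main_wf q).roles_wf r hr
  · exact (hT.ideal_wf i).roles_wf r hr

theorem protocol_role {r : Role} (hr : r ∈ T.protocol.roles) : r.WellFormed := by
  obtain ⟨j, hr⟩ := mem_protocol_roles.1 hr
  exact (hT.main_wf j).roles_wf r hr

theorem ideal_cors_kind {q : T.Node} {ρ : Reg} (h : ρ ∈ (T.ideal q).cors) :
    ρ.kind = .corruption := by
  obtain ⟨r, hr, h⟩ := Protocol.mem_cors.1 h
  exact (((hT.ideal_wf q).roles_wf r hr).cor_kind ρ h).1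

/-- Private, channel and corruption registers are told apart by their kind. -/
theorem tilde_link {q : T.Node} {ρ : Reg} (h : ρ ∈ (T.tilde q).regs) (hl : ρ.IsLink) :
    ρ ∈ (T.ideal q).io ∨ ρ ∈ (T.tilde q).links := by
  rcases Protocol.mem_regs.1 h with ⟨r, hr, h⟩ | h
  · rcases Role.mem_regs.1 h with h | h | h
    · exact absurd ((hT.tilde_role hr).priv_kind ρ h) hl.kind_ne.1
    · exact .inr (Protocol.mem_links.2 ⟨r, hr, h⟩)
    · exact absurd ((hT.tilde_role hr).cor_kind ρ h).1 hl.kind_ne.2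
  · exact .inl h

theorem io_link {q : T.Node} {ρ : Reg} (h : ρ ∈ (T.ideal q).io) : ρ.IsLink :=
  (hT.ideal_wf q).io_link ρ h

theorem tilde_cor {q : T.Node} {ρ : Reg} (h : ρ ∈ (T.tilde q).regs) (hk : ρ.kind = .corruption) :
    ρ ∈ (T.tilde q).cors := by
  rcases Protocol.mem_regs.1 h with ⟨r, hr, h⟩ | h
  · rcases Role.mem_regs.1 h with h | h | h
    · rw [(hT.tilde_role hr).priv_kind ρ h] at hk
      cases hk
    · exact absurd hk ((hT.tilde_role hr).links_kind ρ h).1.kind_ne.2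
    · exact Protocol.mem_cors.2 ⟨r, hr, h⟩
  · exact absurd hk (hT.io_link h).kind_ne.2

/-! ### Registers that are visible outside of a subtree -/

/-- Besides input/output channels, ideal protocols share only corruption registers, and these only
with nodes above; `hc` excludes this second possibility. -/
theorem ideal_outside_io {q j : T.Node} (hj : ¬ T.Below j q) {ρ : Reg} (h : T.OccursBelow q ρ)
    (hρ : ρ ∈ (T.ideal j).regs) (hc : ¬ T.Below q j ∨ ρ.kind ≠ .corruption) :
    ρ ∈ (T.ideal q).io := by
  rcases hT.ideal_outside q j hj ρ h hρ with h | ⟨h, h'⟩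
  · exact h
  · rcases hc with hc | hc
    · exact absurd h hc
    · exact absurd (hT.ideal_cors_kind h') hc

theorem outside_mem_ideal {q j : T.Node} (hj : ¬ T.Below j q) {ρ : Reg} (h : T.OccursBelow q ρ)
    (hρ : T.Occurs j ρ) : ρ ∈ (T.ideal q).io ∨ ρ ∈ (T.ideal q).cors := by
  rcases hρ with hρ | hρ
  · exact .inl (hT.main_outside q j hj ρ h hρ)
  · exact (hT.ideal_outside q j hj ρ h hρ).imp_right And.right

/-- A register of an ideal protocol that is used elsewhere also belongs to the protocol which is
replaced. -/
theorem mem_tilde_of_main {q j : T.Node} {ρ : Reg} (hρ : ρ ∈ (T.mainProtocol j).regs)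
    (h : ρ ∈ (T.ideal q).regs) : ρ ∈ (T.tilde q).regs := by
  by_cases hj : T.Below j q
  · have hown : ρ ∈ (T.mainProtocol q).regs ∨ ∃ i ∈ T.children q, T.OccursBelow i ρ := by
      by_cases hne : j = q
      · exact .inl (hne ▸ hρ)
      · obtain ⟨i, hi, hji⟩ := hj.exists_child hne
        exact .inr ⟨i, mem_children.2 hi, j, hji, .inl hρ⟩
    rcases hT.ideal_own q ρ h hown with h | h
    · exact Protocol.mem_regs_of_io (P := T.tilde q) h
    · exact Protocol.mem_regs_of_cors h.1
  · exact Protocol.mem_regs_of_io (P := T.tilde q)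
      (hT.main_outside q j hj ρ (occursBelow_of_ideal h) hρ)

/-- Here `hc` sets aside the corruption registers that `I(q)` may share with ideal protocols above
it. -/
theorem mem_tilde_of_ideal {q j : T.Node} (hne : j ≠ q) {ρ : Reg} (hρ : ρ ∈ (T.ideal j).regs)
    (hc : ¬ T.Below q j ∨ ρ.kind ≠ .corruption)
    (h : ρ ∈ (T.ideal q).regs) : ρ ∈ (T.tilde q).regs := by
  by_cases hj : T.Below j q
  · obtain ⟨i, hi, hji⟩ := hj.exists_child hne
    rcases hT.ideal_own q ρ h (.inr ⟨i, mem_children.2 hi, j, hji, .inr hρ⟩) with h | h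
    · exact Protocol.mem_regs_of_io (P := T.tilde q) h
    · exact Protocol.mem_regs_of_cors h.1
  · exact Protocol.mem_regs_of_io (P := T.tilde q)
      (hT.ideal_outside_io hj (occursBelow_of_ideal h) hρ hc)

theorem outer_mem {p : T.Node} {r : Role} (hr : r ∈ (T.tilde p).roles) {ρ : Reg} (h : ρ ∈ r.regs)
    (hρ : T.Outer ρ p) : ρ ∈ (T.ideal p).io ∨ ρ ∈ (T.ideal p).cors := by
  rcases hρ with ⟨j, hj, hρ⟩ | hρ
  · exact hT.outside_mem_ideal hj (occursBelow_of_own (occursBelow_of_role hr h)) hρ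
  · exact (hT.ideal_own p ρ hρ (occursBelow_of_role hr h)).imp_right And.right

/-- By `outer_mem` a register visible from outside is a channel or a corruption register, hence not
storage. -/
theorem outer_not_priv {p : T.Node} {r : Role} (hr : r ∈ (T.tilde p).roles) {ρ : Reg}
    (hρ : T.Outer ρ p) : ρ ∉ r.priv := fun h => by
  have hk := (hT.tilde_role hr).priv_kind ρ h
  rcases hT.outer_mem hr (Role.mem_regs.2 (.inl h)) hρ with h | h
  · exact (hT.io_link h).kind_ne.1 hk
  · rw [hT.ideal_cors_kind h] at hk
    cases hk

/-- A circuit that uses an input/output channel has counterparts in the ideal protocols of the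
calling nodes, as far as these use the channel. -/
theorem exists_counterpart {j i : T.Node} (hji : T.Below j i) {r : Role}
    (hr : r ∈ (T.tilde j).roles) {ρ : Reg} (h : ρ ∈ r.links) (hρ : T.Outer ρ i) :
    ∃ r' ∈ (T.ideal i).roles, r'.id = r.id ∧ r'.cor = r.cor ∧ ρ ∈ r'.links := by
  -- At every node on the way up to `i` the channel is visible from outside, hence an input/output
  -- channel of that node; its kind rules out a corruption register.
  have hio : ∀ {j} {r : Role}, T.Below j i → r ∈ (T.tilde j).roles → ρ ∈ r.links →
      ρ ∈ (T.ideal j).io := by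
    intro j r hji hr h
    rcases hT.outer_mem hr (Role.mem_regs.2 (.inr (.inl h))) (outer_of_below hji hρ) with h' | h'
    · exact h'
    · exact absurd (hT.ideal_cors_kind h') ((hT.tilde_role hr).links_kind ρ h).1.kind_ne.2
  refine Relation.ReflTransGen.head_induction_on (motive := fun j _ => ∀ r ∈ (T.tilde j).roles,
    ρ ∈ r.links → ∃ r' ∈ (T.ideal i).roles, r'.id = r.id ∧ r'.cor = r.cor ∧ ρ ∈ r'.links)
    hji ?_ ?_ r hr h
  · intro r hr h
    exact hT.correspondence i r hr ρ h (hio (Below.refl i) hr h)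
  · intro a b hab hbi ih r hr h
    -- One use of the correspondence leads from `tilde a` to `I(a)`, whose circuits are circuits of
    -- `tilde b` for the parent `b`.
    obtain ⟨r', hr', h₁, h₂, h₃⟩ := hT.correspondence a r hr ρ h
      (hio ((below_of_parent hab).trans hbi) hr h)
    obtain ⟨s, hs, k₁, k₂, k₃⟩ := ih r' (mem_tilde_roles.2 (.inr ⟨a, hab, hr'⟩)) h₃
    exact ⟨s, hs, k₁.trans h₁, k₂.trans h₂, k₃⟩

/-- Different circuits of `M(q) + ∑ I(i)` have only channel registers in common. -/
theorem tilde_roles_regs {q : T.Node} {r s : Role} (hr : r ∈ (T.tilde q).roles)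
    (hs : s ∈ (T.tilde q).roles) (hne : r ≠ s) {ρ : Reg} (h : ρ ∈ r.regs) (h' : ρ ∈ s.regs) :
    ρ.IsLink := by
  have mixed : ∀ {r s : Role} {k}, T.parent k = some q → r ∈ T.main q → s ∈ (T.ideal k).roles →
      ρ ∈ r.regs → ρ ∈ s.regs → ρ.IsLink := fun hk hr hs h h' =>
    hT.io_link (hT.main_outside _ q (not_below_of_parent hk) ρ
      (occursBelow_of_ideal (Protocol.mem_regs_of_role hs h')) (mem_main_regs hr h))
  rcases mem_tilde_roles.1 hr with hr | ⟨k, hk, hr⟩ <;>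
    rcases mem_tilde_roles.1 hs with hs | ⟨l, hl, hs⟩
  · exact (hT.main_wf q).roles_regs r hr s hs hne ρ h h'
  · exact mixed hl hr hs h h'
  · exact mixed hk hs hr h' h
  · by_cases hkl : k = l
    · subst hkl
      exact (hT.ideal_wf k).roles_regs r hr s hs hne ρ h h'
    -- Distinct children of `q` are not below one another, so their ideal protocols share
    -- input/output channels only.
    · refine hT.io_link (hT.ideal_outside_io (q := k) (j := l) (fun hb => ?_)
        (occursBelow_of_ideal (Protocol.mem_regs_of_role hr h))
        (Protocol.mem_regs_of_role hs h') (.inl fun hb => ?_))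
      · exact (below_of_child hl hb).elim (fun e => hkl e.symm) (not_below_of_parent hk)
      · exact (below_of_child hk hb).elim hkl (not_below_of_parent hl)

end WellFormed
end ProtocolTree

/-! ## Access rules -/

/-- The access rules for environments; `acc` is the required degree of access. -/
def EnvAccess (acc : Access → Prop) (A : Finset Reg) (P : Protocol) (g : Gate) (ρ : Reg) : Prop :=
  ρ ∈ A ∨ ρ ∈ P.io ∨ ρ ∈ P.cors ∨ (ρ ∈ P.links ∧ acc ρ.outsider) ∨
    ∃ r, P.ActsFor g r ∧ (ρ ∈ r.priv ∨ (ρ ∈ r.links ∧ acc (ρ.accessAs r.id)))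

/-- The access rules for simulators; `c` says whether corruption registers may be accessed. -/
def SimAccess (acc : Access → Prop) (c : Prop) (A : Finset Reg) (P I : Protocol) (g : Gate)
    (ρ : Reg) : Prop :=
  ρ ∈ A ∪ (P.regs \ I.regs) ∨ (c ∧ ρ ∈ I.cors) ∨
    ∃ r, I.ActsFor g r ∧ (ρ ∈ r.priv ∨ (ρ ∈ r.links ∧ acc (ρ.accessAs r.id)) ∨
      (ρ ∈ I.links ∧ ρ ∉ I.io ∧ acc ρ.outsider))

namespace ProtocolTree.WellFormed

variable {T : ProtocolTree} (hT : T.WellFormed) {acc : Access → Prop} {c : Prop} {A B : Finset Reg}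
  {g : Gate} {ρ : Reg}
include hT

/-- What a gate may access in the name of a corrupted circuit deep below `q`, it may also access as
a gate of an environment for the main module of `q` with the ideal protocols of its children. -/
theorem envAccess_of_deep {p q : T.Node} (hpq : T.Below p q) (hne : p ≠ q) {r : Role}
    (hr : r ∈ (T.tilde p).roles) (hg : ∃ C, r.cor = some C ∧ (C, 1) ∈ g.ctrl)
    (hρ : ρ ∈ r.priv ∨ (ρ ∈ r.links ∧ acc (ρ.accessAs r.id))) (hq : ρ ∈ (T.tilde q).regs) :
    EnvAccess acc B (T.tilde q) g ρ := by
  obtain ⟨i, hi, hpi⟩ := hpq.exists_child hne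
  by_cases hio : ρ ∈ (T.ideal q).io
  · exact .inr (.inl hio)
  -- A register of `M(q)`, or of the ideal protocol of another child, occurs outside of the subtree
  -- of `i`; otherwise it is in `I(i)`.
  have hout : T.Outer ρ i := by
    rcases Protocol.mem_regs.1 hq with ⟨s, hs, h⟩ | h
    · rcases mem_tilde_roles.1 hs with hs | ⟨k, hk, hs⟩
      · exact .inl ⟨q, not_below_of_parent hi, .inl (mem_main_regs hs h)⟩
      · have h' := Protocol.mem_regs_of_role hs h
        by_cases hki : k = i
        · exact .inr (hki ▸ h')
        · refine .inl ⟨k, fun hb => ?_, .inr h'⟩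
          rcases below_of_child hk hb with hb | hb
          · exact hki hb
          · exact not_below_of_parent hi hb
    · exact absurd h hio
  have hlink : ρ ∈ r.links ∧ acc (ρ.accessAs r.id) :=
    hρ.resolve_left (hT.outer_not_priv hr (outer_of_below hpi hout))
  obtain ⟨r', hr', h₁, h₂, h₃⟩ := hT.exists_counterpart hpi hr hlink.1 hout
  refine .inr (.inr (.inr (.inr ⟨r', ⟨mem_tilde_roles.2 (.inr ⟨i, hi, hr'⟩), ?_⟩, .inr ⟨h₃, ?_⟩⟩)))
  · rwa [h₂]
  · rw [h₁]
    exact hlink.2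

/-- The gates of an environment for the whole protocol. -/
theorem envAccess_of_envAccess (q : T.Node) (hA : ∀ ρ ∈ A, ρ ∈ B)
    (hB : ∀ ρ ∈ T.allRegs, ρ ∉ (T.tilde q).regs → ρ ∉ (T.ideal q).regs → ρ ∈ B)
    (h : EnvAccess acc A T.protocol g ρ) : EnvAccess acc B (T.tilde q) g ρ := by
  -- A register of a main module cannot be in `I(q)` without being in `tilde q`, so the new
  -- environment owns it unless `tilde q` uses it.
  have main : ∀ {j}, ρ ∈ (T.mainProtocol j).regs → ρ ∈ B ∨ ρ ∈ (T.tilde q).regs := by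
    intro j hj
    by_cases hq : ρ ∈ (T.tilde q).regs
    · exact .inr hq
    · exact .inl (hB ρ (mem_allRegs.2 ⟨j, .inl hj⟩) hq fun hI => hq (hT.mem_tilde_of_main hj hI))
  rcases h with h | h | h | ⟨h, ha⟩ | ⟨r, ⟨hr, hg⟩, h⟩
  · exact .inl (hA ρ h)
  · change ρ ∈ (T.ideal T.root).io at h
    have hl := hT.io_link h
    by_cases hb : T.OccursBelow q ρ
    · refine .inr (.inl ?_)
      by_cases hq : T.root = q
      · exact hq ▸ h
      · exact hT.ideal_outside_io (fun hb' => hq (hb'.antisymm (below_root q))) hb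
          (Protocol.mem_regs_of_io h) (.inr hl.kind_ne.2)
    · exact .inl (hB ρ (mem_allRegs.2 ⟨_, .inr (Protocol.mem_regs_of_io h)⟩)
        (fun h => hb (occursBelow_of_tilde h)) (fun h => hb (occursBelow_of_ideal h)))
  · obtain ⟨r, hr, h⟩ := Protocol.mem_cors.1 h
    obtain ⟨j, hj⟩ := mem_protocol_roles.1 hr
    rcases main (mem_main_regs hj (Role.mem_regs.2 (.inr (.inr h)))) with h' | h'
    · exact .inl h'
    · exact .inr (.inr (.inl (hT.tilde_cor h' ((hT.protocol_role hr).cor_kind ρ h).1)))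
  · obtain ⟨r, hr, h⟩ := Protocol.mem_links.1 h
    obtain ⟨j, hj⟩ := mem_protocol_roles.1 hr
    rcases main (mem_main_regs hj (Role.mem_regs.2 (.inr (.inl h)))) with h' | h'
    · exact .inl h'
    · rcases hT.tilde_link h' ((hT.protocol_role hr).links_kind ρ h).1 with h | h
      · exact .inr (.inl h)
      · exact .inr (.inr (.inr (.inl ⟨h, ha⟩)))
  · obtain ⟨j, hj⟩ := mem_protocol_roles.1 hr
    have hρ : ρ ∈ r.regs := Role.mem_regs.2 (h.imp_right fun h => .inl h.1)
    rcases main (mem_main_regs hj hρ) with h' | h'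
    · exact .inl h'
    -- The circuit `r` of `M(j)` is present in `tilde q` if `j = q`, has a counterpart there if `j`
    -- is strictly below `q`, and otherwise meets `tilde q` in input/output channels only.
    · by_cases hjq : T.Below j q
      · by_cases hne : j = q
        · subst hne
          exact .inr (.inr (.inr (.inr ⟨r, ⟨mem_tilde_roles.2 (.inl hj), hg⟩, h⟩)))
        · exact hT.envAccess_of_deep hjq hne (mem_tilde_roles.2 (.inl hj)) hg h h'
      · exact .inr (.inl (hT.main_outside q j hjq ρ (occursBelow_of_tilde h')
          (mem_main_regs hj hρ)))

/-- The registers that are simulated by a simulator below `j` are not used by the others. -/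
theorem simulated_not_mem {j q : T.Node} (hqj : ¬ T.Below q j) (h : ρ ∈ (T.tilde j).regs)
    (hI : ρ ∉ (T.ideal j).regs) : ρ ∉ (T.tilde q).regs ∧ ρ ∉ (T.ideal q).regs := by
  have hb := occursBelow_of_tilde h
  have key : ∀ k, ¬ T.Below k j → ¬ T.Occurs k ρ := fun k hk ho =>
    hI (mem_ideal_regs (hT.outside_mem_ideal hk hb ho))
  refine ⟨fun hq => ?_, fun hq => key q hqj (.inr hq)⟩
  rcases Protocol.mem_regs.1 hq with ⟨s, hs, h'⟩ | h'
  · rcases mem_tilde_roles.1 hs with hs | ⟨k, hk, hs⟩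
    · exact key q hqj (.inl (mem_main_regs hs h'))
    · have h'' := Protocol.mem_regs_of_role hs h'
      by_cases hkj : k = j
      · exact hI (hkj ▸ h'')
      · refine key k (fun hb => ?_) (.inr h'')
        exact (below_of_child hk hb).elim hkj hqj
  · exact key q hqj (.inr (Protocol.mem_regs_of_io (P := T.ideal q) h'))

/-- The gates of a simulator for a node that is not above `q`. -/
theorem envAccess_of_simAccess {j q : T.Node} (hqj : ¬ T.Below q j) (hA : ∀ ρ ∈ A, ρ ∈ B)
    (hB : ∀ ρ ∈ T.allRegs, ρ ∉ (T.tilde q).regs → ρ ∉ (T.ideal q).regs → ρ ∈ B)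
    (h : SimAccess acc c A (T.tilde j) (T.ideal j) g ρ) : EnvAccess acc B (T.tilde q) g ρ := by
  have hjq' : j ≠ q := fun h => hqj (h ▸ Below.refl q)
  have ideal : ρ ∈ (T.ideal j).regs → ρ ∈ B ∨ ρ ∈ (T.tilde q).regs := by
    intro hj
    by_cases hq : ρ ∈ (T.tilde q).regs
    · exact .inr hq
    · exact .inl (hB ρ (mem_allRegs.2 ⟨j, .inr hj⟩) hq fun hI =>
        hq (hT.mem_tilde_of_ideal hjq' hj (.inl hqj) hI))
  rcases h with h | ⟨-, h⟩ | ⟨r, ⟨hr, hg⟩, h⟩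
  · rcases Finset.mem_union.1 h with h | h
    · exact .inl (hA ρ h)
    · obtain ⟨h, hI⟩ := Finset.mem_sdiff.1 h
      have := hT.simulated_not_mem hqj h hI
      exact .inl (hB ρ (occursBelow_of_tilde h).mem_allRegs this.1 this.2)
  · rcases ideal (Protocol.mem_regs_of_cors h) with h' | h'
    · exact .inl h'
    · exact .inr (.inr (.inl (hT.tilde_cor h' (hT.ideal_cors_kind h))))
  · have hI : ρ ∈ (T.ideal j).regs := by
      rcases h with h | h | h
      · exact Protocol.mem_regs_of_role hr (Role.mem_regs.2 (.inl h))
      · exact Protocol.mem_regs_of_role hr (Role.mem_regs.2 (.inr (.inl h.1)))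
      · exact Protocol.mem_regs_of_links h.1
    rcases ideal hI with h' | h'
    · exact .inl h'
    -- The first two alternatives are access in the name of `r`; the last is access as an outsider
    -- to an internal channel of `I(j)`, which needs no counterpart.
    rw [← or_assoc] at h
    rcases h with h | h
    · by_cases hjq : T.Below j q
      · obtain ⟨p, hp, hpq⟩ := hjq.exists_parent hjq'
        have hrp : r ∈ (T.tilde p).roles := mem_tilde_roles.2 (.inr ⟨j, hp, hr⟩)
        by_cases hne : p = q
        · subst hne
          exact .inr (.inr (.inr (.inr ⟨r, ⟨hrp, hg⟩, h⟩)))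
        · exact hT.envAccess_of_deep hpq hne hrp hg h h'
      · exact .inr (.inl (hT.ideal_outside_io hjq (occursBelow_of_tilde h') hI (.inl hqj)))
    · obtain ⟨s, hs, hsl⟩ := Protocol.mem_links.1 h.1
      rcases hT.tilde_link h' (((hT.ideal_wf j).roles_wf s hs).links_kind ρ hsl).1 with h'' | h''
      · exact .inr (.inl h'')
      · exact .inr (.inr (.inr (.inl ⟨h'', h.2.2⟩)))

/-- A simulated register of a node is a simulated register of the whole tree. -/
theorem simulated_root {j : T.Node} (hA : ∀ ρ ∈ A, ρ ∈ B)
    (hB : ∀ ρ ∈ T.allRegs, ρ ∉ T.protocol.regs → ρ ∉ (T.ideal T.root).regs → ρ ∈ B)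
    (h : ρ ∈ A ∪ ((T.tilde j).regs \ (T.ideal j).regs)) :
    ρ ∈ B ∪ (T.protocol.regs \ (T.ideal T.root).regs) := by
  rcases Finset.mem_union.1 h with h | h
  · exact Finset.mem_union_left _ (hA ρ h)
  · obtain ⟨h, hI⟩ := Finset.mem_sdiff.1 h
    have hI' : ρ ∉ (T.ideal T.root).regs := fun hI' => by
      by_cases hj : j = T.root
      · exact hI (hj ▸ hI')
      · exact hI (mem_ideal_regs (hT.outside_mem_ideal
          (fun hb => hj ((below_root j).antisymm hb)) (occursBelow_of_tilde h) (.inr hI')))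
    by_cases hP : ρ ∈ T.protocol.regs
    · exact Finset.mem_union_right _ (Finset.mem_sdiff.2 ⟨hP, hI'⟩)
    · exact Finset.mem_union_left _ (hB ρ (occursBelow_of_tilde h).mem_allRegs hP hI')

/-- The gates of simulators for all nodes, as gates of a simulator for the whole tree. -/
theorem simAccess_root (j : T.Node) (hA : ∀ ρ ∈ A, ρ ∈ B)
    (hB : ∀ ρ ∈ T.allRegs, ρ ∉ T.protocol.regs → ρ ∉ (T.ideal T.root).regs → ρ ∈ B)
    (h : SimAccess acc c A (T.tilde j) (T.ideal j) g ρ) :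
    SimAccess acc c B T.protocol (T.ideal T.root) g ρ := by
  have hsim : ρ ∈ T.allRegs → ρ ∉ (T.ideal T.root).regs →
      ρ ∈ B ∪ (T.protocol.regs \ (T.ideal T.root).regs) := by
    intro h hI
    by_cases hP : ρ ∈ T.protocol.regs
    · exact Finset.mem_union_right _ (Finset.mem_sdiff.2 ⟨hP, hI⟩)
    · exact Finset.mem_union_left _ (hB ρ h hP hI)
  have hroot : j ≠ T.root → ¬ T.Below T.root j := fun hj hb => hj ((below_root j).antisymm hb)
  rcases h with h | ⟨hc, h⟩ | ⟨r, ⟨hr, hg⟩, h⟩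
  · exact .inl (hT.simulated_root hA hB h)
  · by_cases hj : j = T.root
    · subst hj
      exact .inr (.inl ⟨hc, h⟩)
    · have hI := Protocol.mem_regs_of_cors h
      by_cases hρ : ρ ∈ (T.ideal T.root).regs
      · obtain ⟨i, hi, hji⟩ := (below_root j).exists_child hj
        rcases hT.ideal_own T.root ρ hρ
          (.inr ⟨i, mem_children.2 hi, j, hji, .inr hI⟩) with h' | h'
        · exact absurd (hT.ideal_cors_kind h) (hT.io_link h').kind_ne.2
        · exact .inr (.inl ⟨hc, h'.2⟩)
      · exact .inl (hsim (mem_allRegs.2 ⟨j, .inr hI⟩) hρ)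
  · by_cases hj : j = T.root
    · subst hj
      exact .inr (.inr ⟨r, ⟨hr, hg⟩, h⟩)
    have hI : ρ ∈ (T.ideal j).regs := by
      rcases h with h | h | h
      · exact Protocol.mem_regs_of_role hr (Role.mem_regs.2 (.inl h))
      · exact Protocol.mem_regs_of_role hr (Role.mem_regs.2 (.inr (.inl h.1)))
      · exact Protocol.mem_regs_of_links h.1
    by_cases hρ : ρ ∈ (T.ideal T.root).regs
    swap
    · exact .inl (hsim (mem_allRegs.2 ⟨j, .inr hI⟩) hρ)
    obtain ⟨p, hp, hpr⟩ := (below_root j).exists_parent hj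
    have hrp : r ∈ (T.tilde p).roles := mem_tilde_roles.2 (.inr ⟨j, hp, hr⟩)
    have hout : T.Outer ρ T.root := .inr hρ
    rcases h with h | h | h
    · exact absurd h (hT.outer_not_priv hrp (outer_of_below hpr hout))
    · obtain ⟨r', hr', h₁, h₂, h₃⟩ := hT.exists_counterpart hpr hrp h.1 hout
      refine .inr (.inr ⟨r', ⟨hr', h₂ ▸ hg⟩, .inr (.inl ⟨h₃, ?_⟩)⟩)
      rw [h₁]
      exact h.2
    -- An internal channel of `I(j)` that occurred in `I(root)` would be an input/output channel of
    -- `I(j)`.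
    · obtain ⟨s, hs, hsl⟩ := Protocol.mem_links.1 h.1
      have hl := (((hT.ideal_wf j).roles_wf s hs).links_kind ρ hsl).1
      exact absurd (hT.ideal_outside_io (hroot hj) (occursBelow_of_ideal hI) hρ
        (.inr hl.kind_ne.2)) h.2.1

end ProtocolTree.WellFormed

/-! ### Sizes of sets of gates -/

theorem gatesSize_mono {A B : Finset Gate} (h : A ⊆ B) : gatesSize A ≤ gatesSize B :=
  Finset.sum_le_sum_of_subset h

theorem gatesSize_union_le (A B : Finset Gate) :
    gatesSize (A ∪ B) ≤ gatesSize A + gatesSize B := by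
  unfold gatesSize
  rw [← Finset.sum_union_inter]
  exact Nat.le_add_right _ _

theorem gatesSize_biUnion_le {ι : Type*} (s : Finset ι) (f : ι → Finset Gate) :
    gatesSize (s.biUnion f) ≤ ∑ i ∈ s, gatesSize (f i) := by
  classical
  induction s using Finset.induction_on with
  | empty => simp [gatesSize]
  | insert a s ha ih =>
    rw [Finset.biUnion_insert, Finset.sum_insert ha]
    exact (gatesSize_union_le _ _).trans (Nat.add_le_add_left ih _)

/-! ## Hybrid settings -/

/-- An intermediate stage between the protocol and its ideal protocol: the sub-protocols of the nodes
in `done` have been replaced by their ideal protocols and simulators; `cross` is the order of the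
gates of different circuits. -/
structure Hybrid (T : ProtocolTree) where
  done : Finset T.Node
  sim : T.Node → OpenCircuit
  cross : Gate → Gate → Prop

open ProtocolTree Classical

namespace Hybrid

variable {T : ProtocolTree} (H : Hybrid T) (E : Environment) (q : T.Node)

/-- The nodes whose ideal protocol is present. -/
def front : Finset T.Node :=
  H.done.filter fun k => ∀ p, T.parent k = some p → p ∉ H.done

/-- The circuits that are present. -/
def roles : Finset Role :=
  (Finset.univ \ H.done).biUnion T.main ∪ H.front.biUnion fun k => (T.ideal k).roles

/-- The circuits that are present, without those of `M(q)` and the ideal protocols of the children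
of `q`. -/
def rolesOutside : Finset Role :=
  (Finset.univ \ insert q H.done).biUnion T.main ∪
    (H.front \ T.children q).biUnion fun k => (T.ideal k).roles

/-- The gates of the simulators. -/
def simGates : Finset Gate := H.done.biUnion fun j => (H.sim j).gates

/-- The hybrid setting. -/
def setting : Setting where
  gates := E.gates ∪ H.roles.biUnion Role.gates ∪ H.simGates
  rel x g h := E.ord x g h ∨ (∃ r ∈ H.roles, r.ord x g h) ∨ (∃ j ∈ H.done, (H.sim j).ord x g h) ∨
    H.cross g h
  out := E.out

/-- The gates that are present, without those of `M(q)` and the ideal protocols of the children of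
`q`. -/
def envGates : Finset Gate := E.gates ∪ (H.rolesOutside q).biUnion Role.gates ∪ H.simGates

/-- The hybrid setting as an environment for `M(q)` and the ideal protocols of the children of `q`.
It owns all registers that are used elsewhere. -/
def env : Environment where
  regs := (E.regs ∪ T.allRegs ∪ H.done.biUnion fun j => (H.sim j).regs) \
    ((T.tilde q).regs ∪ (T.ideal q).regs)
  gates := H.envGates E q
  -- Cross-orderings between two gates that now both belong to the environment become part of its
  -- own ordering; this is harmless, as they depend on no register.
  ord x g h := E.ord x g h ∨ (∃ r ∈ H.rolesOutside q, r.ord x g h) ∨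
    (∃ j ∈ H.done, (H.sim j).ord x g h) ∨ (H.cross g h ∧ g ∈ H.envGates E q ∧ h ∈ H.envGates E q)
  cross g h := H.cross g h ∧ ¬ (g ∈ H.envGates E q ∧ h ∈ H.envGates E q)
  out := E.out

/-- The next hybrid setting. -/
def next (S : OpenCircuit) : Hybrid T where
  done := insert q H.done
  sim := Function.update H.sim q S
  -- Orderings that involve `tilde q` disappear with it; those that involve `I(q)` are chosen anew
  -- with `S`.
  cross g h := (H.cross g h ∧ g ∈ H.envGates E q ∧ h ∈ H.envGates E q) ∨ S.cross g h

variable {H E q}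

theorem mem_front {k : T.Node} :
    k ∈ H.front ↔ k ∈ H.done ∧ ∀ p, T.parent k = some p → p ∉ H.done := by
  simp [front]

theorem mem_roles {r : Role} :
    r ∈ H.roles ↔ (∃ j, j ∉ H.done ∧ r ∈ T.main j) ∨ ∃ k ∈ H.front, r ∈ (T.ideal k).roles := by
  simp [roles]

theorem mem_rolesOutside {r : Role} :
    r ∈ H.rolesOutside q ↔ (∃ j, (j ≠ q ∧ j ∉ H.done) ∧ r ∈ T.main j) ∨
      ∃ k, (k ∈ H.front ∧ T.parent k ≠ some q) ∧ r ∈ (T.ideal k).roles := by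
  simp [rolesOutside, mem_children]

theorem mem_simGates {g : Gate} : g ∈ H.simGates ↔ ∃ j ∈ H.done, g ∈ (H.sim j).gates := by
  simp [simGates]

theorem mem_envGates {g : Gate} :
    g ∈ H.envGates E q ↔ g ∈ E.gates ∨ (∃ r ∈ H.rolesOutside q, g ∈ r.gates) ∨ g ∈ H.simGates := by
  simp [envGates]

theorem mem_setting_gates {g : Gate} :
    g ∈ (H.setting E).gates ↔ g ∈ E.gates ∨ (∃ r ∈ H.roles, g ∈ r.gates) ∨ g ∈ H.simGates := by
  simp [setting]

/-- The children of `q` are in `done` and `q` is not, so they are in the front and their ideal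
protocols are present. -/
theorem roles_iff (hq : q ∉ H.done) (hc : ∀ i, T.parent i = some q → i ∈ H.done) {r : Role} :
    r ∈ H.roles ↔ r ∈ H.rolesOutside q ∨ r ∈ (T.tilde q).roles := by
  rw [mem_roles, mem_rolesOutside, mem_tilde_roles]
  constructor
  · rintro (⟨j, hj, hr⟩ | ⟨k, hk, hr⟩)
    · by_cases hjq : j = q
      · exact .inr (.inl (hjq ▸ hr))
      · exact .inl (.inl ⟨j, ⟨hjq, hj⟩, hr⟩)
    · by_cases hkq : T.parent k = some q
      · exact .inr (.inr ⟨k, hkq, hr⟩)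
      · exact .inl (.inr ⟨k, ⟨hk, hkq⟩, hr⟩)
  · rintro ((⟨j, hj, hr⟩ | ⟨k, hk, hr⟩) | hr | ⟨k, hk, hr⟩)
    · exact .inl ⟨j, hj.2, hr⟩
    · exact .inr ⟨k, hk.1, hr⟩
    · exact .inl ⟨q, hq, hr⟩
    · refine .inr ⟨k, mem_front.2 ⟨hc k hk, fun p hp => ?_⟩, hr⟩
      rw [hk] at hp
      cases hp
      exact hq

/-- The node `q` enters the front, because by closedness its parent is not in `done`, and its
children leave it. -/
theorem next_roles_iff (hq : q ∉ H.done) (hcl : ∀ j p, T.parent j = some p → p ∈ H.done → j ∈ H.done)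
    (S : OpenCircuit) {r : Role} :
    r ∈ (H.next E q S).roles ↔ r ∈ H.rolesOutside q ∨ r ∈ (T.ideal q).roles := by
  have hfront : ∀ k, k ∈ (H.next E q S).front ↔ (k ∈ H.front ∧ T.parent k ≠ some q) ∨ k = q := by
    intro k
    rw [mem_front, mem_front]
    change (k ∈ insert q H.done ∧ ∀ p, T.parent k = some p → p ∉ insert q H.done) ↔ _
    simp only [Finset.mem_insert, not_or]
    constructor
    · rintro ⟨rfl | hk, h⟩
      · exact .inr rfl
      · exact .inl ⟨⟨hk, fun p hp => (h p hp).2⟩, fun hp => (h q hp).1 rfl⟩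
    · rintro (⟨⟨hk, h⟩, h'⟩ | rfl)
      · exact ⟨.inr hk, fun p hp => ⟨fun e => h' (e ▸ hp), h p hp⟩⟩
      · refine ⟨.inl rfl, fun p hp => ⟨?_, fun hd => hq (hcl k p hp hd)⟩⟩
        rintro rfl
        exact not_below_of_parent hp (Below.refl p)
  rw [mem_roles, mem_rolesOutside]
  simp only [hfront]
  change ((∃ j, j ∉ insert q H.done ∧ _) ∨ _) ↔ _
  simp only [Finset.mem_insert, not_or, or_assoc]
  refine or_congr Iff.rfl ?_
  constructor
  · rintro ⟨k, hk | rfl, hr⟩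
    · exact .inl ⟨k, hk, hr⟩
    · exact .inr hr
  · rintro (⟨k, hk, hr⟩ | hr)
    · exact ⟨k, .inl hk, hr⟩
    · exact ⟨q, .inr rfl, hr⟩

theorem _root_.Setting.ext_fields {A B : Setting} (h₁ : A.gates = B.gates)
    (h₂ : ∀ x g h, A.rel x g h ↔ B.rel x g h) (h₃ : A.out = B.out) : A = B := by
  cases A
  cases B
  obtain rfl := h₁
  obtain rfl := h₃
  congr 1
  funext x g h
  exact propext (h₂ x g h)

/-- A pair in `H.cross` goes to the `ord` or to the `cross` of the environment according to whether
both gates are its own, so the regrouping loses nothing. -/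
theorem env_withProtocol (hq : q ∉ H.done) (hc : ∀ i, T.parent i = some q → i ∈ H.done) :
    (H.env E q).withProtocol (T.tilde q) = H.setting E := by
  apply Setting.ext_fields
  · ext g
    change g ∈ H.envGates E q ∪ (T.tilde q).gates ↔ _
    rw [Finset.mem_union, mem_envGates, mem_setting_gates, Protocol.mem_gates]
    simp only [roles_iff hq hc, or_and_right, exists_or]
    generalize (∃ r ∈ H.rolesOutside q, g ∈ r.gates) = a
    generalize (∃ r ∈ (T.tilde q).roles, g ∈ r.gates) = b
    tauto
  · intro x g h
    change (_ ∨ _ ∨ _ ∨ _) ∨ _ ∨ _ ↔ _ ∨ _ ∨ _ ∨ _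
    simp only [roles_iff hq hc, or_and_right, exists_or]
    change (_ ∨ _ ∨ _ ∨ _) ∨ (_ ∧ _) ∨ _ ↔ _
    generalize (∃ r ∈ H.rolesOutside q, r.ord x g h) = a
    generalize (∃ r ∈ (T.tilde q).roles, r.ord x g h) = b
    generalize (∃ j ∈ H.done, (H.sim j).ord x g h) = c
    tauto
  · rfl

theorem next_sim_iff (hq : q ∉ H.done) (S : OpenCircuit) (p : OpenCircuit → Prop) :
    (∃ j ∈ (H.next E q S).done, p ((H.next E q S).sim j)) ↔ (∃ j ∈ H.done, p (H.sim j)) ∨ p S := by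
  change (∃ j ∈ insert q H.done, p (Function.update H.sim q S j)) ↔ _
  have hne : ∀ j ∈ H.done, Function.update H.sim q S j = H.sim j := fun j hj =>
    Function.update_of_ne (fun e : j = q => hq (e ▸ hj)) _ _
  constructor
  · rintro ⟨j, hj, h⟩
    rcases Finset.mem_insert.1 hj with rfl | hj
    · rw [Function.update_self] at h
      exact .inr h
    · rw [hne j hj] at h
      exact .inl ⟨j, hj, h⟩
  · rintro (⟨j, hj, h⟩ | h)
    · exact ⟨j, Finset.mem_insert_of_mem hj, by rwa [hne j hj]⟩
    · exact ⟨q, Finset.mem_insert_self _ _, by rwa [Function.update_self]⟩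

/-- Since `withIdeal` ignores the `cross` of the environment, what remains of `H.cross` is the part
absorbed in its `ord`, and `S.cross` is added. -/
theorem env_withIdeal (hq : q ∉ H.done)
    (hcl : ∀ j p, T.parent j = some p → p ∈ H.done → j ∈ H.done) (S : OpenCircuit) :
    (H.env E q).withIdeal (T.ideal q) S = (H.next E q S).setting E := by
  apply Setting.ext_fields
  · ext g
    change g ∈ H.envGates E q ∪ (T.ideal q).gates ∪ S.gates ↔ _
    rw [mem_setting_gates, mem_simGates, next_sim_iff hq S fun S => g ∈ S.gates,
      Finset.mem_union, Finset.mem_union, mem_envGates, Protocol.mem_gates, mem_simGates]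
    simp only [next_roles_iff hq hcl, or_and_right, exists_or]
    generalize (∃ r ∈ H.rolesOutside q, g ∈ r.gates) = a
    generalize (∃ r ∈ (T.ideal q).roles, g ∈ r.gates) = b
    generalize (∃ j ∈ H.done, g ∈ (H.sim j).gates) = c
    tauto
  · intro x g h
    change (_ ∨ _ ∨ _ ∨ _) ∨ _ ∨ _ ∨ _ ↔ _ ∨ _ ∨ (∃ j ∈ (H.next E q S).done, _) ∨ (_ ∨ _)
    rw [next_sim_iff hq S fun S => S.ord x g h]
    simp only [next_roles_iff hq hcl, or_and_right, exists_or]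
    generalize (∃ r ∈ H.rolesOutside q, r.ord x g h) = a
    generalize (∃ r ∈ (T.ideal q).roles, r.ord x g h) = b
    generalize (∃ j ∈ H.done, (H.sim j).ord x g h) = c
    tauto
  · rfl

end Hybrid

/-! ### The invariant -/

/-- The properties of the simulator of the node `j`. -/
structure GoodSim (T : ProtocolTree) (E : Environment) (b : T.Node → ℕ∞) (j : T.Node)
    (S : OpenCircuit) : Prop where
  regs_env : Disjoint S.regs E.regs
  regs_tree : Disjoint S.regs T.allRegs
  gates_env : Disjoint S.gates E.gates
  gates_tree : Disjoint S.gates T.allGates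
  write : ∀ g ∈ S.gates, ∀ ρ ∈ g.tgt, S.SimMayWrite (T.tilde j) (T.ideal j) g ρ
  read : ∀ g ∈ S.gates, ∀ ρ ∈ g.ctrlRegs, S.SimMayRead (T.tilde j) (T.ideal j) g ρ
  ord_gates : ∀ x g h, S.ord x g h → g ∈ S.gates ∧ h ∈ S.gates
  ord_local : DependsOnlyOn S.ord (S.simRegs (T.tilde j) (T.ideal j))
  size : (S.size : ℕ∞) ≤ b j

/-- The properties of the hybrid settings. -/
structure Hybrid.Invariant {T : ProtocolTree} (E : Environment) (b : T.Node → ℕ∞) (H : Hybrid T) :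
    Prop where
  closed : ∀ j p, T.parent j = some p → p ∈ H.done → j ∈ H.done
  good : ∀ j ∈ H.done, GoodSim T E b j (H.sim j)
  cross_pairs : ∀ g h, H.cross g h →
    g ∈ (H.setting E).gates ∧ h ∈ (H.setting E).gates ∧ ShareReg g h ∧
      ¬ (g ∈ E.gates ∧ h ∈ E.gates) ∧ ∀ r ∈ H.roles, ¬ (g ∈ r.gates ∧ h ∈ r.gates)
  isCircuit : (H.setting E).IsCircuit

/-- An environment that does not use any name of the tree. -/
structure Fresh (T : ProtocolTree) (E : Environment) : Prop where
  valid : E.Valid T.protocol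
  regs : Disjoint E.regs T.allRegs
  gates : Disjoint E.gates T.allGates

theorem OpenCircuit.SimMayWrite.simAccess {S : OpenCircuit} {P I : Protocol} {g : Gate} {ρ : Reg}
    (h : S.SimMayWrite P I g ρ) : SimAccess (· = .full) False S.regs P I g ρ :=
  h.imp_right .inr

theorem OpenCircuit.SimMayRead.simAccess {S : OpenCircuit} {P I : Protocol} {g : Gate} {ρ : Reg}
    (h : S.SimMayRead P I g ρ) : SimAccess (· ≠ .none) True S.regs P I g ρ :=
  h.imp_right (Or.imp_left fun h => ⟨trivial, h⟩)

namespace ProtocolTree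

variable {T : ProtocolTree} {q : T.Node}

theorem main_gates_subset {j : T.Node} {r : Role} (hr : r ∈ T.main j) {g : Gate} (hg : g ∈ r.gates) :
    g ∈ (T.mainProtocol j).gates := Protocol.mem_gates.2 ⟨r, hr, hg⟩

theorem tilde_regs_subset {ρ : Reg} (h : ρ ∈ (T.tilde q).regs) : ρ ∈ T.allRegs :=
  (occursBelow_of_tilde h).mem_allRegs

theorem ideal_regs_subset {ρ : Reg} (h : ρ ∈ (T.ideal q).regs) : ρ ∈ T.allRegs :=
  (occursBelow_of_ideal h).mem_allRegs

theorem ideal_gates_subset {g : Gate} (h : g ∈ (T.ideal q).gates) : g ∈ T.allGates :=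
  mem_allGates.2 ⟨q, .inr h⟩

theorem tilde_gates_cases {g : Gate} (h : g ∈ (T.tilde q).gates) :
    g ∈ (T.mainProtocol q).gates ∨ ∃ i, T.parent i = some q ∧ g ∈ (T.ideal i).gates := by
  obtain ⟨r, hr, hg⟩ := Protocol.mem_gates.1 h
  rcases mem_tilde_roles.1 hr with hr | ⟨i, hi, hr⟩
  · exact .inl (main_gates_subset hr hg)
  · exact .inr ⟨i, hi, Protocol.mem_gates.2 ⟨r, hr, hg⟩⟩

theorem tilde_gates_subset {g : Gate} (h : g ∈ (T.tilde q).gates) : g ∈ T.allGates := by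
  rcases tilde_gates_cases h with h | ⟨i, -, h⟩
  · exact mem_allGates.2 ⟨q, .inl h⟩
  · exact ideal_gates_subset h

end ProtocolTree

/-! ### The hybrid setting as a valid environment for the next node -/

namespace Hybrid

variable {T : ProtocolTree} {H : Hybrid T} {E : Environment} {q : T.Node} {b : T.Node → ℕ∞}

theorem rolesOutside_subset {r : Role} (hr : r ∈ H.rolesOutside q) {g : Gate} (hg : g ∈ r.gates) :
    g ∈ T.allGates := by
  rcases mem_rolesOutside.1 hr with ⟨j, _, hr⟩ | ⟨k, _, hr⟩
  · exact mem_allGates.2 ⟨j, .inl (main_gates_subset hr hg)⟩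
  · exact ideal_gates_subset (Protocol.mem_gates.2 ⟨r, hr, hg⟩)

theorem mem_env_regs {ρ : Reg} (h : ρ ∈ E.regs ∨ ρ ∈ T.allRegs ∨ ∃ j ∈ H.done, ρ ∈ (H.sim j).regs)
    (h₁ : ρ ∉ (T.tilde q).regs) (h₂ : ρ ∉ (T.ideal q).regs) : ρ ∈ (H.env E q).regs := by
  refine Finset.mem_sdiff.2 ⟨?_, fun h => (Finset.mem_union.1 h).elim h₁ h₂⟩
  simpa [or_assoc] using h

namespace Invariant

variable (hH : H.Invariant E b)
include hH

/-- `done` is closed downwards. This direction is what the access lemma for earlier simulators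
requires. -/
theorem not_below (hq : q ∉ H.done) {j : T.Node} (hj : j ∈ H.done) : ¬ T.Below q j := by
  intro h
  refine hq ?_
  refine Relation.ReflTransGen.head_induction_on (motive := fun q _ => q ∈ H.done) h hj ?_
  intro a c hac _ ih
  exact hH.closed a c hac ih

theorem below_done (hc : ∀ i, T.parent i = some q → i ∈ H.done) {j : T.Node} (h : T.Below j q)
    (hne : j ≠ q) : j ∈ H.done := by
  obtain ⟨i, hi, hji⟩ := h.exists_child hne
  refine Relation.ReflTransGen.head_induction_on (motive := fun j _ => j ∈ H.done) hji (hc i hi) ?_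
  intro a c hac _ ih
  exact hH.closed a c hac ih

/-- All nodes strictly below `q` are in `done`, whereas the parent of a front node is not; so a
front node below `q` is a child of `q`. -/
theorem front_outside (hq : q ∉ H.done) {k : T.Node} (hk : k ∈ H.front)
    (hkq : T.parent k ≠ some q) (hc : ∀ i, T.parent i = some q → i ∈ H.done) : ¬ T.Below k q := by
  intro h
  obtain ⟨hkd, hk⟩ := mem_front.1 hk
  obtain ⟨p, hp, hpq⟩ := h.exists_parent (fun e => hq (e ▸ hkd))
  by_cases hne : p = q
  · exact hkq (hne ▸ hp)
  · exact hk p hp (hH.below_done hc hpq hne)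

/-- The circuits outside of `q` share only input/output channels with the subtree of `q`. -/
theorem rolesOutside_io (hT : T.WellFormed) (hq : q ∉ H.done)
    (hc : ∀ i, T.parent i = some q → i ∈ H.done) {r : Role} (hr : r ∈ H.rolesOutside q) {ρ : Reg}
    (hρ : ρ ∈ r.regs) (h : T.OccursBelow q ρ) : ρ ∈ (T.ideal q).io := by
  rcases mem_rolesOutside.1 hr with ⟨j, ⟨hj, hjd⟩, hr⟩ | ⟨k, ⟨hk, hkq⟩, hr⟩
  · exact hT.main_outside q j (fun hb => hjd (hH.below_done hc hb hj)) ρ h (mem_main_regs hr hρ)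
  · exact hT.ideal_outside_io (hH.front_outside hq hk hkq hc) h
      (Protocol.mem_regs_of_role hr hρ) (.inl (hH.not_below hq (mem_front.1 hk).1))

omit hH in
theorem _root_.Hybrid.rolesOutside_mem {r : Role} (hr : r ∈ H.rolesOutside q) {ρ : Reg}
    (hρ : ρ ∈ r.regs) : ρ ∈ T.allRegs := by
  rcases mem_rolesOutside.1 hr with ⟨j, _, hr⟩ | ⟨k, _, hr⟩
  · exact mem_allRegs.2 ⟨j, .inl (mem_main_regs hr hρ)⟩
  · exact ideal_regs_subset (Protocol.mem_regs_of_role hr hρ)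

omit hH in
theorem _root_.Hybrid.rolesOutside_wf (hT : T.WellFormed) {r : Role} (hr : r ∈ H.rolesOutside q) :
    r.WellFormed := by
  rcases mem_rolesOutside.1 hr with ⟨j, _, hr⟩ | ⟨k, _, hr⟩
  · exact (hT.main_wf j).roles_wf r hr
  · exact (hT.ideal_wf k).roles_wf r hr

/-- Registers that do not occur below `q` are owned by the environment, and the others are
input/output channels. -/
theorem rolesOutside_access (hT : T.WellFormed) (hq : q ∉ H.done)
    (hc : ∀ i, T.parent i = some q → i ∈ H.done) {r : Role} (hr : r ∈ H.rolesOutside q) {ρ : Reg}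
    (hρ : ρ ∈ r.regs) : ρ ∈ (H.env E q).regs ∨ ρ ∈ (T.tilde q).io := by
  by_cases h : T.OccursBelow q ρ
  · exact .inr (hH.rolesOutside_io hT hq hc hr hρ h)
  · exact .inl (mem_env_regs (.inr (.inl (rolesOutside_mem hr hρ)))
      (fun h' => h (occursBelow_of_tilde h')) fun h' => h (occursBelow_of_ideal h'))

theorem envGates_disjoint_tilde (hT : T.WellFormed) (hE : Fresh T E) :
    Disjoint (H.envGates E q) (T.tilde q).gates := by
  rw [Finset.disjoint_left]
  intro g hg hgt
  rcases mem_envGates.1 hg with hg | ⟨r, hr, hg⟩ | hg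
  · exact Finset.disjoint_left.1 hE.gates hg (tilde_gates_subset hgt)
  · rcases mem_rolesOutside.1 hr with ⟨j, ⟨hj, _⟩, hr⟩ | ⟨k, ⟨hk, hkq⟩, hr⟩
    · have hg' := main_gates_subset hr hg
      rcases tilde_gates_cases hgt with h | ⟨i, -, h⟩
      · exact Finset.disjoint_left.1 (hT.main_gates j q hj) hg' h
      · exact Finset.disjoint_left.1 (hT.main_ideal_gates j i) hg' h
    · have hg' : g ∈ (T.ideal k).gates := Protocol.mem_gates.2 ⟨r, hr, hg⟩
      rcases tilde_gates_cases hgt with h | ⟨i, hi, h⟩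
      · exact Finset.disjoint_left.1 (hT.main_ideal_gates q k) h hg'
      · exact Finset.disjoint_left.1 (hT.ideal_gates k i fun e => hkq (e ▸ hi)) hg' h
  · obtain ⟨j, hj, hg⟩ := mem_simGates.1 hg
    exact Finset.disjoint_left.1 (hH.good j hj).gates_tree hg (tilde_gates_subset hgt)

theorem envGates_disjoint_ideal (hT : T.WellFormed) (hE : Fresh T E) (hq : q ∉ H.done) :
    Disjoint (H.envGates E q) (T.ideal q).gates := by
  rw [Finset.disjoint_left]
  intro g hg hgt
  rcases mem_envGates.1 hg with hg | ⟨r, hr, hg⟩ | hg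
  · exact Finset.disjoint_left.1 hE.gates hg (ideal_gates_subset hgt)
  · rcases mem_rolesOutside.1 hr with ⟨j, ⟨hj, _⟩, hr⟩ | ⟨k, ⟨hk, hkq⟩, hr⟩
    · exact Finset.disjoint_left.1 (hT.main_ideal_gates j q) (main_gates_subset hr hg) hgt
    · exact Finset.disjoint_left.1
        (hT.ideal_gates k q fun e => hq (e ▸ (mem_front.1 hk).1))
        (Protocol.mem_gates.2 ⟨r, hr, hg⟩) hgt
  · obtain ⟨j, hj, hg⟩ := mem_simGates.1 hg
    exact Finset.disjoint_left.1 (hH.good j hj).gates_tree hg (ideal_gates_subset hgt)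

theorem sim_regs_subset {j : T.Node} (hj : j ∈ H.done) {ρ : Reg} (hρ : ρ ∈ (H.sim j).regs) :
    ρ ∈ (H.env E q).regs := by
  have := Finset.disjoint_left.1 (hH.good j hj).regs_tree hρ
  exact mem_env_regs (.inr (.inr ⟨j, hj, hρ⟩)) (fun h => this (tilde_regs_subset h))
    fun h => this (ideal_regs_subset h)

omit hH in
theorem _root_.Fresh.regs_subset (hE : Fresh T E) {ρ : Reg} (hρ : ρ ∈ E.regs) :
    ρ ∈ (H.env E q).regs := by
  have := Finset.disjoint_left.1 hE.regs hρ
  exact mem_env_regs (.inl hρ) (fun h => this (tilde_regs_subset h))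
    fun h => this (ideal_regs_subset h)

theorem sim_simRegs_subset (hT : T.WellFormed) (hq : q ∉ H.done) {j : T.Node} (hj : j ∈ H.done)
    {ρ : Reg} (hρ : ρ ∈ (H.sim j).simRegs (T.tilde j) (T.ideal j)) : ρ ∈ (H.env E q).regs := by
  rcases Finset.mem_union.1 hρ with hρ | hρ
  · exact hH.sim_regs_subset hj hρ
  · obtain ⟨h₁, h₂⟩ := Finset.mem_sdiff.1 hρ
    have := hT.simulated_not_mem (hH.not_below hq hj) h₁ h₂
    exact mem_env_regs (.inr (.inl (tilde_regs_subset h₁))) this.1 this.2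

theorem env_avoids (hT : T.WellFormed) (hE : Fresh T E) (hq : q ∉ H.done) :
    (H.env E q).Avoids (T.ideal q) := by
  refine ⟨?_, hH.envGates_disjoint_ideal hT hE hq⟩
  rw [Finset.disjoint_left]
  intro ρ hρ h
  exact (Finset.mem_sdiff.1 hρ).2 (Finset.mem_union_right _ h)

/-- The gates come from `E`, from circuits outside of `q`, or from earlier simulators, with the
access lemmas `envAccess_of_envAccess`, `rolesOutside_access` and `envAccess_of_simAccess`. The
circuit property is inherited, as the total setting is unchanged. -/
theorem env_valid (hT : T.WellFormed) (hE : Fresh T E) (hq : q ∉ H.done)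
    (hc : ∀ i, T.parent i = some q → i ∈ H.done) : (H.env E q).Valid (T.tilde q) where
  regs_disjoint := by
    rw [Finset.disjoint_left]
    intro ρ hρ h
    exact (Finset.mem_sdiff.1 hρ).2 (Finset.mem_union_left _ h)
  gates_disjoint := hH.envGates_disjoint_tilde hT hE
  out_mem := hE.regs_subset hE.valid.out_mem
  out_bit := hE.valid.out_bit
  write g hg ρ hρ := by
    have hB : ∀ ρ ∈ T.allRegs, ρ ∉ (T.tilde q).regs → ρ ∉ (T.ideal q).regs →
        ρ ∈ (H.env E q).regs := fun ρ h => mem_env_regs (.inr (.inl h))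
    change EnvAccess (· = .full) _ _ _ _
    rcases mem_envGates.1 hg with hg | ⟨r, hr, hg⟩ | hg
    · exact hT.envAccess_of_envAccess q (fun ρ => hE.regs_subset) hB (hE.valid.write g hg ρ hρ)
    · exact (hH.rolesOutside_access hT hq hc hr ((rolesOutside_wf hT hr).gate_regs hg
        (Finset.mem_union_right _ hρ))).imp_right .inl
    · obtain ⟨j, hj, hg⟩ := mem_simGates.1 hg
      exact hT.envAccess_of_simAccess (hH.not_below hq hj) (fun ρ => hH.sim_regs_subset hj) hB
        ((hH.good j hj).write g hg ρ hρ).simAccess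
  read g hg ρ hρ := by
    have hB : ∀ ρ ∈ T.allRegs, ρ ∉ (T.tilde q).regs → ρ ∉ (T.ideal q).regs →
        ρ ∈ (H.env E q).regs := fun ρ h => mem_env_regs (.inr (.inl h))
    change EnvAccess (· ≠ .none) _ _ _ _
    rcases mem_envGates.1 hg with hg | ⟨r, hr, hg⟩ | hg
    · exact hT.envAccess_of_envAccess q (fun ρ => hE.regs_subset) hB (hE.valid.read g hg ρ hρ)
    · exact (hH.rolesOutside_access hT hq hc hr ((rolesOutside_wf hT hr).gate_regs hg
        (Finset.mem_union_left _ hρ))).imp_right .inl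
    · obtain ⟨j, hj, hg⟩ := mem_simGates.1 hg
      exact hT.envAccess_of_simAccess (hH.not_below hq hj) (fun ρ => hH.sim_regs_subset hj) hB
        ((hH.good j hj).read g hg ρ hρ).simAccess
  ord_gates x g h := by
    change _ → g ∈ H.envGates E q ∧ h ∈ H.envGates E q
    rintro (h' | ⟨r, hr, h'⟩ | ⟨j, hj, h'⟩ | h')
    · have := hE.valid.ord_gates x g h h'
      exact ⟨mem_envGates.2 (.inl this.1), mem_envGates.2 (.inl this.2)⟩
    · have := (rolesOutside_wf hT hr).ord_gates x g h h'
      exact ⟨mem_envGates.2 (.inr (.inl ⟨r, hr, this.1⟩)),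
        mem_envGates.2 (.inr (.inl ⟨r, hr, this.2⟩))⟩
    · have := (hH.good j hj).ord_gates x g h h'
      exact ⟨mem_envGates.2 (.inr (.inr (mem_simGates.2 ⟨j, hj, this.1⟩))),
        mem_envGates.2 (.inr (.inr (mem_simGates.2 ⟨j, hj, this.2⟩)))⟩
    · exact h'.2
  ord_local := by
    intro x y hxy g h
    refine or_congr (hE.valid.ord_local x y (fun ρ hρ => hxy ρ (hE.regs_subset hρ)) g h)
      (or_congr (exists_congr fun r => and_congr_right fun hr => ?_)
        (or_congr (exists_congr fun j => and_congr_right fun hj => ?_) Iff.rfl))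
    -- The ordering of a circuit depends on private registers; these are storage and not
    -- input/output channels, so the environment owns them.
    · refine (rolesOutside_wf hT hr).ord_local x y (fun ρ hρ => hxy ρ ?_) g h
      refine (hH.rolesOutside_access hT hq hc hr (Role.mem_regs.2 (.inl hρ))).resolve_right
        fun hio => (hT.io_link hio).kind_ne.1 ((rolesOutside_wf hT hr).priv_kind ρ hρ)
    · exact (hH.good j hj).ord_local x y
        (fun ρ hρ => hxy ρ (hH.sim_simRegs_subset hT hq hj hρ)) g h
  cross_pairs g h := by
    rintro ⟨hgh, hnot⟩
    obtain ⟨hg, hh, hshare, -, hroles⟩ := hH.cross_pairs g h hgh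
    rw [← env_withProtocol hq hc] at hg hh
    have hroles' : ∀ r ∈ (T.tilde q).roles, ¬ (g ∈ r.gates ∧ h ∈ r.gates) := fun r hr =>
      hroles r ((roles_iff hq hc).2 (.inr hr))
    rcases Finset.mem_union.1 hg with hg | hg <;> rcases Finset.mem_union.1 hh with hh | hh
    · exact absurd ⟨hg, hh⟩ hnot
    · exact .inl ⟨hg, hh, hshare⟩
    · exact .inr (.inl ⟨hg, hh, hshare⟩)
    · refine .inr (.inr ⟨hg, hh, ?_, hroles'⟩)
      -- Both gates belong to `tilde q`, but to different circuits, so their common register is a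
      -- channel.
      obtain ⟨ρ, hρg, hρh⟩ := hshare
      obtain ⟨r, hr, hg⟩ := Protocol.mem_gates.1 hg
      obtain ⟨s, hs, hh⟩ := Protocol.mem_gates.1 hh
      refine ⟨ρ, hT.tilde_roles_regs hr hs ?_ ((hT.tilde_role hr).gate_regs hg hρg)
        ((hT.tilde_role hs).gate_regs hh hρh), hρg, hρh⟩
      rintro rfl
      exact hroles' r hr ⟨hg, hh⟩
  isCircuit := by
    rw [env_withProtocol hq hc]
    exact hH.isCircuit

/-- Replacing one more sub-protocol. -/
theorem next (hT : T.WellFormed) (hE : Fresh T E) (hq : q ∉ H.done)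
    (hc : ∀ i, T.parent i = some q → i ∈ H.done) {S : OpenCircuit}
    (hS : S.ValidSimulator (H.env E q) (T.tilde q) (T.ideal q)) (hsize : (S.size : ℕ∞) ≤ b q)
    (hSg : Disjoint S.gates T.allGates) : (H.next E q S).Invariant E b where
  closed j p hjp hp := by
    rcases Finset.mem_insert.1 hp with rfl | hp
    · exact Finset.mem_insert_of_mem (hc j hjp)
    · exact Finset.mem_insert_of_mem (hH.closed j p hjp hp)
  good j hj := by
    change GoodSim T E b j (Function.update H.sim q S j)
    rcases Finset.mem_insert.1 hj with rfl | hj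
    · rw [Function.update_self]
      exact
      { regs_env := hS.regs_disjoint.1.mono_right fun ρ hρ => hE.regs_subset hρ
        regs_tree := by
          rw [Finset.disjoint_left]
          intro ρ hρ hρT
          -- Every register of the tree belongs to `tilde j`, to `I(j)` or to the environment, and
          -- the registers of `S` avoid all three.
          by_cases h₁ : ρ ∈ (T.tilde j).regs
          · exact Finset.disjoint_left.1 hS.regs_disjoint.2.1 hρ h₁
          by_cases h₂ : ρ ∈ (T.ideal j).regs
          · exact Finset.disjoint_left.1 hS.regs_disjoint.2.2 hρ h₂
          exact Finset.disjoint_left.1 hS.regs_disjoint.1 hρ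
            (mem_env_regs (.inr (.inl hρT)) h₁ h₂)
        gates_env := hS.gates_disjoint.1.mono_right fun g hg => mem_envGates.2 (.inl hg)
        gates_tree := hSg
        write := hS.write
        read := hS.read
        ord_gates := hS.ord_gates
        ord_local := hS.ord_local
        size := hsize }
    · rw [Function.update_of_ne fun e : j = q => hq (e ▸ hj)]
      exact hH.good j hj
  cross_pairs g h hgh := by
    have hset : ∀ {g}, g ∈ ((H.next E q S).setting E).gates ↔
        (g ∈ H.envGates E q ∨ g ∈ (T.ideal q).gates) ∨ g ∈ S.gates := by
      intro g
      rw [← env_withIdeal hq hH.closed]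
      change g ∈ H.envGates E q ∪ (T.ideal q).gates ∪ S.gates ↔ _
      rw [Finset.mem_union, Finset.mem_union]
    have hIE : ∀ {g}, g ∈ (T.ideal q).gates → g ∉ E.gates := fun h h' =>
      Finset.disjoint_left.1 hE.gates h' (ideal_gates_subset h)
    have hSE : ∀ {g}, g ∈ S.gates → g ∉ E.gates := fun h h' =>
      Finset.disjoint_left.1 hS.gates_disjoint.1 h (mem_envGates.2 (.inl h'))
    have hrS : ∀ {r g}, r ∈ (H.next E q S).roles → g ∈ r.gates → g ∉ S.gates := by
      intro r g hr hg hgS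
      rcases (next_roles_iff hq hH.closed S).1 hr with hr | hr
      · exact Finset.disjoint_left.1 hSg hgS (rolesOutside_subset hr hg)
      · exact Finset.disjoint_left.1 hSg hgS
          (ideal_gates_subset (Protocol.mem_gates.2 ⟨r, hr, hg⟩))
    have hdisj : ∀ {g}, g ∈ H.envGates E q → g ∉ (T.ideal q).gates := fun h h' =>
      Finset.disjoint_left.1 (hH.envGates_disjoint_ideal hT hE hq) h h'
    have hmixed : ∀ {r g h}, r ∈ (H.next E q S).roles → g ∈ H.envGates E q →
        h ∈ (T.ideal q).gates → ¬ (g ∈ r.gates ∧ h ∈ r.gates) := by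
      rintro r g h hr hg hh ⟨hgr, hhr⟩
      rcases (next_roles_iff hq hH.closed S).1 hr with hr | hr
      · exact hdisj (mem_envGates.2 (.inr (.inl ⟨r, hr, hhr⟩))) hh
      · exact hdisj hg (Protocol.mem_gates.2 ⟨r, hr, hgr⟩)
    rw [hset, hset]
    rcases hgh with ⟨hgh, hg, hh⟩ | hgh
    · obtain ⟨-, -, hshare, hEE, hroles⟩ := hH.cross_pairs g h hgh
      refine ⟨.inl (.inl hg), .inl (.inl hh), hshare, hEE, fun r hr => ?_⟩
      rcases (next_roles_iff hq hH.closed S).1 hr with hr | hr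
      · exact hroles r ((roles_iff hq hc).2 (.inl hr))
      · exact fun h' => hdisj hg (Protocol.mem_gates.2 ⟨r, hr, h'.1⟩)
    · rcases hS.cross_pairs g h hgh with ⟨hg, hh, hs⟩ | ⟨hg, hh, hs⟩ | ⟨hg, hh, hs⟩ |
        ⟨hg, hh, hs⟩ | ⟨hg, hh, hs, hr⟩
      · exact ⟨.inr hg, .inl (Finset.mem_union.1 hh), hs, fun h' => hSE hg h'.1,
          fun r hr h' => hrS hr h'.1 hg⟩
      · exact ⟨.inl (Finset.mem_union.1 hg), .inr hh, hs, fun h' => hSE hh h'.2,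
          fun r hr h' => hrS hr h'.2 hh⟩
      · exact ⟨.inl (.inl hg), .inl (.inr hh), hs, fun h' => hIE hh h'.2,
          fun r hr h' => hmixed hr hg hh h'⟩
      · exact ⟨.inl (.inr hg), .inl (.inl hh), hs, fun h' => hIE hg h'.1,
          fun r hr h' => hmixed hr hh hg h'.symm⟩
      · refine ⟨.inl (.inr hg), .inl (.inr hh), ?_, fun h' => hIE hg h'.1, fun r hr' h' => ?_⟩
        · obtain ⟨ρ, -, hρ⟩ := hs
          exact ⟨ρ, hρ⟩
        · rcases (next_roles_iff hq hH.closed S).1 hr' with hr' | hr'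
          · exact hdisj (mem_envGates.2 (.inr (.inl ⟨r, hr', h'.1⟩))) hg
          · exact hr r hr' h'
  isCircuit := by
    rw [← env_withIdeal hq hH.closed]
    exact hS.isCircuit

end Invariant

end Hybrid

/-! ### The combined simulator and the sizes of the environments -/

open ProtocolTree Classical

namespace Hybrid

variable {T : ProtocolTree} {H : Hybrid T} {E : Environment} {q : T.Node} {b : T.Node → ℕ∞}

variable (H E) in
/-- The simulator for the whole tree. -/
def total : OpenCircuit where
  regs := (T.allRegs ∪ H.done.biUnion fun j => (H.sim j).regs) \
    (T.protocol.regs ∪ (T.ideal T.root).regs)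
  gates := H.simGates
  ord x g h := (∃ j ∈ H.done, (H.sim j).ord x g h) ∨
    (H.cross g h ∧ g ∈ H.simGates ∧ h ∈ H.simGates)
  cross g h := H.cross g h ∧ ¬ (g ∈ H.simGates ∧ h ∈ H.simGates)

/-- Only the root has no parent, so it alone forms the front. -/
theorem roles_iff_of_all (hall : ∀ j, j ∈ H.done) {r : Role} :
    r ∈ H.roles ↔ r ∈ (T.ideal T.root).roles := by
  rw [mem_roles]
  constructor
  · rintro (⟨j, hj, -⟩ | ⟨k, hk, hr⟩)
    · exact absurd (hall j) hj
    · obtain rfl : k = T.root := by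
        by_contra hne
        obtain ⟨p, hp, -⟩ := (below_root k).exists_parent hne
        exact (mem_front.1 hk).2 p hp (hall p)
      exact hr
  · intro hr
    refine .inr ⟨T.root, mem_front.2 ⟨hall _, fun p hp => ?_⟩, hr⟩
    rw [T.parent_root] at hp
    cases hp

theorem withIdeal_total (hall : ∀ j, j ∈ H.done) :
    E.withIdeal (T.ideal T.root) H.total = H.setting E := by
  apply Setting.ext_fields
  · ext g
    change g ∈ E.gates ∪ (T.ideal T.root).gates ∪ H.simGates ↔ _
    rw [mem_setting_gates, Finset.mem_union, Finset.mem_union, Protocol.mem_gates, or_assoc]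
    simp only [roles_iff_of_all hall]
  · intro x g h
    change _ ∨ (_ ∨ _) ∨ (_ ∧ _) ∨ _ ↔ _ ∨ _ ∨ _ ∨ _
    simp only [roles_iff_of_all hall]
    generalize (∃ r ∈ (T.ideal T.root).roles, r.ord x g h) = a
    generalize (∃ j ∈ H.done, (H.sim j).ord x g h) = b
    tauto
  · rfl

theorem protocol_regs_subset {ρ : Reg} (h : ρ ∈ T.protocol.regs) : ρ ∈ T.allRegs := by
  rcases Protocol.mem_regs.1 h with ⟨r, hr, h⟩ | h
  · obtain ⟨j, hr⟩ := mem_protocol_roles.1 hr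
    exact mem_allRegs.2 ⟨j, .inl (mem_main_regs hr h)⟩
  · exact ideal_regs_subset (Protocol.mem_regs_of_io (P := T.ideal T.root) h)

theorem mem_total_regs {ρ : Reg} (h : ρ ∈ T.allRegs ∨ ∃ j ∈ H.done, ρ ∈ (H.sim j).regs)
    (h₁ : ρ ∉ T.protocol.regs) (h₂ : ρ ∉ (T.ideal T.root).regs) : ρ ∈ H.total.regs := by
  refine Finset.mem_sdiff.2 ⟨?_, fun h => (Finset.mem_union.1 h).elim h₁ h₂⟩
  simpa using h

namespace Invariant

/-- The access rules follow from `simAccess_root`. Orderings between gates of simulators for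
different nodes have become internal to the combined simulator. -/
theorem total_valid (hH : H.Invariant E b) (hT : T.WellFormed) (hE : Fresh T E)
    (hall : ∀ j, j ∈ H.done) : H.total.ValidSimulator E T.protocol (T.ideal T.root) := by
  have hA : ∀ j, ∀ ρ ∈ (H.sim j).regs, ρ ∈ H.total.regs := fun j ρ hρ => by
    have := Finset.disjoint_left.1 (hH.good j (hall j)).regs_tree hρ
    exact mem_total_regs (.inr ⟨j, hall j, hρ⟩) (fun h => this (protocol_regs_subset h))
      fun h => this (ideal_regs_subset h)
  have hB : ∀ ρ ∈ T.allRegs, ρ ∉ T.protocol.regs → ρ ∉ (T.ideal T.root).regs →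
      ρ ∈ H.total.regs := fun ρ h => mem_total_regs (.inl h)
  exact
  { regs_disjoint := by
      refine ⟨?_, ?_, ?_⟩ <;> rw [Finset.disjoint_left] <;> intro ρ hρ h
      · rcases Finset.mem_union.1 (Finset.mem_sdiff.1 hρ).1 with hρ | hρ
        · exact Finset.disjoint_left.1 hE.regs h hρ
        · obtain ⟨j, hj, hρ⟩ := Finset.mem_biUnion.1 hρ
          exact Finset.disjoint_left.1 (hH.good j hj).regs_env hρ h
      · exact (Finset.mem_sdiff.1 hρ).2 (Finset.mem_union_left _ h)
      · exact (Finset.mem_sdiff.1 hρ).2 (Finset.mem_union_right _ h)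
    gates_disjoint := by
      refine ⟨?_, ?_⟩ <;> rw [Finset.disjoint_left] <;> intro g hg h <;>
        obtain ⟨j, hj, hg⟩ := mem_simGates.1 hg
      · exact Finset.disjoint_left.1 (hH.good j hj).gates_env hg h
      · exact Finset.disjoint_left.1 (hH.good j hj).gates_tree hg (ideal_gates_subset h)
    write := fun g hg ρ hρ => by
      obtain ⟨j, hj, hg⟩ := mem_simGates.1 hg
      -- For writing, `c` is `False`, which excludes the corruption registers.
      rcases hT.simAccess_root j (hA j) hB ((hH.good j hj).write g hg ρ hρ).simAccess with
        h | h | h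
      · exact .inl h
      · exact h.1.elim
      · exact .inr h
    read := fun g hg ρ hρ => by
      obtain ⟨j, hj, hg⟩ := mem_simGates.1 hg
      exact (hT.simAccess_root j (hA j) hB ((hH.good j hj).read g hg ρ hρ).simAccess).imp_right
        (Or.imp_left And.right)
    ord_gates := by
      rintro x g h (⟨j, hj, h'⟩ | h')
      · have := (hH.good j hj).ord_gates x g h h'
        exact ⟨mem_simGates.2 ⟨j, hj, this.1⟩, mem_simGates.2 ⟨j, hj, this.2⟩⟩
      · exact h'.2
    ord_local := by
      intro x y hxy g h
      refine or_congr (exists_congr fun j => and_congr_right fun hj => ?_) Iff.rfl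
      refine (hH.good j hj).ord_local x y (fun ρ hρ => hxy ρ ?_) g h
      exact hT.simulated_root (hA j) hB hρ
    cross_pairs := by
      rintro g h ⟨hgh, hnot⟩
      obtain ⟨hg, hh, hs, hEE, hroles⟩ := hH.cross_pairs g h hgh
      have hroles' : ∀ r ∈ (T.ideal T.root).roles, ¬ (g ∈ r.gates ∧ h ∈ r.gates) := fun r hr =>
        hroles r ((roles_iff_of_all hall).2 hr)
      have hset : ∀ {g}, g ∈ (H.setting E).gates →
          g ∈ E.gates ∨ g ∈ (T.ideal T.root).gates ∨ g ∈ H.simGates := by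
        intro g hg
        rw [← withIdeal_total hall] at hg
        change g ∈ E.gates ∪ (T.ideal T.root).gates ∪ H.simGates at hg
        rwa [Finset.mem_union, Finset.mem_union, or_assoc] at hg
      rcases hset hg with hg | hg | hg <;> rcases hset hh with hh | hh | hh
      · exact absurd ⟨hg, hh⟩ hEE
      · exact .inr (.inr (.inl ⟨hg, hh, hs⟩))
      · exact .inr (.inl ⟨Finset.mem_union_left _ hg, hh, hs⟩)
      · exact .inr (.inr (.inr (.inl ⟨hg, hh, hs⟩)))
      · refine .inr (.inr (.inr (.inr ⟨hg, hh, ?_, hroles'⟩)))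
        obtain ⟨ρ, hρg, hρh⟩ := hs
        obtain ⟨r, hr, hg⟩ := Protocol.mem_gates.1 hg
        obtain ⟨s, hs, hh⟩ := Protocol.mem_gates.1 hh
        have hwf := hT.ideal_wf T.root
        refine ⟨ρ, hwf.roles_regs r hr s hs ?_ ρ ((hwf.roles_wf r hr).gate_regs hg hρg)
          ((hwf.roles_wf s hs).gate_regs hh hρh), hρg, hρh⟩
        rintro rfl
        exact hroles' r hr ⟨hg, hh⟩
      · exact .inr (.inl ⟨Finset.mem_union_right _ hg, hh, hs⟩)
      · exact .inl ⟨hg, Finset.mem_union_left _ hh, hs⟩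
      · exact .inl ⟨hg, Finset.mem_union_right _ hh, hs⟩
      · exact absurd ⟨hg, hh⟩ hnot
    isCircuit := by
      rw [withIdeal_total hall]
      exact hH.isCircuit }

theorem simGates_size (hH : H.Invariant E b) : (gatesSize H.simGates : ℕ∞) ≤ ∑ q, b q := by
  calc (gatesSize H.simGates : ℕ∞) ≤ ((∑ j ∈ H.done, (H.sim j).size : ℕ) : ℕ∞) := by
        exact_mod_cast gatesSize_biUnion_le _ _
    _ = ∑ j ∈ H.done, ((H.sim j).size : ℕ∞) := by push_cast; rfl
    _ ≤ ∑ j ∈ H.done, b j := Finset.sum_le_sum fun j hj => (hH.good j hj).size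
    _ ≤ ∑ q, b q := Finset.sum_le_sum_of_subset (Finset.subset_univ _)

/-- The bound is the same for all nodes and stages. This is where it matters that the size of a
simulator does not depend on its environment. -/
theorem env_size (hH : H.Invariant E b) : ((H.env E q).size : ℕ∞) ≤
    E.size + ((∑ j, ((T.tilde j).size + (T.ideal j).size) : ℕ) : ℕ∞) + ∑ q, b q := by
  have h₁ : (H.rolesOutside q).biUnion Role.gates ⊆
      Finset.univ.biUnion fun j => (T.tilde j).gates ∪ (T.ideal j).gates := by
    intro g hg
    obtain ⟨r, hr, hg⟩ := Finset.mem_biUnion.1 hg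
    rw [Finset.mem_biUnion]
    rcases mem_rolesOutside.1 hr with ⟨j, _, hr⟩ | ⟨k, _, hr⟩
    · exact ⟨j, Finset.mem_univ _, Finset.mem_union_left _
        (Protocol.mem_gates.2 ⟨r, mem_tilde_roles.2 (.inl hr), hg⟩)⟩
    · exact ⟨k, Finset.mem_univ _, Finset.mem_union_right _ (Protocol.mem_gates.2 ⟨r, hr, hg⟩)⟩
  have h₂ : gatesSize ((H.rolesOutside q).biUnion Role.gates) ≤
      ∑ j, ((T.tilde j).size + (T.ideal j).size) :=
    (gatesSize_mono h₁).trans ((gatesSize_biUnion_le _ _).trans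
      (Finset.sum_le_sum fun j _ => gatesSize_union_le _ _))
  have h₃ : (H.env E q).size ≤ E.size + (∑ j, ((T.tilde j).size + (T.ideal j).size)) +
      gatesSize H.simGates :=
    (gatesSize_union_le _ _).trans (Nat.add_le_add_right
      ((gatesSize_union_le _ _).trans (Nat.add_le_add_left h₂ _)) _)
  calc ((H.env E q).size : ℕ∞) ≤ ((E.size + (∑ j, ((T.tilde j).size + (T.ideal j).size)) +
      gatesSize H.simGates : ℕ) : ℕ∞) := by exact_mod_cast h₃
    _ = E.size + ((∑ j, ((T.tilde j).size + (T.ideal j).size) : ℕ) : ℕ∞) +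
      (gatesSize H.simGates : ℕ∞) := by rw [Nat.cast_add, Nat.cast_add]
    _ ≤ _ := by gcongr; exact hH.simGates_size

end Invariant

/-! ### The initial hybrid setting -/

variable (T E) in
/-- The hybrid setting in which nothing has been replaced. -/
def start : Hybrid T where
  done := ∅
  sim _ := ⟨∅, ∅, fun _ _ _ => False, fun _ _ => False⟩
  cross := E.cross

theorem start_roles {r : Role} : r ∈ (start T E).roles ↔ r ∈ T.protocol.roles := by
  rw [mem_roles, mem_protocol_roles]
  simp [start, mem_front]

theorem start_setting : (start T E).setting E = E.withProtocol T.protocol := by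
  apply Setting.ext_fields
  · ext g
    rw [mem_setting_gates, mem_simGates]
    change _ ↔ g ∈ E.gates ∪ T.protocol.gates
    rw [Finset.mem_union, Protocol.mem_gates]
    simp only [start_roles]
    simp [start]
  · intro x g h
    change _ ∨ _ ∨ _ ∨ _ ↔ _ ∨ _ ∨ _
    simp only [start_roles]
    simp only [start, Finset.notMem_empty, false_and, exists_false, false_or]
    exact or_congr Iff.rfl or_comm
  · rfl

theorem start_invariant (hE : Fresh T E) : (start T E).Invariant E b where
  closed j p _ hp := by simp [start] at hp
  good j hj := by simp [start] at hj
  cross_pairs g h hgh := by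
    have hP : ∀ {g}, g ∈ T.protocol.gates → g ∉ E.gates := fun h h' =>
      Finset.disjoint_left.1 hE.valid.gates_disjoint h' h
    rw [start_setting]
    change g ∈ E.gates ∪ T.protocol.gates ∧ h ∈ E.gates ∪ T.protocol.gates ∧ _
    simp only [start_roles]
    have hr : ∀ {r g}, r ∈ T.protocol.roles → g ∈ r.gates → g ∉ E.gates := fun hr hg =>
      hP (Protocol.mem_gates.2 ⟨_, hr, hg⟩)
    rcases hE.valid.cross_pairs g h hgh with ⟨hg, hh, hs⟩ | ⟨hg, hh, hs⟩ | ⟨hg, hh, hs, hr'⟩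
    · exact ⟨Finset.mem_union_left _ hg, Finset.mem_union_right _ hh, hs, fun h' => hP hh h'.2,
        fun r h h' => hr h h'.1 hg⟩
    · exact ⟨Finset.mem_union_right _ hg, Finset.mem_union_left _ hh, hs, fun h' => hP hg h'.1,
        fun r h h' => hr h h'.2 hh⟩
    · obtain ⟨ρ, -, hρ⟩ := hs
      exact ⟨Finset.mem_union_right _ hg, Finset.mem_union_right _ hh, ⟨ρ, hρ⟩,
        fun h' => hP hg h'.1, hr'⟩
  isCircuit := by
    rw [start_setting]
    exact hE.valid.isCircuit

end Hybrid

/-! ## Composition -/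

namespace ProtocolTree.WellFormed

variable {T : ProtocolTree} (hT : T.WellFormed) {b : T.Node → ℕ∞} {ε : T.Node → ℕ → ℝ}
include hT

/-- One more sub-protocol can be replaced. -/
theorem hybrid_step
    (h : ∀ q (E : Environment), E.Valid (T.tilde q) → E.Avoids (T.ideal q) →
      ∃ S : OpenCircuit, S.ValidSimulator E (T.tilde q) (T.ideal q) ∧ (S.size : ℕ∞) ≤ b q ∧
        Close (E.withProtocol (T.tilde q)) (E.withIdeal (T.ideal q) S) (ε q E.size))
    {E : Environment} (hE : Fresh T E) (H : Hybrid T) (hH : H.Invariant E b)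
    (hne : (Finset.univ \ H.done).Nonempty) :
    ∃ (q : T.Node) (H' : Hybrid T), q ∉ H.done ∧ H'.done = insert q H.done ∧ H'.Invariant E b ∧
      Close (H.setting E) (H'.setting E) (ε q (H.env E q).size) := by
  -- A lowest node outside `done`: by minimality its children are all in `done`.
  obtain ⟨q, hq, hmin⟩ := exists_forall_not_lt (fun a b => T.Below a b ∧ a ≠ b)
    (fun a b c h h' => ⟨h.1.trans h'.1, fun e => h.2 (h.1.antisymm (e ▸ h'.1))⟩)
    (fun a h => h.2 rfl) hne
  replace hq : q ∉ H.done := (Finset.mem_sdiff.1 hq).2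
  have hc : ∀ i, T.parent i = some q → i ∈ H.done := fun i hi => by
    by_contra hid
    refine hmin i (Finset.mem_sdiff.2 ⟨Finset.mem_univ _, hid⟩) ⟨below_of_parent hi, ?_⟩
    rintro rfl
    exact not_below_of_parent hi (Below.refl i)
  have hval := hH.env_valid hT hE hq hc
  obtain ⟨S, hS, hb, hclose⟩ := h q (H.env E q) hval (hH.env_avoids hT hE hq)
  -- The rules would allow gates of `S` that coincide with gates of ideal protocols entering later;
  -- renumbering prevents this.
  obtain ⟨S', hS', hsize, hdisj, hclose'⟩ :=
    hS.exists_fresh (hT.ideal_wf q).roles_wf hval.ord_gates T.allGates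
  refine ⟨q, H.next E q S', hq, rfl, hH.next hT hE hq hc hS' (hsize ▸ hb) hdisj, ?_⟩
  rw [← Hybrid.env_withIdeal hq hH.closed, ← Hybrid.env_withProtocol hq hc]
  exact hclose' _ _ hclose

/-- All remaining sub-protocols can be replaced. -/
theorem simulator_of_hybrid
    (h : ∀ q (E : Environment), E.Valid (T.tilde q) → E.Avoids (T.ideal q) →
      ∃ S : OpenCircuit, S.ValidSimulator E (T.tilde q) (T.ideal q) ∧ (S.size : ℕ∞) ≤ b q ∧
        Close (E.withProtocol (T.tilde q)) (E.withIdeal (T.ideal q) S) (ε q E.size))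
    {E : Environment} (hE : Fresh T E) (A : Setting) (M : ℕ∞)
    (hM : M = E.size + ((∑ j, ((T.tilde j).size + (T.ideal j).size) : ℕ) : ℕ∞) + ∑ q, b q)
    (k : ℕ) (H : Hybrid T) (hH : H.Invariant E b) (hk : (Finset.univ \ H.done).card = k + 1)
    (m : T.Node → ℕ) (hm : ∀ q ∈ H.done, (m q : ℕ∞) ≤ M)
    (hA : ∀ B δ, Close (H.setting E) B δ → Close A B (∑ q ∈ H.done, ε q (m q) + δ)) :
    ∃ (S : OpenCircuit) (m : T.Node → ℕ), S.ValidSimulator E T.protocol (T.ideal T.root) ∧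
      (S.size : ℕ∞) ≤ ∑ q, b q ∧ (∀ q, (m q : ℕ∞) ≤ M) ∧
      Close A (E.withIdeal (T.ideal T.root) S) (∑ q, ε q (m q)) := by
  -- The errors so far are carried by `hA`, and the last step is taken with `k = 0`, one node
  -- remaining. Thus `Close A A 0` is never needed, which would say that the probability does not
  -- depend on the schedule.
  induction k using Nat.strong_induction_on generalizing H m with
  | _ k ih =>
    obtain ⟨q, H', hq, hdone, hH', hclose⟩ := hT.hybrid_step h hE H hH
      (Finset.card_pos.1 (by omega))
    have hcard : (Finset.univ \ H'.done).card = k := by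
      have hd : Finset.univ \ H'.done = (Finset.univ \ H.done).erase q := by
        ext j
        simp [hdone]
      rw [hd, Finset.card_erase_of_mem (by simpa using hq), hk]
      rfl
    -- `m` records for each node the size of the environment against which its simulator was chosen;
    -- the error is evaluated there.
    let m' := Function.update m q (H.env E q).size
    have hm' : ∀ j ∈ H'.done, (m' j : ℕ∞) ≤ M := by
      intro j hj
      by_cases hjq : j = q
      · subst hjq
        rw [show m' j = _ from Function.update_self _ _ _, hM]
        exact hH.env_size
      · rw [show m' j = m j from Function.update_of_ne hjq _ _]
        rw [hdone] at hj
        exact hm j (Finset.mem_of_mem_insert_of_ne hj hjq)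
    have hsum : ∑ j ∈ H'.done, ε j (m' j) =
        ∑ j ∈ H.done, ε j (m j) + ε q (H.env E q).size := by
      rw [hdone, Finset.sum_insert hq, add_comm, show m' q = _ from Function.update_self _ _ _]
      congr 1
      refine Finset.sum_congr rfl fun j hj => ?_
      rw [show m' j = m j from Function.update_of_ne (fun e : j = q => hq (e ▸ hj)) _ _]
    rcases k with _ | k
    · have hall : H'.done = Finset.univ := by
        rw [Finset.card_eq_zero, Finset.sdiff_eq_empty_iff_subset] at hcard
        exact Finset.univ_subset_iff.1 hcard
      have hall' : ∀ j, j ∈ H'.done := fun j => hall ▸ Finset.mem_univ j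
      refine ⟨H'.total, m', hH'.total_valid hT hE hall', hH'.simGates_size,
        fun j => hm' j (hall' j), ?_⟩
      rw [Hybrid.withIdeal_total hall', ← hall, hsum]
      exact hA _ _ hclose
    · refine ih k (Nat.lt_succ_self k) H' hH' hcard m' hm' fun B δ hB => ?_
      rw [hsum, add_assoc]
      exact hA _ _ (hclose.trans hH'.isCircuit hB)

theorem exists_simulator
    (h : ∀ q (E : Environment), E.Valid (T.tilde q) → E.Avoids (T.ideal q) →
      ∃ S : OpenCircuit, S.ValidSimulator E (T.tilde q) (T.ideal q) ∧ (S.size : ℕ∞) ≤ b q ∧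
        Close (E.withProtocol (T.tilde q)) (E.withIdeal (T.ideal q) S) (ε q E.size))
    {E : Environment} (hE : E.Valid T.protocol) (hEI : E.Avoids (T.ideal T.root)) :
    ∃ (S : OpenCircuit) (m : T.Node → ℕ), S.ValidSimulator E T.protocol (T.ideal T.root) ∧
      (S.size : ℕ∞) ≤ ∑ q, b q ∧
      (∀ q, (m q : ℕ∞) ≤
        E.size + ((∑ j, ((T.tilde j).size + (T.ideal j).size) : ℕ) : ℕ∞) + ∑ q, b q) ∧
      Close (E.withProtocol T.protocol) (E.withIdeal (T.ideal T.root) S) (∑ q, ε q (m q)) := by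
  -- `Q` packs the size bounds and the form of the error, so that they survive the passage to fresh
  -- names.
  obtain ⟨S, δ, h₁, ⟨h₂, m, h₃, rfl⟩, h₄⟩ := simulates_of_fresh
    (Q := fun s δ => (s : ℕ∞) ≤ ∑ q, b q ∧ ∃ m : T.Node → ℕ, (∀ q, (m q : ℕ∞) ≤
        E.size + ((∑ j, ((T.tilde j).size + (T.ideal j).size) : ℕ) : ℕ∞) + ∑ q, b q) ∧
        δ = ∑ q, ε q (m q))
    (fun r => hT.protocol_role) (hT.ideal_wf T.root).roles_wf T.allRegs T.allGates hE hEI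
    fun E' hE' _ hr hg hs => by
      have hF : Fresh T E' := ⟨hE', hr, hg⟩
      have hcard : (Finset.univ \ (Hybrid.start T E').done).card =
          (Fintype.card T.Node - 1) + 1 := by
        have : 0 < Fintype.card T.Node := Fintype.card_pos_iff.2 ⟨T.root⟩
        simp only [Hybrid.start, Finset.sdiff_empty, Finset.card_univ]
        omega
      obtain ⟨S, m, h₁, h₂, h₃, h₄⟩ := hT.simulator_of_hybrid h hF (E'.withProtocol T.protocol) _
        rfl _ (Hybrid.start T E') (Hybrid.start_invariant hF) hcard (fun _ => 0)
        (fun q hq => by simp [Hybrid.start] at hq) (fun B δ hB => by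
          rw [Hybrid.start_setting] at hB
          simpa [Hybrid.start] using hB)
      rw [hs] at h₃
      exact ⟨S, _, h₁, ⟨h₂, m, h₃, rfl⟩, h₄⟩
  exact ⟨S, m, h₁, h₂, h₃, h₄⟩

end ProtocolTree.WellFormed

/-! ## Negligible functions -/

/-- An error need not be monotone in the size of the environment; it is replaced by its maximum over
all sizes up to `k`, which is attained at an admissible size. -/
theorem exists_argmax (f : ℕ → ℝ) (k : ℕ) :
    ∃ a ≤ k, ∀ m ≤ k, f m ≤ f a := by
  obtain ⟨a, ha, h⟩ := (Finset.range (k + 1)).exists_max_image f ⟨0, by simp⟩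
  exact ⟨a, Nat.lt_succ_iff.1 (Finset.mem_range.1 ha),
    fun m hm => h m (Finset.mem_range.2 (Nat.lt_succ_of_le hm))⟩

theorem eventually_eval_mul_two_rpow_le (c : Polynomial ℕ) {α : ℝ} (hα : 0 < α) :
    ∀ᶠ n : ℕ in Filter.atTop, ((c.eval n : ℕ) : ℝ) * (2 : ℝ) ^ (-(α * (n : ℝ))) ≤ 1 := by
  have hβ : 0 < Real.log 2 * α := mul_pos (Real.log_pos one_lt_two) hα
  set β := Real.log 2 * α
  -- Rescaled so that `p (β n) = c n`, with `exp (β n) = 2 ^ (α n)`.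
  set p : Polynomial ℝ := (c.map (Nat.castRingHom ℝ)).comp (Polynomial.C β⁻¹ * Polynomial.X)
  have h₁ : Filter.Tendsto (fun n : ℕ => β * (n : ℝ)) Filter.atTop Filter.atTop :=
    tendsto_natCast_atTop_atTop.const_mul_atTop hβ
  have h₂ := (Polynomial.tendsto_div_exp_atTop p).comp h₁
  filter_upwards [h₂.eventually_le_const zero_lt_one] with n hn
  have hp : p.eval (β * n) = ((c.eval n : ℕ) : ℝ) := by
    simp only [p, Polynomial.eval_comp, Polynomial.eval_mul, Polynomial.eval_C, Polynomial.eval_X]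
    rw [inv_mul_cancel_left₀ hβ.ne', Polynomial.eval_natCast_map]
    rfl
  simp only [Function.comp, hp] at hn
  rw [Real.rpow_def_of_pos two_pos, mul_neg, Real.exp_neg, ← mul_assoc, ← div_eq_mul_inv]
  exact hn

theorem Negligible.sum {D : Type} [Fintype D] {e : D → ℕ → ℝ} (c : Polynomial ℕ)
    (h : ∀ d, ∀ q : Polynomial ℕ, ∀ᶠ n in Filter.atTop, e d n * ((q.eval n : ℕ) : ℝ) ≤ 1)
    (q : Polynomial ℕ) :
    ∀ᶠ n in Filter.atTop,
      (((c.eval n : ℕ) : ℝ) * ∑ d, max (e d n) 0) * ((q.eval n : ℕ) : ℝ) ≤ 1 := by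
  -- Testing against the larger polynomial `|D| c q` makes each of the `|D|` summands at most `1 /
  -- |D|`.
  have H := Filter.eventually_all.2 fun d => h d (Polynomial.C (Fintype.card D) * c * q)
  filter_upwards [H] with n hn
  rcases isEmpty_or_nonempty D with hD | hD
  · simp
  have hK : (0 : ℝ) < Fintype.card D := by exact_mod_cast Fintype.card_pos
  have key : ∀ d, Fintype.card D * (max (e d n) 0 * (((c.eval n : ℕ) : ℝ) * ((q.eval n : ℕ) : ℝ)))
      ≤ 1 := by
    intro d
    have := hn d
    simp only [Polynomial.eval_mul, Polynomial.eval_C, Nat.cast_mul] at this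
    rcases max_cases (e d n) 0 with ⟨h, -⟩ | ⟨h, -⟩ <;> rw [h]
    · linarith
    · simp
  have := Finset.sum_le_sum fun d (_ : d ∈ Finset.univ) => key d
  rw [← Finset.mul_sum, ← Finset.sum_mul, Finset.sum_const, Finset.card_univ, nsmul_eq_mul] at this
  have := le_of_mul_le_mul_left this hK
  linarith

theorem ExpNegligible.sum {D : Type} [Fintype D] {e : D → ℕ → ℝ} (c : Polynomial ℕ)
    (h : ∀ d, ∃ α : ℝ, 0 < α ∧ ∀ᶠ n : ℕ in Filter.atTop, e d n ≤ (2 : ℝ) ^ (-(α * (n : ℝ)))) :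
    ∃ α : ℝ, 0 < α ∧ ∀ᶠ n : ℕ in Filter.atTop,
      ((c.eval n : ℕ) : ℝ) * ∑ d, max (e d n) 0 ≤ (2 : ℝ) ^ (-(α * (n : ℝ))) := by
  choose α hα h using h
  -- Half of the smallest exponent: of the two factors `2 ^ (-γ n)`, one absorbs `|D| c(n)` and the
  -- other remains as the bound.
  obtain ⟨γ, hγ, hγα⟩ : ∃ γ : ℝ, 0 < γ ∧ ∀ d, 2 * γ ≤ α d := by
    rcases isEmpty_or_nonempty D with hD | hD
    · exact ⟨1, one_pos, fun d => (hD.false d).elim⟩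
    · obtain ⟨d, hd⟩ := Finite.exists_min α
      exact ⟨α d / 2, half_pos (hα d), fun d' => by linarith [hd d']⟩
  refine ⟨γ, hγ, ?_⟩
  filter_upwards [Filter.eventually_all.2 h,
    eventually_eval_mul_two_rpow_le (Polynomial.C (Fintype.card D) * c) hγ] with n hn hc
  simp only [Polynomial.eval_mul, Polynomial.eval_C, Nat.cast_mul] at hc
  have hpos : (0 : ℝ) < (2 : ℝ) ^ (-(γ * (n : ℝ))) := Real.rpow_pos_of_pos two_pos _
  have key : ∀ d, max (e d n) 0 ≤ (2 : ℝ) ^ (-(γ * (n : ℝ))) * (2 : ℝ) ^ (-(γ * (n : ℝ))) := by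
    intro d
    refine max_le ((hn d).trans ?_) (mul_pos hpos hpos).le
    rw [← Real.rpow_add two_pos]
    refine Real.rpow_le_rpow_of_exponent_le one_le_two ?_
    have := mul_le_mul_of_nonneg_right (hγα d) (Nat.cast_nonneg (α := ℝ) n)
    linarith
  have hs := Finset.sum_le_sum fun d (_ : d ∈ Finset.univ) => key d
  rw [Finset.sum_const, Finset.card_univ, nsmul_eq_mul] at hs
  have h₂ := mul_le_mul_of_nonneg_left hs (Nat.cast_nonneg (α := ℝ) (c.eval n))
  have h₃ := mul_le_mul_of_nonneg_right hc hpos.le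
  linarith

/-- Polynomially many errors taken from finitely many negligible functions, for environments that
are larger by a polynomial, add up to a negligible error. -/
theorem exists_negligible_bound {Neg : (ℕ → ℕ → ℝ) → Prop}
    (hNeg : Neg = Negligible ∨ Neg = ExpNegligible) {D : Type} [Fintype D] {ε : D → ℕ → ℕ → ℝ}
    (hε : ∀ d, Neg (ε d)) (c R : Polynomial ℕ) :
    ∃ δ : ℕ → ℕ → ℝ, Neg δ ∧ ∀ (n k : ℕ) (ι : Type) [Fintype ι] (l : ι → D) (m : ι → ℕ),
      Fintype.card ι ≤ c.eval n → (∀ i, m i ≤ k + R.eval n) → ∑ i, ε (l i) n (m i) ≤ δ n k := by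
  -- The worst size `a` is still polynomially bounded when `k` is, so negligibility applies to it.
  -- Truncation at `0` in `δ` allows summation over all of `D`, even if some errors are negative.
  choose a ha hmax using fun d n k => exists_argmax (ε d n) k
  refine ⟨fun n k => ((c.eval n : ℕ) : ℝ) * ∑ d, max (ε d n (a d n (k + R.eval n))) 0, ?_, ?_⟩
  · have hbound : ∀ (p : Polynomial ℕ) (f : ℕ → ℕ), (∀ n, f n ≤ p.eval n) → ∀ d n,
        a d n (f n + R.eval n) ≤ (p + R).eval n := by
      intro p f hf d n
      rw [Polynomial.eval_add]
      exact (ha d n _).trans (Nat.add_le_add_right (hf n) _)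
    rcases hNeg with rfl | rfl
    · intro p f hf
      exact Negligible.sum c fun d => hε d (p + R) _ (hbound p f hf d)
    · intro p f hf
      exact ExpNegligible.sum c fun d => hε d (p + R) _ (hbound p f hf d)
  · intro n k ι _ l m hcard hm
    calc ∑ i, ε (l i) n (m i)
        ≤ ∑ _i : ι, ∑ d, max (ε d n (a d n (k + R.eval n))) 0 := by
          refine Finset.sum_le_sum fun i _ => ?_
          refine ((hmax (l i) n _ (m i) (hm i)).trans (le_max_left _ 0)).trans ?_
          exact Finset.single_le_sum (f := fun d => max (ε d n (a d n (k + R.eval n))) 0)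
            (fun d _ => le_max_right _ _) (Finset.mem_univ (l i))
      _ = Fintype.card ι * ∑ d, max (ε d n (a d n (k + R.eval n))) 0 := by
          rw [Finset.sum_const, Finset.card_univ, nsmul_eq_mul]
      _ ≤ _ := by
          refine mul_le_mul_of_nonneg_right (by exact_mod_cast hcard)
            (Finset.sum_nonneg fun d _ => le_max_right _ _)

theorem sum_le_eval {ι D : Type} [Fintype ι] [Fintype D] (l : ι → D) (f : ι → ℕ)
    (p : D → Polynomial ℕ) (c : Polynomial ℕ) (n : ℕ) (hcard : Fintype.card ι ≤ c.eval n)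
    (h : ∀ i, f i ≤ (p (l i)).eval n) : ∑ i, f i ≤ (c * ∑ d, p d).eval n := by
  rw [Polynomial.eval_mul, Polynomial.eval_finsetSum]
  calc ∑ i, f i ≤ ∑ _i : ι, ∑ d, (p d).eval n :=
        Finset.sum_le_sum fun i _ => (h i).trans
          (Finset.single_le_sum (f := fun d => (p d).eval n) (fun _ _ => Nat.zero_le _)
            (Finset.mem_univ (l i)))
    _ = Fintype.card ι * ∑ d, (p d).eval n := by
        rw [Finset.sum_const, Finset.card_univ, smul_eq_mul]
    _ ≤ _ := Nat.mul_le_mul_right _ hcard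

theorem ProtocolTree.protocol_size_le (T : ProtocolTree) :
    T.protocol.size ≤ ∑ j, (T.tilde j).size := by
  classical
  refine (gatesSize_mono fun g hg => ?_).trans (gatesSize_biUnion_le Finset.univ
    fun j => (T.tilde j).gates)
  obtain ⟨r, hr, hg⟩ := Protocol.mem_gates.1 hg
  obtain ⟨j, hr⟩ := mem_protocol_roles.1 hr
  exact Finset.mem_biUnion.2 ⟨j, Finset.mem_univ _,
    Protocol.mem_gates.2 ⟨r, mem_tilde_roles.2 (.inl hr), hg⟩⟩

end

theorem theorem1 (T : ℕ → ProtocolTree) (hT : ∀ n, (T n).WellFormed) :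
    -- unconditional scenario
    (∀ (n : ℕ) (ε : (T n).Node → ℝ),
      (∀ q, SecurelyRealizes ((T n).tilde q) ((T n).ideal q) (fun _ => ε q)) →
        SecurelyRealizes (T n).protocol ((T n).ideal (T n).root) (fun _ => ∑ q, ε q)) ∧
    -- computational scenario, for polynomially many copies of finitely many definitions
    (∀ (Neg : (ℕ → ℕ → ℝ) → Prop), Neg = Negligible ∨ Neg = ExpNegligible →
      ∀ (D : Type) (_ : Finite D) (label : (n : ℕ) → (T n).Node → D),
        (∃ p : Polynomial ℕ, ∀ n, Fintype.card (T n).Node ≤ p.eval n) →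
        (∀ d : D, ComputationallyRealizes Neg (κ := fun n => {q : (T n).Node // label n q = d})
          (fun n q => (T n).tilde q.1) (fun n q => (T n).ideal q.1)) →
        ComputationallyRealizes Neg (κ := fun _ => Unit)
          (fun n _ => (T n).protocol) (fun n _ => (T n).ideal (T n).root)) := by
  refine ⟨fun n ε h E hE hEI => ?_, fun Neg hNeg D hD label hcard h => ?_⟩
  -- With the bound `⊤` no condition on sizes remains, and the error does not depend on the recorded
  -- sizes `m`.
  · obtain ⟨S, m, hS, -, -, hclose⟩ := (hT n).exists_simulator (b := fun _ => ⊤)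
      (ε := fun q _ => ε q) (fun q E hE hEI => by
        obtain ⟨S, hS, hclose⟩ := h q E hE hEI
        exact ⟨S, hS, le_top, hclose⟩) hE hEI
    exact ⟨S, hS, hclose⟩
  · have := Fintype.ofFinite D
    obtain ⟨c, hc⟩ := hcard
    choose hP hI ε hε pS hS using h
    choose pP hP using hP
    choose pI hI using hI
    have hP' : ∀ n, ∑ q, ((T n).tilde q).size ≤ (c * ∑ d, pP d).eval n := fun n =>
      sum_le_eval (label n) _ pP c n (hc n) fun q => hP _ n ⟨q, rfl⟩
    have hI' : ∀ n, ∑ q, ((T n).ideal q).size ≤ (c * ∑ d, pI d).eval n := fun n =>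
      sum_le_eval (label n) _ pI c n (hc n) fun q => hI _ n ⟨q, rfl⟩
    have hS' : ∀ n, ∑ q, (pS (label n q)).eval n ≤ (c * ∑ d, pS d).eval n := fun n =>
      sum_le_eval (label n) _ pS c n (hc n) fun q => le_rfl
    -- The three summands bound the total sizes of the `tilde` protocols, the ideal protocols and
    -- the simulators, by which the environments may exceed `E`.
    obtain ⟨δ, hδ, hbound⟩ := exists_negligible_bound hNeg hε c
      (c * ∑ d, pP d + c * ∑ d, pI d + c * ∑ d, pS d)
    refine ⟨⟨_, fun n _ => (T n).protocol_size_le.trans (hP' n)⟩, ⟨_, fun n _ =>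
      (Finset.single_le_sum (f := fun q => ((T n).ideal q).size) (fun _ _ => Nat.zero_le _)
        (Finset.mem_univ (T n).root)).trans (hI' n)⟩, δ, hδ, c * ∑ d, pS d,
        fun n _ E hE hEI => ?_⟩
    obtain ⟨S, m, hval, hsize, hm, hclose⟩ := (hT n).exists_simulator
      (b := fun q => (((pS (label n q)).eval n : ℕ) : ℕ∞))
      (ε := fun q k => ε (label n q) n k) (fun q E hE hEI => by
        obtain ⟨S, hS, hsize, hclose⟩ := hS (label n q) n ⟨q, rfl⟩ E hE hEI
        exact ⟨S, hS, by exact_mod_cast hsize, hclose⟩) hE hEI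
    refine ⟨S, hval, ?_, fun s t => (hclose s t).trans ?_⟩
    · rw [← Nat.cast_sum] at hsize
      exact (Nat.cast_le.1 hsize).trans (hS' n)
    · refine hbound n E.size (T n).Node (label n) m (hc n) fun q => ?_
      have hq := hm q
      rw [← Nat.cast_sum, ← Nat.cast_add, ← Nat.cast_add, Nat.cast_le,
        Finset.sum_add_distrib] at hq
      refine hq.trans ?_
      rw [Polynomial.eval_add, Polynomial.eval_add, add_assoc]
      exact Nat.add_le_add_left (Nat.add_le_add (Nat.add_le_add (hP' n) (hI' n)) (hS' n)) _
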